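/- **Setting.** Let $E\ge 2$, let $a_e:\mathbb R^{d_{e-1}}\times\mathbb R^{n_e}\to\mathbb R^{d_e}$ $(1\le e\le E)$ with $d_E=1$, and let $D$ be a probability distribution on $\mathbb R^{d_0}$ with $\mathbb E_{x\sim D}\|x\|^2<\infty$. For $w=(w_1,\dots,w_E)$ put $y_0=x$, $y_e=a_e(y_{e-1},w_e)$, $L(x;w)=y_E$ and $\ell(w)=\mathbb E_{x\sim D}L(x;w)$, with $\inf_w\ell(w)>-\infty$. Norms are Euclidean, or operator norms for Jacobians; $\nabla_1a_e,\nabla_2a_e$ denote the Jacobians of $a_e$ in its first and second argument. *Assumption 1 (smoothness).* There are constants $L_\ell,C_a,L_a,L_{\nabla a}$ such that: $\ell$ is differentiable with $L_\ell$-Lipschitz gradient; each $a_e$ is differentiable with $\|\nabla_1a_e\|\le C_a$ and $\|\nabla_2a_e\|\le C_a$ everywhere; $a_e$ is $L_a$-Lipschitz for $1\le e\le E-1$; $\nabla_1a_e$ and $\nabla_2a_e$ are $L_{\nabla a}$-Lipschitz for $2\le e\le E$; and $w_1\mapsto\nabla_2a_1(x,w_1)$ is $L_{\nabla a}$-Lipschitz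 for every $x$. *Assumption 2 (stochastic gradient).* For every $w$, $\mathbb E_{x\sim D}\nabla_wL(x;w)=\nabla\ell(w)$ and $\mathbb E_{x\sim D}\|\nabla_wL(x;w)-\nabla\ell(w)\|^2\le\sigma^2$. *Assumption 3 (compression).* For every $1\le e\le E-1$ a forward compressor $\mathcal Q^F_e$ and a backward compressor $\mathcal Q^B_e$ on $\mathbb R^{d_e}$, possibly random, satisfy $\mathbb E\|y-\mathcal Q^F_e(y)\|^2\le\omega_F^2\|y\|^2$ and $\mathbb E\|y-\mathcal Q^B_e(y)\|^2\le\omega_B^2\|y\|^2$ for all $y$, where $0\le\omega_F,\omega_B<1$. **Algorithm (Clapping-FC).** Fix a step size $\gamma>0$, a momentum coefficient $m\in(0,1)$, a lazy sampling probability $p\in[0,1]$ and deterministic initial weights $w^{(1)}$; set $\tilde y_e^{(0)}=0$, $\tilde v_e^{(0)}=0$, $\tilde u_e^{(0)}=0$. Draw $x^{(1)}\sim D$. For $t\ge 2$, with probability $p_t$ draw a new sample $x^{(t)}\sim D$, otherwise keep $x^{(t)}=x^{(t-1)}$; here $p_2=1$ and $p_t=p$ for $t\ge 3$. At iteration $t=1,2,\dots$: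 - forward: $\tilde y_0^{(t)}=x^{(t)}$; for $e=1,\dots,E-1$, $y_e^{(t)}=a_e(\tilde y_{e-1}^{(t)},w_e^{(t)})$ and $\tilde y_e^{(t)}=\tilde y_e^{(t-1)}+\mathcal Q^F_e\big(y_e^{(t)}-\tilde y_e^{(t-1)}\big)$; - backward: $\tilde v_E^{(t)}=1$; for $e=E,\dots,2$, $v_{e-1}^{(t)}=\nabla_1a_e(\tilde y_{e-1}^{(t)},w_e^{(t)})^{\top}\tilde v_e^{(t)}$ and $\tilde v_{e-1}^{(t)}=\tilde v_{e-1}^{(t-1)}+\mathcal Q^B_{e-1}\big(v_{e-1}^{(t)}-\tilde v_{e-1}^{(t-1)}\big)$; - update: for every $e$, $\tilde u_e^{(t)}=(1-m)\tilde u_e^{(t-1)}+m\,\nabla_2a_e(\tilde y_{e-1}^{(t)},w_e^{(t)})^{\top}\tilde v_e^{(t)}$ and $w_e^{(t+1)}=w_e^{(t)}-\gamma\,\tilde u_e^{(t)}$. All fresh data samples, all sampling indicators and all compressor randomness (over iterations, workers and directions) are independent. **Lemma.** Under Assumptions 1–3 there is a constant $C>0$, depending only on the problem data (the operators $a_e$,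 the distribution $D$, the compressors, $w^{(1)}$ and the constants of the assumptions, including $\sigma$) and not on $T$, $p$, $m$, $\gamma$, such that for all integers $T\ge1$ and all $p\in[0,1]$, $m\in(0,1)$, $\gamma>0$ all the expectations below are finite and $$ \begin{aligned} \frac1T\sum_{t=1}^T\mathbb E\|\nabla\ell(w^{(t)})\|^2\le{}&\frac{C}{\gamma T}+\frac{C}{mT}+\frac CT\sum_{t=1}^T\mathbb E\|x^{(t+1)}-x^{(t)}\|^2+C\sigma^2\,\frac{(2-p)m-(1-p)m^2}{1-(1-p)(1-m)^2}\\ &+\frac1T\Big(\frac C{m^2}-\frac1{2\gamma^2}\Big)\sum_{e=1}^E\sum_{t=1}^T\mathbb E\|w_e^{(t+1)}-w_e^{(t)}\|^2 . \end{aligned} $$ -/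

import Mathlib

open MeasureTheory ProbabilityTheory

noncomputable section

namespace Clapping

/-! ### The pipeline

There are `E` workers.  Worker `e + 1` of the usual numbering is the index `e : Fin E`; it maps the
activation with index `e.castSucc : Fin (E + 1)` to the one with index `e.succ`.  The activation
with index `0` is the data sample, the one with index `Fin.last E` is the (one-dimensional) loss. -/

/-- The space `ℝ^{d_j}` of the `j`-th activations. -/
abbrev Act {E : ℕ} (d : Fin (E + 1) → ℕ) (j : Fin (E + 1)) : Type :=
  EuclideanSpace ℝ (Fin (d j))

/-- The space of the weights of one worker. -/
abbrev Wt {E : ℕ} (dw : Fin E → ℕ) (e : Fin E) : Type :=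
  EuclideanSpace ℝ (Fin (dw e))

/-- The space of all weights `(w_1, …, w_E)`, with its Euclidean norm. -/
abbrev Params {E : ℕ} (dw : Fin E → ℕ) : Type :=
  PiLp 2 (fun e : Fin E => Wt dw e)

/-- The operators `a_e (y_{e-1}, w_e)` of the workers. -/
abbrev Operators {E : ℕ} (d : Fin (E + 1) → ℕ) (dw : Fin E → ℕ) : Type :=
  ∀ e : Fin E, Act d e.castSucc → Wt dw e → Act d e.succ

variable {E : ℕ} {d : Fin (E + 1) → ℕ} {dw : Fin E → ℕ}

/-- The exact activations: `y_0 = x` and `y_e = a_e (y_{e-1}, w_e)`. -/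
def activation (a : Operators d dw) (x : Act d 0) (w : Params dw) (j : Fin (E + 1)) : Act d j :=
  Fin.induction (motive := fun j => Act d j) x (fun e y => a e y (w e)) j

/-- The sample loss `L (x; w) = y_E`.  It is used with `d_E = 1`, where the sum has one term. -/
def loss (a : Operators d dw) (x : Act d 0) (w : Params dw) : ℝ :=
  ∑ i, activation a x w (Fin.last E) i

/-- The objective `ℓ (w) = 𝔼_{x ∼ D} L (x; w)`. -/
def risk (a : Operators d dw) (D : Measure (Act d 0)) (w : Params dw) : ℝ :=
  ∫ x, loss a x w ∂D

/-- The Jacobian `∇₁ a_e` with respect to the incoming activation. -/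
def jac₁ (a : Operators d dw) (e : Fin E) (y : Act d e.castSucc) (w : Wt dw e) :
    Act d e.castSucc →L[ℝ] Act d e.succ :=
  fderiv ℝ (fun y' => a e y' w) y

/-- The Jacobian `∇₂ a_e` with respect to the weights. -/
def jac₂ (a : Operators d dw) (e : Fin E) (y : Act d e.castSucc) (w : Wt dw e) :
    Wt dw e →L[ℝ] Act d e.succ :=
  fderiv ℝ (fun w' => a e y w') w

/-! ### Assumptions -/

/-- Smoothness of the objective and of the operators. -/
structure IsSmooth (a : Operators d dw) (D : Measure (Act d 0)) (Lℓ Ca La Lga : ℝ) : Prop where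
  risk_diff : Differentiable ℝ (risk a D)
  risk_lip : ∀ w w', ‖gradient (risk a D) w - gradient (risk a D) w'‖ ≤ Lℓ * ‖w - w'‖
  op_diff : ∀ e, Differentiable ℝ (fun z : Act d e.castSucc × Wt dw e => a e z.1 z.2)
  jac₁_le : ∀ e y w, ‖jac₁ a e y w‖ ≤ Ca
  jac₂_le : ∀ e y w, ‖jac₂ a e y w‖ ≤ Ca
  /-- all workers but the last one -/
  op_lip : ∀ e : Fin E, (e : ℕ) + 1 < E → ∀ y y' w w',
    ‖a e y w - a e y' w'‖ ^ 2 ≤ La ^ 2 * (‖y - y'‖ ^ 2 + ‖w - w'‖ ^ 2)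
  /-- all workers but the first one -/
  jac₁_lip : ∀ e : Fin E, 0 < (e : ℕ) → ∀ y y' w w',
    ‖jac₁ a e y w - jac₁ a e y' w'‖ ^ 2 ≤ Lga ^ 2 * (‖y - y'‖ ^ 2 + ‖w - w'‖ ^ 2)
  /-- all workers but the first one -/
  jac₂_lip : ∀ e : Fin E, 0 < (e : ℕ) → ∀ y y' w w',
    ‖jac₂ a e y w - jac₂ a e y' w'‖ ^ 2 ≤ Lga ^ 2 * (‖y - y'‖ ^ 2 + ‖w - w'‖ ^ 2)
  /-- the first worker: only the dependence on its weights, at each fixed data sample -/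
  jac₂_first_lip : ∀ e : Fin E, (e : ℕ) = 0 → ∀ y w w',
    ‖jac₂ a e y w - jac₂ a e y w'‖ ≤ Lga * ‖w - w'‖

/-- The stochastic gradient `∇ L (x; w)` is unbiased with variance at most `σ ^ 2`. -/
structure IsUnbiased (a : Operators d dw) (D : Measure (Act d 0)) (σ : ℝ) : Prop where
  integrable : ∀ w, Integrable (fun x => gradient (loss a x) w) D
  mean : ∀ w, ∫ x, gradient (loss a x) w ∂D = gradient (risk a D) w
  sq_integrable : ∀ w,
    Integrable (fun x => ‖gradient (loss a x) w - gradient (risk a D) w‖ ^ 2) D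
  variance : ∀ w, ∫ x, ‖gradient (loss a x) w - gradient (risk a D) w‖ ^ 2 ∂D ≤ σ ^ 2

/-- A family of (possibly randomised) compressors, one for each activation index.  The compressor
is a function of a random seed with law `ν` and of the vector to be compressed. -/
abbrev Compressors {E : ℕ} (d : Fin (E + 1) → ℕ) (Z : Type*) : Type _ :=
  ∀ j : Fin (E + 1), Z → Act d j → Act d j

/-- Contractive compressors on the `E - 1` links between neighbouring workers, that is, at the
indices `1, …, E - 1`; the compressors at the indices `0` and `E` never influence the algorithm. -/
structure IsContractive {Z : Type*} [MeasurableSpace Z] (Q : Compressors d Z) (ν : Measure Z)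
    (ω : ℝ) : Prop where
  nonneg : 0 ≤ ω
  lt_one : ω < 1
  measurable : ∀ j, Measurable (fun q : Z × Act d j => Q j q.1 q.2)
  integrable : ∀ j, j ≠ 0 → j ≠ Fin.last E → ∀ y, Integrable (fun z => ‖y - Q j z y‖ ^ 2) ν
  contract : ∀ j, j ≠ 0 → j ≠ Fin.last E → ∀ y, ∫ z, ‖y - Q j z y‖ ^ 2 ∂ν ≤ ω ^ 2 * ‖y‖ ^ 2

/-! ### The randomness -/

/-- The randomness of one iteration: a candidate data sample, the indicator that a new sample is
drawn, and the seeds of the forward and of the backward compressors. -/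
abbrev Noise {E : ℕ} (d : Fin (E + 1) → ℕ) (Z : Type*) : Type _ :=
  Act d 0 × Bool × (Fin (E + 1) → Z) × (Fin (E + 1) → Z)

/-- Law of the randomness of one iteration with sampling probability `q`; all the components are
independent. -/
def noiseLaw {Z : Type*} [MeasurableSpace Z] (D : Measure (Act d 0)) (ν : Measure Z)
    (q : unitInterval) : Measure (Noise d Z) :=
  D.prod ((bernoulliMeasure true false q).prod
    ((Measure.pi fun _ => ν).prod (Measure.pi fun _ => ν)))

instance {Z : Type*} [MeasurableSpace Z] (D : Measure (Act d 0)) (ν : Measure Z)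
    [IsProbabilityMeasure D] [IsProbabilityMeasure ν] (q : unitInterval) :
    IsProbabilityMeasure (noiseLaw D ν q) := by
  unfold noiseLaw
  infer_instance

/-- The lazy sampling probabilities: `p_2 = 1` and `p_t = p` for `t ≥ 3`. -/
def schedule (p : unitInterval) (t : ℕ) : unitInterval :=
  if t ≤ 2 then 1 else p

/-- Law of the randomness of all iterations, which are independent of each other. -/
def pathLaw {Z : Type*} [MeasurableSpace Z] (D : Measure (Act d 0)) (ν : Measure Z)
    [IsProbabilityMeasure D] [IsProbabilityMeasure ν] (p : unitInterval) :
    Measure (ℕ → Noise d Z) :=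
  Measure.infinitePi fun t => noiseLaw D ν (schedule p t)

/-! ### Clapping-FC -/

/-- What is kept at the end of iteration `t`: the sample `x^{(t)}`, the compressed activations
`ỹ^{(t)}`, the compressed activation gradients `ṽ^{(t)}`, the momentum `ũ^{(t)}` and the new weights
`w^{(t+1)}`. -/
structure State {E : ℕ} (d : Fin (E + 1) → ℕ) (dw : Fin E → ℕ) where
  x : Act d 0
  y : ∀ j : Fin (E + 1), Act d j
  v : ∀ j : Fin (E + 1), Act d j
  u : Params dw
  w : Params dw

/-- Before the first iteration everything is `0`, except for the weights `w^{(1)}`. -/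
def initState (w₁ : Params dw) : State d dw where
  x := 0
  y := 0
  v := 0
  u := 0
  w := w₁

/-- Lazy sampling: at iteration `1`, and whenever the indicator says so, take the new sample;
otherwise keep the previous one. -/
def lazySample {Z : Type*} (t : ℕ) (xOld : Act d 0) (n : Noise d Z) : Act d 0 :=
  if t = 1 ∨ n.2.1 = true then n.1 else xOld

/-- Forward pass with error feedback: `ỹ_0 = x` and
`ỹ_e = ỹ_e^{old} + Q (y_e - ỹ_e^{old})`, where `y_e = a_e (ỹ_{e-1}, w_e)`. -/
def forward {Z : Type*} (a : Operators d dw) (QF : Compressors d Z) (x : Act d 0)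
    (yOld : ∀ j, Act d j) (w : Params dw) (z : Fin (E + 1) → Z) (j : Fin (E + 1)) : Act d j :=
  Fin.induction (motive := fun j => Act d j) x
    (fun e y => yOld e.succ + QF e.succ (z e.succ) (a e y (w e) - yOld e.succ)) j

/-- Backward pass with error feedback: `ṽ_E = 1` and
`ṽ_{e-1} = ṽ_{e-1}^{old} + Q (v_{e-1} - ṽ_{e-1}^{old})`, where
`v_{e-1} = ∇₁ a_e (ỹ_{e-1}, w_e)ᵀ ṽ_e`. -/
def backward {Z : Type*} (a : Operators d dw) (QB : Compressors d Z) (y : ∀ j, Act d j)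
    (vOld : ∀ j, Act d j) (w : Params dw) (z : Fin (E + 1) → Z) (j : Fin (E + 1)) : Act d j :=
  Fin.reverseInduction (motive := fun j => Act d j) (WithLp.toLp 2 fun _ => 1)
    (fun e v => vOld e.castSucc + QB e.castSucc (z e.castSucc)
      (ContinuousLinearMap.adjoint (jac₁ a e (y e.castSucc) (w e)) v - vOld e.castSucc)) j

/-- Momentum: `ũ_e = (1 - m) ũ_e^{old} + m ∇₂ a_e (ỹ_{e-1}, w_e)ᵀ ṽ_e`. -/
def momentum (a : Operators d dw) (m : ℝ) (y v : ∀ j, Act d j) (uOld w : Params dw) : Params dw :=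
  WithLp.toLp 2 fun e => (1 - m) • uOld e +
    m • ContinuousLinearMap.adjoint (jac₂ a e (y e.castSucc) (w e)) (v e.succ)

/-- Iteration `t` of Clapping-FC with step size `γ` and momentum coefficient `m`. -/
def step {Z : Type*} (a : Operators d dw) (QF QB : Compressors d Z) (γ m : ℝ) (t : ℕ)
    (s : State d dw) (n : Noise d Z) : State d dw :=
  let x := lazySample t s.x n
  let y := forward a QF x s.y s.w n.2.2.1
  let v := backward a QB y s.v s.w n.2.2.2
  let u := momentum a m y v s.u s.w
  { x := x, y := y, v := v, u := u, w := s.w - γ • u }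

/-- The state at the end of iteration `t`, as a function of the randomness. -/
def run {Z : Type*} (a : Operators d dw) (QF QB : Compressors d Z) (w₁ : Params dw) (γ m : ℝ) :
    ℕ → (ℕ → Noise d Z) → State d dw
  | 0, _ => initState w₁
  | t + 1, ω => step a QF QB γ m (t + 1) (run a QF QB w₁ γ m t ω) (ω (t + 1))

/-- The sample `x^{(t)}` used at iteration `t ≥ 1`. -/
def sample {Z : Type*} (a : Operators d dw) (QF QB : Compressors d Z) (w₁ : Params dw) (γ m : ℝ)
    (t : ℕ) (ω : ℕ → Noise d Z) : Act d 0 :=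
  (run a QF QB w₁ γ m t ω).x

/-- The weights `w^{(t)}` at the beginning of iteration `t ≥ 1`. -/
def weights {Z : Type*} (a : Operators d dw) (QF QB : Compressors d Z) (w₁ : Params dw) (γ m : ℝ)
    (t : ℕ) (ω : ℕ → Noise d Z) : Params dw :=
  (run a QF QB w₁ γ m (t - 1) ω).w

end Clapping

end

/-! The momentum error `ũ^{(t)} - ∇ℓ(w^{(t)})` splits into `noiseAvg`, the exponential average of
the deviations `∇L(x; w) - ∇ℓ(w)` met along the run, and a remainder `biasIter`. For every step
size, smoothness of `ℓ` bounds `‖∇ℓ(w)‖²` by a telescoping decrease of `ℓ`, the squared momentum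
error, and `2 Lℓ² - 1/(2γ²)` times the squared step (`IsSmooth.descent`). It remains to sum the
squares of the two pieces over time.

The bias contracts by `1 - m` per iteration; it is driven by the moves of `∇ℓ` and by `m` times the
error of the gradient computed from compressed messages. Error feedback controls that error: a
contractive compressor tracks its target up to the moves of the target and the perturbation of its
input (`Controlled.track`). The targets are the exact activations and cotangents. They are Lipschitz
in the sample and the weights, so their moves are paid for by the moves collected in `budget`.
Induction along the pipeline, upwards for activations (`controlled_activation_error`) and then
downwards for cotangents (`controlled_cotangent_error`), gives `controlled_gradient_error`.

Lazy sampling makes successive deviations correlated. A fresh sample contributes nothing to the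
correlation with the past, and a kept one repeats the previous deviation up to a move of the
weights; so correlations decay by `1 - p` (`integral_inner_noiseAvg`). For `p > m` the recursions
for correlation and size (`sum_le_of_correlation_recursion`) give a noise of order `σ² m / p` per
iteration, plus weight moves over `p²`. For `p ≤ m` the crude order `σ²` is enough, because the
noise factor is then at least `1/3`. The variance assumption concerns a fixed `w`, whereas a kept
sample is correlated with the current weights; this is why a bound uniform in `w` is needed
(`exists_deviation_sq_le`), with a constant that depends on `σ`.

Independence enters only through resampling: replacing one ingredient of the randomness by a fresh
copy preserves the law, and quantities that do not depend on that ingredient stay fixed. -/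

namespace Clapping

/-! ### Resampling -/

section Resampling

variable {α β ζ : Type*} [MeasurableSpace α] [MeasurableSpace β] [MeasurableSpace ζ]

/-- The map `φ : α → ζ → α` replaces a part of a random element of law `μ` by a fresh copy, of law
`ν`: the outcome has law `μ` again. -/
def IsResampling (φ : α → ζ → α) (μ : Measure α) (ν : Measure ζ) : Prop :=
  MeasurePreserving (fun q : α × ζ => φ q.1 q.2) (μ.prod ν) μ

theorem IsResampling.prod_right {φ : β → ζ → β} {μ : Measure β} {ν : Measure ζ} [SFinite μ]
    [SFinite ν] (h : IsResampling φ μ ν) (μ' : Measure α) [SFinite μ'] :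
    IsResampling (fun (q : α × β) z => (q.1, φ q.2 z)) (μ'.prod μ) ν :=
  ((MeasurePreserving.id μ').prod h).comp (measurePreserving_prodAssoc μ' μ ν)

theorem IsResampling.prod_left {φ : α → ζ → α} {μ : Measure α} {ν : Measure ζ} [SFinite μ]
    [SFinite ν] (h : IsResampling φ μ ν) (μ' : Measure β) [SFinite μ'] :
    IsResampling (fun (q : α × β) z => (φ q.1 z, q.2)) (μ.prod μ') ν :=
  (Measure.measurePreserving_swap (μ := μ') (ν := μ)).comp
    ((h.prod_right μ').comp
      ((Measure.measurePreserving_swap (μ := μ) (ν := μ')).prod (MeasurePreserving.id ν)))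

variable {ι : Type*} [DecidableEq ι] {X : ι → Type*} [∀ i, MeasurableSpace (X i)]

/-- The product measure is determined by finite boxes, and the preimage of a box is the box without
its side `i`, times that side in the fresh coordinate. -/
theorem isResampling_update (μ : ∀ i, Measure (X i)) [∀ i, IsProbabilityMeasure (μ i)] (i : ι) :
    IsResampling (fun (x : ∀ i, X i) (y : X i) => Function.update x i y)
      (Measure.infinitePi μ) (μ i) := by
  have hm : Measurable fun q : (∀ i, X i) × X i => Function.update q.1 i q.2 := by
    refine measurable_pi_iff.2 fun j => ?_
    by_cases hj : j = i
    · subst hj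
      simpa using measurable_snd
    · simp only [Function.update_of_ne hj]
      fun_prop
  refine ⟨hm, Measure.eq_infinitePi μ fun s t ht => ?_⟩
  rw [Measure.map_apply hm (MeasurableSet.pi s.countable_toSet fun j _ => ht j)]
  have hset : (fun q : (∀ i, X i) × X i => Function.update q.1 i q.2) ⁻¹' Set.pi s t
      = Set.pi (s.erase i : Finset ι) t ×ˢ (if i ∈ s then t i else Set.univ) := by
    ext ⟨x, y⟩
    simp only [Set.mem_preimage, Set.mem_pi, Finset.mem_coe, Set.mem_prod, Finset.mem_erase]
    constructor
    · intro h
      refine ⟨fun j hj => by simpa [Function.update_of_ne hj.1] using h j hj.2, ?_⟩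
      split_ifs with hi
      · simpa using h i hi
      · trivial
    · rintro ⟨h₁, h₂⟩ j hj
      by_cases hji : j = i
      · subst hji
        simpa [hj] using h₂
      · simpa [Function.update_of_ne hji] using h₁ j ⟨hji, hj⟩
  rw [hset, Measure.prod_prod, Measure.infinitePi_pi _ fun j _ => ht j]
  split_ifs with hi
  · exact Finset.prod_erase_mul s (fun j => μ j (t j)) hi
  · rw [Finset.erase_eq_of_notMem hi, measure_univ, mul_one]

/-- This resamples only a part of coordinate `i`. The trick is to replace the whole coordinate by a
fresh `y` beforehand, which does not change the law; then `y` is independent of the rest and `ψ` can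
act on it through the product structure. -/
theorem IsResampling.update {μ : ∀ i, Measure (X i)} [∀ i, IsProbabilityMeasure (μ i)] {i : ι}
    {ν : Measure ζ} [SFinite ν] {ψ : X i → ζ → X i} (h : IsResampling ψ (μ i) ν) :
    IsResampling (fun (x : ∀ i, X i) z => Function.update x i (ψ (x i) z))
      (Measure.infinitePi μ) ν := by
  have hU := isResampling_update μ i
  have hUm : Measurable fun q : (∀ i, X i) × X i => Function.update q.1 i q.2 := hU.measurable
  have hψ : Measurable fun q : X i × ζ => ψ q.1 q.2 := h.measurable
  have hm : Measurable fun q : (∀ i, X i) × ζ => Function.update q.1 i (ψ (q.1 i) q.2) :=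
    hUm.comp (measurable_fst.prodMk
      (hψ.comp (((measurable_pi_apply i).comp measurable_fst).prodMk measurable_snd)))
  have h₁ : MeasurePreserving
      (fun q : ((∀ i, X i) × X i) × ζ => (Function.update q.1.1 i q.1.2, q.2))
      (((Measure.infinitePi μ).prod (μ i)).prod ν) ((Measure.infinitePi μ).prod ν) :=
    hU.prod (MeasurePreserving.id ν)
  have h₂ : MeasurePreserving
      (fun q : ((∀ i, X i) × X i) × ζ => Function.update q.1.1 i (ψ q.1.2 q.2))
      (((Measure.infinitePi μ).prod (μ i)).prod ν) (Measure.infinitePi μ) :=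
    hU.comp (h.prod_right (Measure.infinitePi μ))
  refine ⟨hm, ?_⟩
  calc Measure.map (fun q : (∀ i, X i) × ζ => Function.update q.1 i (ψ (q.1 i) q.2))
        ((Measure.infinitePi μ).prod ν)
      = Measure.map (fun q : ((∀ i, X i) × X i) × ζ => Function.update q.1.1 i (ψ q.1.2 q.2))
        (((Measure.infinitePi μ).prod (μ i)).prod ν) := by
        -- The second update at `i` overwrites the first, so the composite is the map of `h₂`.
        conv_lhs => rw [← h₁.map_eq, Measure.map_map hm h₁.measurable]
        congr 1
        funext q
        simp
    _ = _ := h₂.map_eq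

theorem isResampling_pi_update {ι : Type*} [DecidableEq ι] [Fintype ι] {X : ι → Type*}
    [∀ i, MeasurableSpace (X i)] (μ : ∀ i, Measure (X i)) [∀ i, IsProbabilityMeasure (μ i)]
    (i : ι) :
    IsResampling (fun (x : ∀ i, X i) (y : X i) => Function.update x i y)
      (Measure.pi μ) (μ i) := by
  rw [← Measure.infinitePi_eq_pi]
  exact isResampling_update μ i

theorem IsResampling.integrable {φ : α → ζ → α} {μ : Measure α} {ν : Measure ζ}
    (h : IsResampling φ μ ν) {V : Type*} [NormedAddCommGroup V] {f : α → V}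
    (hf : Integrable f μ) : Integrable (fun q : α × ζ => f (φ q.1 q.2)) (μ.prod ν) :=
  MeasurePreserving.integrable_comp_of_integrable h hf

/-- This plays the role of conditioning on everything except the resampled ingredient: the inner
integral averages over that ingredient alone. -/
theorem IsResampling.integral_eq {φ : α → ζ → α} {μ : Measure α} {ν : Measure ζ} [SFinite μ]
    [SFinite ν] (h : IsResampling φ μ ν) {V : Type*} [NormedAddCommGroup V] [NormedSpace ℝ V]
    {f : α → V} (hf : Integrable f μ) :
    ∫ a, f a ∂μ = ∫ a, ∫ z, f (φ a z) ∂ν ∂μ := by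
  have hf' : AEStronglyMeasurable f ((μ.prod ν).map fun q : α × ζ => φ q.1 q.2) := by
    rw [MeasurePreserving.map_eq h]; exact hf.aestronglyMeasurable
  rw [← integral_prod (fun q : α × ζ => f (φ q.1 q.2)) (h.integrable hf),
    ← integral_map (MeasurePreserving.measurable h).aemeasurable hf', MeasurePreserving.map_eq h]

end Resampling

/-! ### Square integrable functions -/

section L2

variable {Ω : Type*} [MeasurableSpace Ω] {V : Type*} [NormedAddCommGroup V]

theorem lpNorm_two_sq {μ : Measure Ω} {f : Ω → V} (hf : MemLp f 2 μ) :
    lpNorm f 2 μ ^ 2 = ∫ ω, ‖f ω‖ ^ 2 ∂μ := by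
  have h0 : 0 ≤ ∫ ω, ‖f ω‖ ^ 2 ∂μ := integral_nonneg fun _ => by positivity
  rw [lpNorm_eq_integral_norm_rpow_toReal (by simp) (by simp) hf.1]
  simp only [ENNReal.toReal_ofNat, Real.rpow_ofNat]
  rw [← Real.rpow_natCast, ← Real.rpow_mul h0]
  norm_num

theorem _root_.MeasureTheory.MemLp.integrable_norm_sq {μ : Measure Ω} {f : Ω → V}
    (hf : MemLp f 2 μ) : Integrable (fun ω => ‖f ω‖ ^ 2) μ :=
  hf.integrable_norm_pow (by simp)

/-- The error of a contractive random map, applied to a vector which is independent of its seed. -/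
theorem memLp_compression_error {Z : Type*} [MeasurableSpace Z] [MeasurableSpace V] [BorelSpace V]
    [SecondCountableTopology V] {P : Measure Ω} {ν : Measure Z} [SFinite P] [SFinite ν]
    {φ : Ω → Z → Ω} (hφ : IsResampling φ P ν) {Q : Z → V → V}
    (hQm : Measurable fun q : Z × V => Q q.1 q.2) {c : ℝ} (hc : 0 ≤ c)
    (hQi : ∀ y, Integrable (fun z => ‖y - Q z y‖ ^ 2) ν)
    (hQ : ∀ y, ∫ z, ‖y - Q z y‖ ^ 2 ∂ν ≤ c ^ 2 * ‖y‖ ^ 2)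
    {seed : Ω → Z} (hseed : Measurable seed) (hseed' : ∀ ω z, seed (φ ω z) = z)
    {δ : Ω → V} (hδm : Measurable δ) (hδ' : ∀ ω z, δ (φ ω z) = δ ω) (hδ : MemLp δ 2 P) :
    MemLp (fun ω => δ ω - Q (seed ω) (δ ω)) 2 P ∧
      lpNorm (fun ω => δ ω - Q (seed ω) (δ ω)) 2 P ≤ c * lpNorm δ 2 P := by
  have hm : Measurable fun ω => δ ω - Q (seed ω) (δ ω) :=
    hδm.sub (hQm.comp (hseed.prodMk hδm))
  have hm2 : Measurable fun q : Ω × Z => ‖δ q.1 - Q q.2 (δ q.1)‖ ^ 2 :=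
    (((hδm.comp measurable_fst).sub
      (hQm.comp (measurable_snd.prodMk (hδm.comp measurable_fst)))).norm).pow_const 2
  -- Resampling puts `z` in place of the seed and leaves `δ` unchanged, so on the product space the
  -- seed is independent of the compressed vector and the contraction bound applies fibrewise.
  have hcomp : (fun q : Ω × Z => ‖δ q.1 - Q q.2 (δ q.1)‖ ^ 2)
      = (fun ω => ‖δ ω - Q (seed ω) (δ ω)‖ ^ 2) ∘ fun q : Ω × Z => φ q.1 q.2 := by
    funext q
    simp [hseed', hδ']
  have hprod : Integrable (fun q : Ω × Z => ‖δ q.1 - Q q.2 (δ q.1)‖ ^ 2) (P.prod ν) := by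
    refine (integrable_prod_iff hm2.aestronglyMeasurable).2
      ⟨ae_of_all _ fun ω => hQi (δ ω), ?_⟩
    refine (hδ.integrable_norm_sq.const_mul (c ^ 2)).mono'
      hm2.aestronglyMeasurable.norm.integral_prod_right' (ae_of_all _ fun ω => ?_)
    have h0 : 0 ≤ ∫ z, ‖δ ω - Q z (δ ω)‖ ^ 2 ∂ν := integral_nonneg fun _ => by positivity
    simpa [abs_of_nonneg h0] using hQ (δ ω)
  have hint : Integrable (fun ω => ‖δ ω - Q (seed ω) (δ ω)‖ ^ 2) P := by
    rw [hcomp] at hprod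
    exact (MeasurePreserving.integrable_comp hφ (hm.norm.pow_const 2).aestronglyMeasurable).1 hprod
  have hmem : MemLp (fun ω => δ ω - Q (seed ω) (δ ω)) 2 P :=
    (memLp_two_iff_integrable_sq_norm hm.aestronglyMeasurable).2 hint
  refine ⟨hmem, ?_⟩
  refine le_of_sq_le_sq ?_ (mul_nonneg hc lpNorm_nonneg)
  rw [lpNorm_two_sq hmem, mul_pow, lpNorm_two_sq hδ, ← integral_const_mul, hφ.integral_eq hint]
  refine integral_mono_of_nonneg
    (ae_of_all _ fun ω => integral_nonneg fun _ => by positivity)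
    (hδ.integrable_norm_sq.const_mul _) (ae_of_all _ fun ω => ?_)
  simpa [hseed', hδ'] using hQ (δ ω)

/-- The sum of the squares of a nonnegative sequence that contracts up to a perturbation. -/
theorem sum_sq_le_of_contraction {θ β : ℕ → ℝ} {c : ℝ} (hc : 0 ≤ c) (hc1 : c < 1)
    (hθ : ∀ t, 0 ≤ θ t) (h : ∀ t, θ (t + 1) ≤ c * θ t + β (t + 1)) (T : ℕ) :
    ∑ t ∈ Finset.range T, θ (t + 1) ^ 2
      ≤ (θ 0 ^ 2 + (∑ t ∈ Finset.range T, β (t + 1) ^ 2) / (1 - c)) / (1 - c) := by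
  have h1 : 0 < 1 - c := by linarith
  -- Convexity of the square, with weights `c` and `1 - c` at the points `θ t` and `β (t + 1) / (1 -
  -- c)`.
  have hstep : ∀ t, θ (t + 1) ^ 2 ≤ c * θ t ^ 2 + β (t + 1) ^ 2 / (1 - c) := by
    intro t
    refine (pow_le_pow_left₀ (hθ _) (h t) 2).trans ?_
    have : c * θ t ^ 2 + β (t + 1) ^ 2 / (1 - c) - (c * θ t + β (t + 1)) ^ 2
        = c * ((1 - c) * θ t - β (t + 1)) ^ 2 / (1 - c) := by
      field_simp
      ring
    have : 0 ≤ c * ((1 - c) * θ t - β (t + 1)) ^ 2 / (1 - c) := by positivity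
    linarith
  have hsum : ∀ T : ℕ, (1 - c) * ∑ t ∈ Finset.range T, θ (t + 1) ^ 2 + θ T ^ 2
      ≤ θ 0 ^ 2 + (∑ t ∈ Finset.range T, β (t + 1) ^ 2) / (1 - c)
        + (1 - c) * θ T ^ 2 := by
    intro T
    induction T with
    | zero => simp; nlinarith [sq_nonneg (θ 0)]
    | succ n ih =>
      rw [Finset.sum_range_succ, Finset.sum_range_succ, add_div]
      nlinarith [hstep n]
  rw [le_div_iff₀ h1]
  nlinarith [hsum T, sq_nonneg (θ T)]

end L2

/-! ### Families that are controlled by a budget -/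

/-- A family of processes, indexed by the hyperparameters `θ`, whose cumulated second moments are
at most a multiple of the budget `B`, with a constant that does not depend on `θ`. -/
structure Controlled {Θ Ω V : Type*} [MeasurableSpace Ω] [NormedAddCommGroup V]
    (P : Θ → Measure Ω) (B : Θ → ℕ → ℝ) (f : Θ → ℕ → Ω → V) : Prop where
  memLp : ∀ θ t, MemLp (f θ t) 2 (P θ)
  bound : ∃ C, 0 ≤ C ∧ ∀ θ T,
    ∑ t ∈ Finset.range T, ∫ ω, ‖f θ (t + 1) ω‖ ^ 2 ∂P θ ≤ C * B θ T

section Controlled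

variable {Θ Ω V V₁ V₂ : Type*} [MeasurableSpace Ω] [NormedAddCommGroup V] [NormedAddCommGroup V₁]
  [NormedAddCommGroup V₂] {P : Θ → Measure Ω} {B : Θ → ℕ → ℝ}

/-- Pointwise Lipschitz estimates are fed into the control of second moments through this lemma; the
factor `2` comes from `(a + b)² ≤ 2 (a² + b²)`. -/
theorem Controlled.of_le {f : Θ → ℕ → Ω → V₁} {g : Θ → ℕ → Ω → V₂} {h : Θ → ℕ → Ω → V}
    (hf : Controlled P B f) (hg : Controlled P B g)
    (hm : ∀ θ t, AEStronglyMeasurable (h θ t) (P θ)) {K : ℝ}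
    (hle : ∀ θ t ω, ‖h θ t ω‖ ≤ K * (‖f θ t ω‖ + ‖g θ t ω‖)) : Controlled P B h := by
  have hmem : ∀ θ t, MemLp (h θ t) 2 (P θ) := fun θ t => by
    refine MemLp.of_le (((hf.memLp θ t).norm.add (hg.memLp θ t).norm).const_mul K) (hm θ t)
      (ae_of_all _ fun ω => ?_)
    exact (hle θ t ω).trans (le_abs_self _)
  refine ⟨hmem, ?_⟩
  obtain ⟨C₁, hC₁, h₁⟩ := hf.bound
  obtain ⟨C₂, hC₂, h₂⟩ := hg.bound
  refine ⟨2 * K ^ 2 * (C₁ + C₂), by positivity, fun θ T => ?_⟩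
  have key : ∀ t, ∫ ω, ‖h θ t ω‖ ^ 2 ∂P θ
      ≤ 2 * K ^ 2 * (∫ ω, ‖f θ t ω‖ ^ 2 ∂P θ + ∫ ω, ‖g θ t ω‖ ^ 2 ∂P θ) := fun t => by
    rw [← integral_add (hf.memLp θ t).integrable_norm_sq (hg.memLp θ t).integrable_norm_sq,
      ← integral_const_mul]
    refine integral_mono (hmem θ t).integrable_norm_sq
      (((hf.memLp θ t).integrable_norm_sq.add (hg.memLp θ t).integrable_norm_sq).const_mul _)
      fun ω => ?_
    refine (pow_le_pow_left₀ (norm_nonneg _) (hle θ t ω) 2).trans ?_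
    rw [mul_pow, mul_assoc, mul_left_comm]
    refine mul_le_mul_of_nonneg_left ?_ (sq_nonneg K)
    nlinarith [sq_nonneg (‖f θ t ω‖ - ‖g θ t ω‖)]
  refine (Finset.sum_le_sum fun t _ => key (t + 1)).trans ?_
  rw [← Finset.mul_sum, Finset.sum_add_distrib]
  calc _ ≤ 2 * K ^ 2 * (C₁ * B θ T + C₂ * B θ T) := by
        gcongr
        · exact h₁ θ T
        · exact h₂ θ T
    _ = _ := by ring

/-- A compressor with error feedback tracks a slowly moving target, even if it only sees a
perturbation of that target. -/
theorem Controlled.track {r r' c : Θ → ℕ → Ω → V} {q : ℝ} (hq : 0 ≤ q) (hq1 : q < 1)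
    (hB : ∀ θ T, 1 ≤ B θ T)
    (hpert : Controlled P B fun θ t ω => r' θ t ω - r θ t ω)
    (hmove : Controlled P B fun θ t ω => r θ t ω - r θ (t - 1) ω)
    (hr : ∀ θ t, MemLp (r θ t) 2 (P θ)) (hc : ∀ θ t, MemLp (c θ t) 2 (P θ))
    (hstep : ∀ θ t, lpNorm (fun ω => c θ (t + 1) ω - r' θ (t + 1) ω) 2 (P θ)
      ≤ q * lpNorm (fun ω => r' θ (t + 1) ω - c θ t ω) 2 (P θ))
    (hinit : ∃ C₀, 0 ≤ C₀ ∧ ∀ θ, ∫ ω, ‖c θ 0 ω - r θ 0 ω‖ ^ 2 ∂P θ ≤ C₀) :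
    Controlled P B fun θ t ω => c θ t ω - r θ t ω := by
  have hmem : ∀ θ t, MemLp (fun ω => c θ t ω - r θ t ω) 2 (P θ) := fun θ t =>
    (hc θ t).sub (hr θ t)
  refine ⟨hmem, ?_⟩
  obtain ⟨C₁, hC₁, h₁⟩ := hpert.bound
  obtain ⟨C₂, hC₂, h₂⟩ := hmove.bound
  obtain ⟨C₀, hC₀, h₀⟩ := hinit
  have hq' : 0 < 1 - q := by linarith
  refine ⟨(C₀ + (8 * C₁ + 2 * C₂) / (1 - q)) / (1 - q), by positivity, fun θ T => ?_⟩
  have hr' : ∀ t, MemLp (r' θ t) 2 (P θ) := fun t => by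
    have := (hpert.memLp θ t).add (hr θ t)
    simpa [Pi.add_def] using this
  let N : (Ω → V) → ℝ := fun f => lpNorm f 2 (P θ)
  have hN0 : ∀ f, 0 ≤ N f := fun f => lpNorm_nonneg
  have hadd : ∀ f g : Ω → V, MemLp f 2 (P θ) → N (f + g) ≤ N f + N g := fun f g hf =>
    lpNorm_add_le hf (by norm_num)
  -- In `L²` norm, so that the triangle inequality is available. The perturbation `r' - r` is met
  -- twice, after the compression (`e₁`) and inside its argument (`e₂`), whence the factor `2`.
  have hrec : ∀ t, N (fun ω => c θ (t + 1) ω - r θ (t + 1) ω)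
      ≤ q * N (fun ω => c θ t ω - r θ t ω)
        + (2 * N (fun ω => r' θ (t + 1) ω - r θ (t + 1) ω)
          + N (fun ω => r θ (t + 1) ω - r θ (t + 1 - 1) ω)) := by
    intro t
    have e₁ : (fun ω => c θ (t + 1) ω - r θ (t + 1) ω)
        = (fun ω => c θ (t + 1) ω - r' θ (t + 1) ω)
          + fun ω => r' θ (t + 1) ω - r θ (t + 1) ω := by
      funext ω; simp
    have e₂ : (fun ω => r' θ (t + 1) ω - c θ t ω)
        = (fun ω => r' θ (t + 1) ω - r θ (t + 1) ω)
          + ((fun ω => r θ (t + 1) ω - r θ (t + 1 - 1) ω) + -fun ω => c θ t ω - r θ t ω) := by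
      funext ω; simp
    have i₁ := hadd (fun ω => c θ (t + 1) ω - r' θ (t + 1) ω)
      (fun ω => r' θ (t + 1) ω - r θ (t + 1) ω)
      ((hc θ (t + 1)).sub (hr' (t + 1)))
    have i₂ := hadd _ ((fun ω => r θ (t + 1) ω - r θ (t + 1 - 1) ω) + -fun ω => c θ t ω - r θ t ω)
      (hpert.memLp θ (t + 1))
    have i₃ := hadd _ (-fun ω => c θ t ω - r θ t ω) (hmove.memLp θ (t + 1))
    have i₄ : N (-fun ω => c θ t ω - r θ t ω) = N (fun ω => c θ t ω - r θ t ω) :=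
      lpNorm_neg _ _ _
    have i₅ := hstep θ t
    rw [e₂] at i₅
    rw [e₁]
    refine i₁.trans ?_
    have i₆ := mul_le_mul_of_nonneg_left (i₂.trans (add_le_add_right (i₃.trans_eq (by rw [i₄])) _)) hq
    have i₇ : q * N (fun ω => r' θ (t + 1) ω - r θ (t + 1) ω)
      ≤ N (fun ω => r' θ (t + 1) ω - r θ (t + 1) ω) := mul_le_of_le_one_left (hN0 _) hq1.le
    have i₈ : q * N (fun ω => r θ (t + 1) ω - r θ (t + 1 - 1) ω)
      ≤ N (fun ω => r θ (t + 1) ω - r θ (t + 1 - 1) ω) := mul_le_of_le_one_left (hN0 _) hq1.le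
    have i₉ := i₅.trans i₆
    simp only [mul_add] at i₉
    change N _ ≤ _ at i₉
    linarith
  have hsum := sum_sq_le_of_contraction (θ := fun t => N fun ω => c θ t ω - r θ t ω)
    (β := fun t => 2 * N (fun ω => r' θ t ω - r θ t ω)
          + N (fun ω => r θ t ω - r θ (t - 1) ω)) hq hq1 (fun t => hN0 _) hrec T
  have hsq : ∀ t, (N fun ω => c θ t ω - r θ t ω) ^ 2 = ∫ ω, ‖c θ t ω - r θ t ω‖ ^ 2 ∂P θ :=
    fun t => lpNorm_two_sq (hmem θ t)
  simp only [hsq] at hsum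
  refine hsum.trans ?_
  have hβ : ∑ t ∈ Finset.range T, (2 * N (fun ω => r' θ (t + 1) ω - r θ (t + 1) ω)
          + N (fun ω => r θ (t + 1) ω - r θ (t + 1 - 1) ω)) ^ 2 ≤ (8 * C₁ + 2 * C₂) * B θ T := by
    have : ∀ t, (2 * N (fun ω => r' θ (t + 1) ω - r θ (t + 1) ω)
          + N (fun ω => r θ (t + 1) ω - r θ (t + 1 - 1) ω)) ^ 2
        ≤ 8 * ∫ ω, ‖r' θ (t + 1) ω - r θ (t + 1) ω‖ ^ 2 ∂P θ
          + 2 * ∫ ω, ‖r θ (t + 1) ω - r θ (t + 1 - 1) ω‖ ^ 2 ∂P θ := fun t => by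
      rw [← lpNorm_two_sq (hpert.memLp θ (t + 1)), ← lpNorm_two_sq (hmove.memLp θ (t + 1))]
      simp only [N]
      nlinarith [sq_nonneg (2 * lpNorm (fun ω => r' θ (t + 1) ω - r θ (t + 1) ω) 2 (P θ)
          - lpNorm (fun ω => r θ (t + 1) ω - r θ (t + 1 - 1) ω) 2 (P θ))]
    refine (Finset.sum_le_sum fun t _ => this t).trans ?_
    rw [Finset.sum_add_distrib, ← Finset.mul_sum, ← Finset.mul_sum]
    linarith [h₁ θ T, h₂ θ T]
  have hB1 := hB θ T
  -- The budget is at least `1`, so it absorbs the initial error.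
  have h0' : ∫ ω, ‖c θ 0 ω - r θ 0 ω‖ ^ 2 ∂P θ ≤ C₀ * B θ T :=
    (h₀ θ).trans (le_mul_of_one_le_right hC₀ hB1)
  calc _ ≤ (C₀ * B θ T + (8 * C₁ + 2 * C₂) * B θ T / (1 - q)) / (1 - q) := by
        gcongr
    _ = _ := by ring

end Controlled

/-! ### The exact gradient -/

section Exact

variable {E : ℕ} {d : Fin (E + 1) → ℕ} {dw : Fin E → ℕ}

/-- The exact activation gradients: `v_E = 1` and `v_{e-1} = ∇₁ a_e (y_{e-1}, w_e)ᵀ v_e`. -/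
noncomputable def cotangent (a : Operators d dw) (x : Act d 0) (w : Params dw) (j : Fin (E + 1)) :
    Act d j :=
  Fin.reverseInduction (motive := fun j => Act d j) (WithLp.toLp 2 fun _ => 1)
    (fun e v => ContinuousLinearMap.adjoint (jac₁ a e (activation a x w e.castSucc) (w e)) v) j

/-- The gradient of the sample loss, computed by backpropagation. -/
noncomputable def lossGrad (a : Operators d dw) (x : Act d 0) (w : Params dw) : Params dw :=
  WithLp.toLp 2 fun e =>
    ContinuousLinearMap.adjoint (jac₂ a e (activation a x w e.castSucc) (w e))
      (cotangent a x w e.succ)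

/-- The derivatives of the activations with respect to the weights. -/
noncomputable def tangent (a : Operators d dw) (x : Act d 0) (w : Params dw) (j : Fin (E + 1)) :
    Params dw →L[ℝ] Act d j :=
  Fin.induction (motive := fun j => Params dw →L[ℝ] Act d j) 0
    (fun e A => (jac₁ a e (activation a x w e.castSucc) (w e)).comp A +
      (jac₂ a e (activation a x w e.castSucc) (w e)).comp
        (PiLp.proj 2 (fun e : Fin E => Wt dw e) e)) j

variable {a : Operators d dw} {D : Measure (Act d 0)} {Lℓ Ca La Lga σ : ℝ}

theorem activation_succ (x : Act d 0) (w : Params dw) (e : Fin E) :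
    activation a x w e.succ = a e (activation a x w e.castSucc) (w e) :=
  Fin.induction_succ ..

theorem activation_of_val_eq_zero (x : Act d 0) (w w' : Params dw) {j : Fin (E + 1)}
    (hj : (j : ℕ) = 0) : activation a x w j = activation a x w' j := by
  obtain rfl : j = 0 := Fin.ext hj
  rfl

theorem cotangent_last (x : Act d 0) (w : Params dw) :
    cotangent a x w (Fin.last E) = WithLp.toLp 2 fun _ => 1 :=
  Fin.reverseInduction_last ..

theorem cotangent_castSucc (x : Act d 0) (w : Params dw) (e : Fin E) :
    cotangent a x w e.castSucc = ContinuousLinearMap.adjoint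
      (jac₁ a e (activation a x w e.castSucc) (w e)) (cotangent a x w e.succ) :=
  Fin.reverseInduction_castSucc ..

theorem tangent_succ (x : Act d 0) (w : Params dw) (e : Fin E) :
    tangent a x w e.succ = (jac₁ a e (activation a x w e.castSucc) (w e)).comp
        (tangent a x w e.castSucc) +
      (jac₂ a e (activation a x w e.castSucc) (w e)).comp
        (PiLp.proj 2 (fun e : Fin E => Wt dw e) e) :=
  Fin.induction_succ ..

/-- Chain rule along the pipeline; joint differentiability of each operator turns its two partial
Jacobians into the two halves of one derivative. -/
theorem hasFDerivAt_activation
    (hdiff : ∀ e, Differentiable ℝ (fun z : Act d e.castSucc × Wt dw e => a e z.1 z.2))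
    (x : Act d 0) (w : Params dw) (j : Fin (E + 1)) :
    HasFDerivAt (fun w => activation a x w j) (tangent a x w j) w := by
  induction j using Fin.induction with
  | zero => exact hasFDerivAt_const x w
  | succ e ih =>
    set y := activation a x w e.castSucc
    have hF := (hdiff e (y, w e)).hasFDerivAt
    have h₁ : jac₁ a e y (w e)
        = (fderiv ℝ (fun z : Act d e.castSucc × Wt dw e => a e z.1 z.2) (y, w e)).comp
          (ContinuousLinearMap.inl ℝ _ _) :=
      (HasFDerivAt.comp y (f := fun y' => (y', w e)) hF
        (hasFDerivAt_prodMk_left y (w e))).fderiv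
    have h₂ : jac₂ a e y (w e)
        = (fderiv ℝ (fun z : Act d e.castSucc × Wt dw e => a e z.1 z.2) (y, w e)).comp
          (ContinuousLinearMap.inr ℝ _ _) :=
      (HasFDerivAt.comp (w e) (f := fun w' => (y, w')) hF
        (hasFDerivAt_prodMk_right y (w e))).fderiv
    have hpr : HasFDerivAt (fun w : Params dw => w e)
        (PiLp.proj 2 (fun e : Fin E => Wt dw e) e) w :=
      (PiLp.proj (𝕜 := ℝ) 2 (fun e : Fin E => Wt dw e) e).hasFDerivAt
    have hc := HasFDerivAt.comp w (f := fun w => (activation a x w e.castSucc, w e)) hF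
      (ih.prodMk hpr)
    simp only [activation_succ]
    refine hc.congr_fderiv ?_
    rw [tangent_succ]
    ext h : 1
    simp only [ContinuousLinearMap.comp_apply, add_apply,
      ContinuousLinearMap.prod_apply]
    change _ = jac₁ a e y (w e) _ + jac₂ a e y (w e) _
    rw [h₁, h₂]
    simp only [ContinuousLinearMap.comp_apply, ContinuousLinearMap.inl_apply,
      ContinuousLinearMap.inr_apply, ← map_add, Prod.mk_add_mk, add_zero, zero_add]

/-- Backpropagation as a telescoping sum: by adjointness, the pairing of cotangent and tangent grows
at worker `e` by exactly the contribution of `h e`, and it is `0` at the input, which does not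
depend on the weights. -/
theorem inner_cotangent_tangent_last (x : Act d 0) (w h : Params dw) :
    inner ℝ (cotangent a x w (Fin.last E)) (tangent a x w (Fin.last E) h)
      = inner ℝ (lossGrad a x w) h := by
  set φ : Fin (E + 1) → ℝ := fun j => inner ℝ (cotangent a x w j) (tangent a x w j h)
  have hφ0 : φ 0 = 0 := by
    have : tangent a x w 0 = 0 := rfl
    simp [φ, this]
  have hφ : ∀ e : Fin E, φ e.succ = φ e.castSucc + inner ℝ (lossGrad a x w e) (h e) := by
    intro e
    simp only [φ, lossGrad, tangent_succ, cotangent_castSucc, add_apply,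
      ContinuousLinearMap.comp_apply, inner_add_right, ContinuousLinearMap.adjoint_inner_left]
    rfl
  -- The sum of `φ` with its first or its last term split off; comparing the two performs the
  -- telescoping.
  have h₁ := Fin.sum_univ_succ φ
  have h₂ := Fin.sum_univ_castSucc φ
  simp only [hφ, Finset.sum_add_distrib] at h₁
  rw [PiLp.inner_apply (lossGrad a x w) h]
  change φ (Fin.last E) = _
  linarith

theorem gradient_loss
    (hdiff : ∀ e, Differentiable ℝ (fun z : Act d e.castSucc × Wt dw e => a e z.1 z.2))
    (x : Act d 0) (w : Params dw) : gradient (loss a x) w = lossGrad a x w := by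
  refine HasGradientAt.gradient (hasGradientAt_iff_hasFDerivAt.2 ?_)
  -- The loss is the pairing of the last activation with the vector from which the cotangents start.
  have hl : loss a x = fun w => inner ℝ (WithLp.toLp 2 fun _ => 1 : Act d (Fin.last E))
      (activation a x w (Fin.last E)) := by
    funext w
    simp [loss, PiLp.inner_apply]
  rw [hl]
  have := ((innerSL ℝ (WithLp.toLp 2 fun _ => 1 : Act d (Fin.last E))).hasFDerivAt).comp w
    (hasFDerivAt_activation hdiff x w (Fin.last E))
  refine this.congr_fderiv ?_
  ext h : 1
  rw [InnerProductSpace.toDual_apply_apply, ← inner_cotangent_tangent_last, cotangent_last]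
  rfl

/-! ### Boundedness and Lipschitz continuity -/

/-- The asymmetric split is deliberate: only the second vector needs a bound, and it will be an
exact cotangent, which is bounded, while the compressed one need not be. -/
theorem norm_adjoint_sub_adjoint_le {V W : Type*} [NormedAddCommGroup V] [InnerProductSpace ℝ V]
    [CompleteSpace V] [NormedAddCommGroup W] [InnerProductSpace ℝ W] [CompleteSpace W]
    (A B : V →L[ℝ] W) (u v : W) :
    ‖ContinuousLinearMap.adjoint A u - ContinuousLinearMap.adjoint B v‖
      ≤ ‖A‖ * ‖u - v‖ + ‖A - B‖ * ‖v‖ := by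
  have : ContinuousLinearMap.adjoint A u - ContinuousLinearMap.adjoint B v
      = ContinuousLinearMap.adjoint A (u - v) + ContinuousLinearMap.adjoint (A - B) v := by
    simp
  rw [this, ← LinearIsometryEquiv.norm_map ContinuousLinearMap.adjoint A,
    ← LinearIsometryEquiv.norm_map ContinuousLinearMap.adjoint (A - B)]
  exact (norm_add_le _ _).trans
    (add_le_add (ContinuousLinearMap.le_opNorm _ _) (ContinuousLinearMap.le_opNorm _ _))

theorem le_abs_mul_add_of_sq_le {A L p q : ℝ} (hp : 0 ≤ p) (hq : 0 ≤ q)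
    (h : A ^ 2 ≤ L ^ 2 * (p ^ 2 + q ^ 2)) : A ≤ |L| * (p + q) := by
  refine le_of_sq_le_sq ?_ (by positivity)
  rw [mul_pow, sq_abs]
  refine h.trans (mul_le_mul_of_nonneg_left ?_ (sq_nonneg L))
  nlinarith [mul_nonneg hp hq]

theorem norm_params_le_sum (v : Params dw) : ‖v‖ ≤ ∑ e, ‖v e‖ := by
  refine le_of_sq_le_sq ?_ (Finset.sum_nonneg fun _ _ => norm_nonneg _)
  rw [PiLp.norm_sq_eq_of_L2]
  exact Finset.sum_sq_le_sq_sum_of_nonneg fun _ _ => norm_nonneg _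

theorem IsSmooth.op_lip' (hs : IsSmooth a D Lℓ Ca La Lga) {e : Fin E} (he : (e : ℕ) + 1 < E)
    (y y' w w') : ‖a e y w - a e y' w'‖ ≤ |La| * (‖y - y'‖ + ‖w - w'‖) :=
  le_abs_mul_add_of_sq_le (norm_nonneg _) (norm_nonneg _) (hs.op_lip e he y y' w w')

theorem IsSmooth.jac₁_lip' (hs : IsSmooth a D Lℓ Ca La Lga) {e : Fin E} (he : 0 < (e : ℕ))
    (y y' w w') : ‖jac₁ a e y w - jac₁ a e y' w'‖ ≤ |Lga| * (‖y - y'‖ + ‖w - w'‖) :=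
  le_abs_mul_add_of_sq_le (norm_nonneg _) (norm_nonneg _) (hs.jac₁_lip e he y y' w w')

theorem IsSmooth.jac₂_lip' (hs : IsSmooth a D Lℓ Ca La Lga) {e : Fin E} (he : 0 < (e : ℕ))
    (y y' w w') : ‖jac₂ a e y w - jac₂ a e y' w'‖ ≤ |Lga| * (‖y - y'‖ + ‖w - w'‖) :=
  le_abs_mul_add_of_sq_le (norm_nonneg _) (norm_nonneg _) (hs.jac₂_lip e he y y' w w')

theorem IsSmooth.jac₂_first_lip' (hs : IsSmooth a D Lℓ Ca La Lga) {e : Fin E} (he : (e : ℕ) = 0)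
    (y w w') : ‖jac₂ a e y w - jac₂ a e y w'‖ ≤ |Lga| * ‖w - w'‖ :=
  (hs.jac₂_first_lip e he y w w').trans
    (mul_le_mul_of_nonneg_right (le_abs_self _) (norm_nonneg _))

/-- The last activation is left out because the joint Lipschitz assumption on the operators stops
before the last worker. -/
theorem IsSmooth.activation_lip (hs : IsSmooth a D Lℓ Ca La Lga) (j : Fin (E + 1))
    (hj : j ≠ Fin.last E) : ∃ K, 0 ≤ K ∧ ∀ x x' w w',
      ‖activation a x w j - activation a x' w' j‖ ≤ K * (‖x - x'‖ + ‖w - w'‖) := by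
  induction j using Fin.induction with
  | zero =>
    refine ⟨1, zero_le_one, fun x x' w w' => ?_⟩
    have : ‖x - x'‖ ≤ 1 * (‖x - x'‖ + ‖w - w'‖) := by
      rw [one_mul]; exact le_add_of_nonneg_right (norm_nonneg _)
    exact this
  | succ e ih =>
    obtain ⟨K, hK, h⟩ := ih (Fin.castSucc_lt_last e).ne
    have he : (e : ℕ) + 1 < E := by
      have := Fin.val_lt_last hj
      simpa using this
    refine ⟨|La| * (K + 1), by positivity, fun x x' w w' => ?_⟩
    rw [activation_succ, activation_succ]
    refine (hs.op_lip' he _ _ _ _).trans ?_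
    rw [mul_assoc]
    refine mul_le_mul_of_nonneg_left ?_ (abs_nonneg La)
    have h₁ := h x x' w w'
    have h₂ : ‖w e - w' e‖ ≤ ‖w - w'‖ := PiLp.norm_apply_le (w - w') e
    nlinarith [norm_nonneg (x - x')]

theorem IsSmooth.cotangent_le (hs : IsSmooth a D Lℓ Ca La Lga) (j : Fin (E + 1)) :
    ∃ G, 0 ≤ G ∧ ∀ x w, ‖cotangent a x w j‖ ≤ G := by
  induction j using Fin.reverseInduction with
  | last => exact ⟨_, norm_nonneg _, fun x w => (congrArg norm (cotangent_last x w)).le⟩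
  | cast e ih =>
    obtain ⟨G, hG, h⟩ := ih
    refine ⟨|Ca| * G, by positivity, fun x w => ?_⟩
    rw [cotangent_castSucc]
    refine (ContinuousLinearMap.le_opNorm _ _).trans ?_
    rw [LinearIsometryEquiv.norm_map]
    exact mul_le_mul ((hs.jac₁_le e _ _).trans (le_abs_self _)) (h x w) (norm_nonneg _)
      (abs_nonneg _)

/-- A product of bounded Lipschitz maps is Lipschitz. Index `0` is left out: it would involve `∇₁`
of the first worker, on which there is no Lipschitz assumption. -/
theorem IsSmooth.cotangent_lip (hs : IsSmooth a D Lℓ Ca La Lga) (j : Fin (E + 1))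
    (hj : j ≠ 0) : ∃ K, 0 ≤ K ∧ ∀ x x' w w',
      ‖cotangent a x w j - cotangent a x' w' j‖ ≤ K * (‖x - x'‖ + ‖w - w'‖) := by
  induction j using Fin.reverseInduction with
  | last => exact ⟨0, le_rfl, fun x x' w w' => by simp [cotangent_last]⟩
  | cast e ih =>
    obtain ⟨K, hK, h⟩ := ih (Fin.succ_ne_zero e)
    obtain ⟨G, hG, hb⟩ := hs.cotangent_le e.succ
    obtain ⟨M, hM, hl⟩ := hs.activation_lip e.castSucc (Fin.castSucc_lt_last e).ne
    have he : 0 < (e : ℕ) := Nat.pos_of_ne_zero fun h0 => hj (Fin.ext h0)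
    refine ⟨|Ca| * K + |Lga| * (M + 1) * G, by positivity, fun x x' w w' => ?_⟩
    rw [cotangent_castSucc, cotangent_castSucc]
    refine (norm_adjoint_sub_adjoint_le _ _ _ _).trans ?_
    have h₂ : ‖w e - w' e‖ ≤ ‖w - w'‖ := PiLp.norm_apply_le (w - w') e
    have h₃ := hl x x' w w'
    have h₄ : ‖jac₁ a e (activation a x w e.castSucc) (w e)
        - jac₁ a e (activation a x' w' e.castSucc) (w' e)‖
        ≤ |Lga| * ((M + 1) * (‖x - x'‖ + ‖w - w'‖)) := by
      refine (hs.jac₁_lip' he _ _ _ _).trans (mul_le_mul_of_nonneg_left ?_ (abs_nonneg _))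
      nlinarith [norm_nonneg (x - x')]
    calc _ ≤ |Ca| * (K * (‖x - x'‖ + ‖w - w'‖))
          + |Lga| * ((M + 1) * (‖x - x'‖ + ‖w - w'‖)) * G := by
          gcongr
          · exact (hs.jac₁_le e _ _).trans (le_abs_self _)
          · exact h x x' w w'
          · exact hb x' w'
      _ = _ := by ring

theorem IsSmooth.lossGrad_le (hs : IsSmooth a D Lℓ Ca La Lga) :
    ∃ G, 0 ≤ G ∧ ∀ x w, ‖lossGrad a x w‖ ≤ G := by
  choose G hG h using hs.cotangent_le
  refine ⟨∑ e : Fin E, |Ca| * G e.succ,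
    Finset.sum_nonneg fun e _ => mul_nonneg (abs_nonneg _) (hG _), fun x w => ?_⟩
  refine (norm_params_le_sum _).trans (Finset.sum_le_sum fun e _ => ?_)
  refine (ContinuousLinearMap.le_opNorm _ _).trans ?_
  rw [LinearIsometryEquiv.norm_map]
  exact mul_le_mul ((hs.jac₂_le e _ _).trans (le_abs_self _)) (h _ x w) (norm_nonneg _)
    (abs_nonneg _)

/-- Only the weights vary, since `∇₂ a_1` is Lipschitz in the weights at a fixed sample but not
assumed so in the sample. -/
theorem IsSmooth.lossGrad_lip (hs : IsSmooth a D Lℓ Ca La Lga) :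
    ∃ K, 0 ≤ K ∧ ∀ x w w', ‖lossGrad a x w - lossGrad a x w'‖ ≤ K * ‖w - w'‖ := by
  have key : ∀ e : Fin E, ∃ K, 0 ≤ K ∧ ∀ x w w',
      ‖(lossGrad a x w - lossGrad a x w') e‖ ≤ K * ‖w - w'‖ := by
    intro e
    obtain ⟨K, hK, h⟩ := hs.cotangent_lip e.succ (Fin.succ_ne_zero e)
    obtain ⟨G, hG, hb⟩ := hs.cotangent_le e.succ
    obtain ⟨M, hM, hl⟩ := hs.activation_lip e.castSucc (Fin.castSucc_lt_last e).ne
    refine ⟨|Ca| * K + |Lga| * (M + 1) * G, by positivity, fun x w w' => ?_⟩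
    refine (norm_adjoint_sub_adjoint_le _ _ _ _).trans ?_
    have h₂ : ‖w e - w' e‖ ≤ ‖w - w'‖ := PiLp.norm_apply_le (w - w') e
    have h₃ := hl x x w w'
    have h₅ := h x x w w'
    simp only [sub_self, norm_zero, zero_add] at h₃ h₅
    have h₄ : ‖jac₂ a e (activation a x w e.castSucc) (w e)
        - jac₂ a e (activation a x w' e.castSucc) (w' e)‖
        ≤ |Lga| * ((M + 1) * ‖w - w'‖) := by
      rcases Nat.eq_zero_or_pos (e : ℕ) with he | he
      · rw [activation_of_val_eq_zero x w w' (j := e.castSucc) he]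
        refine (hs.jac₂_first_lip' he _ _ _).trans (mul_le_mul_of_nonneg_left ?_ (abs_nonneg _))
        nlinarith [norm_nonneg (w - w')]
      · refine (hs.jac₂_lip' he _ _ _ _).trans (mul_le_mul_of_nonneg_left ?_ (abs_nonneg _))
        nlinarith
    calc _ ≤ |Ca| * (K * ‖w - w'‖) + |Lga| * ((M + 1) * ‖w - w'‖) * G := by
          gcongr
          · exact (hs.jac₂_le e _ _).trans (le_abs_self _)
          · exact hb x w'
      _ = _ := by ring
  choose K hK h using key
  refine ⟨∑ e, K e, Finset.sum_nonneg fun e _ => hK e, fun x w w' => ?_⟩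
  rw [Finset.sum_mul]
  exact (norm_params_le_sum _).trans (Finset.sum_le_sum fun e _ => h e x w w')

/-- The mean value inequality on the segment yields the constant `|Lℓ|` in place of the sharp half
of it, which is enough here. -/
theorem IsSmooth.risk_le (hs : IsSmooth a D Lℓ Ca La Lga) (w w' : Params dw) :
    risk a D w' ≤ risk a D w + inner ℝ (gradient (risk a D) w) (w' - w)
      + |Lℓ| * ‖w' - w‖ ^ 2 := by
  have h := (convex_segment w w').norm_image_sub_le_of_norm_fderiv_le' (𝕜 := ℝ)
    (f := risk a D) (φ := fderiv ℝ (risk a D) w) (C := |Lℓ| * ‖w' - w‖)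
    (fun z _ => hs.risk_diff z) (fun z hz => ?_) (left_mem_segment ℝ w w')
    (right_mem_segment ℝ w w')
  · have hi : fderiv ℝ (risk a D) w (w' - w) = inner ℝ (gradient (risk a D) w) (w' - w) := by
      rw [gradient, InnerProductSpace.toDual_symm_apply]
    rw [hi, Real.norm_eq_abs] at h
    have := (abs_le.1 h).2
    nlinarith
  · have : ‖fderiv ℝ (risk a D) z - fderiv ℝ (risk a D) w‖
        = ‖gradient (risk a D) z - gradient (risk a D) w‖ := by
      rw [gradient, gradient, ← map_sub, LinearIsometryEquiv.norm_map]
    rw [this]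
    refine (hs.risk_lip z w).trans ?_
    have hz' : ‖z - w‖ ≤ ‖w' - w‖ := by
      obtain ⟨t, ht, rfl⟩ := (segment_eq_image' ℝ w w').subset hz
      simp only [add_sub_cancel_left, norm_smul, Real.norm_eq_abs, abs_of_nonneg ht.1]
      exact mul_le_of_le_one_left (norm_nonneg _) ht.2
    exact mul_le_mul (le_abs_self _) hz' (norm_nonneg _) (abs_nonneg _)

theorem IsSmooth.gradient_risk_le [IsProbabilityMeasure D] (hs : IsSmooth a D Lℓ Ca La Lga)
    (hu : IsUnbiased a D σ) {G : ℝ} (hG : ∀ x w, ‖lossGrad a x w‖ ≤ G) (w : Params dw) :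
    ‖gradient (risk a D) w‖ ≤ G := by
  rw [← hu.mean w]
  have h := norm_integral_le_of_norm_le_const (μ := D) (f := fun x => gradient (loss a x) w)
    (C := G) (ae_of_all _ fun x => by rw [gradient_loss hs.op_diff]; exact hG x w)
  simpa using h

end Exact

/-! ### Measurability -/

section Measurability

variable {E : ℕ} {d : Fin (E + 1) → ℕ} {dw : Fin E → ℕ} {a : Operators d dw}
variable {Ω : Type*} [MeasurableSpace Ω]

theorem measurable_adjoint_apply {V W : Type*} [NormedAddCommGroup V] [InnerProductSpace ℝ V]
    [FiniteDimensional ℝ V] [CompleteSpace V] [NormedAddCommGroup W] [InnerProductSpace ℝ W]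
    [FiniteDimensional ℝ W] [CompleteSpace W] [MeasurableSpace V] [BorelSpace V]
    [MeasurableSpace W] [BorelSpace W] {A : Ω → V →L[ℝ] W} {v : Ω → W} (hA : Measurable A)
    (hv : Measurable v) : Measurable fun ω => ContinuousLinearMap.adjoint (A ω) (v ω) := by
  have : ProperSpace W := FiniteDimensional.proper_real W
  have hadj : Continuous (ContinuousLinearMap.adjoint (𝕜 := ℝ) (E := V) (F := W)) :=
    LinearIsometryEquiv.continuous _
  have hA' : Measurable fun ω => ContinuousLinearMap.adjoint (A ω) := hadj.measurable.comp hA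
  have hm : Measurable fun q : (W →L[ℝ] V) × W => q.1 q.2 :=
    Continuous.measurable (by fun_prop)
  exact hm.comp (hA'.prodMk hv)

theorem measurable_params_apply {w : Ω → Params dw} (hw : Measurable w) (e : Fin E) :
    Measurable fun ω => w ω e :=
  (PiLp.continuous_apply 2 (fun e : Fin E => Wt dw e) e).measurable.comp hw

theorem measurable_params {w : Ω → Params dw} (hw : ∀ e, Measurable fun ω => w ω e) :
    Measurable w :=
  (PiLp.continuous_toLp 2 (fun e : Fin E => Wt dw e)).measurable.comp (measurable_pi_iff.2 hw)

variable (hdiff : ∀ e, Differentiable ℝ (fun z : Act d e.castSucc × Wt dw e => a e z.1 z.2))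

include hdiff

theorem measurable_op {e : Fin E} {y : Ω → Act d e.castSucc} {w : Ω → Wt dw e}
    (hy : Measurable y) (hw : Measurable w) : Measurable fun ω => a e (y ω) (w ω) :=
  (hdiff e).continuous.measurable.comp (hy.prodMk hw)

/-- Derivatives of a jointly continuous family are jointly measurable; continuity of the Jacobian is
not assumed for the first worker. -/
theorem measurable_jac₁ {e : Fin E} {y : Ω → Act d e.castSucc} {w : Ω → Wt dw e}
    (hy : Measurable y) (hw : Measurable w) : Measurable fun ω => jac₁ a e (y ω) (w ω) := by
  have hc : Continuous (Function.uncurry fun (w : Wt dw e) (y : Act d e.castSucc) => a e y w) :=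
    (hdiff e).continuous.comp continuous_swap
  exact (measurable_fderiv_with_param ℝ hc).comp (hw.prodMk hy)

theorem measurable_jac₂ {e : Fin E} {y : Ω → Act d e.castSucc} {w : Ω → Wt dw e}
    (hy : Measurable y) (hw : Measurable w) : Measurable fun ω => jac₂ a e (y ω) (w ω) := by
  have hc : Continuous (Function.uncurry fun (y : Act d e.castSucc) (w : Wt dw e) => a e y w) :=
    (hdiff e).continuous
  exact (measurable_fderiv_with_param ℝ hc).comp (hy.prodMk hw)

theorem measurable_activation {x : Ω → Act d 0} {w : Ω → Params dw} (hx : Measurable x)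
    (hw : Measurable w) (j : Fin (E + 1)) : Measurable fun ω => activation a (x ω) (w ω) j := by
  induction j using Fin.induction with
  | zero => exact hx
  | succ e ih =>
    simp only [activation_succ]
    exact measurable_op hdiff ih (measurable_params_apply hw e)

theorem measurable_cotangent {x : Ω → Act d 0} {w : Ω → Params dw} (hx : Measurable x)
    (hw : Measurable w) (j : Fin (E + 1)) : Measurable fun ω => cotangent a (x ω) (w ω) j := by
  induction j using Fin.reverseInduction with
  | last => simp only [cotangent_last]; exact measurable_const
  | cast e ih =>
    simp only [cotangent_castSucc]
    exact measurable_adjoint_apply (measurable_jac₁ hdiff (measurable_activation hdiff hx hw _)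
      (measurable_params_apply hw e)) ih

theorem measurable_lossGrad {x : Ω → Act d 0} {w : Ω → Params dw} (hx : Measurable x)
    (hw : Measurable w) : Measurable fun ω => lossGrad a (x ω) (w ω) :=
  measurable_params fun e => measurable_adjoint_apply
    (measurable_jac₂ hdiff (measurable_activation hdiff hx hw _) (measurable_params_apply hw e))
    (measurable_cotangent hdiff hx hw _)

end Measurability

/-! ### The algorithm -/

section Algorithm

variable {E : ℕ} {d : Fin (E + 1) → ℕ} {dw : Fin E → ℕ} {a : Operators d dw}
variable {Z : Type*}

/-! ### Recursions of the two passes and their dependence on the seeds -/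

section Recursion

variable {QF QB : Compressors d Z}

theorem forward_succ (x : Act d 0) (yOld : ∀ j, Act d j) (w : Params dw) (z : Fin (E + 1) → Z)
    (e : Fin E) : forward a QF x yOld w z e.succ = yOld e.succ +
      QF e.succ (z e.succ) (a e (forward a QF x yOld w z e.castSucc) (w e) - yOld e.succ) :=
  Fin.induction_succ ..

theorem backward_last (y vOld : ∀ j, Act d j) (w : Params dw) (z : Fin (E + 1) → Z) :
    backward a QB y vOld w z (Fin.last E) = WithLp.toLp 2 fun _ => 1 :=
  Fin.reverseInduction_last ..

theorem backward_castSucc (y vOld : ∀ j, Act d j) (w : Params dw) (z : Fin (E + 1) → Z)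
    (e : Fin E) : backward a QB y vOld w z e.castSucc = vOld e.castSucc +
      QB e.castSucc (z e.castSucc) (ContinuousLinearMap.adjoint (jac₁ a e (y e.castSucc) (w e))
        (backward a QB y vOld w z e.succ) - vOld e.castSucc) :=
  Fin.reverseInduction_castSucc ..

/-- Causality inside an iteration: a message does not depend on the seeds used further along the
pass, so what is compressed at `i` is independent of the seed at `i`. -/
theorem forward_update (x : Act d 0) (yOld : ∀ j, Act d j) (w : Params dw) (z : Fin (E + 1) → Z)
    (z' : Z) {i j : Fin (E + 1)} (hij : j < i) :
    forward a QF x yOld w (Function.update z i z') j = forward a QF x yOld w z j := by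
  induction j using Fin.induction with
  | zero => rfl
  | succ e ih =>
    rw [forward_succ, forward_succ, ih ((Fin.castSucc_lt_succ).trans hij),
      Function.update_of_ne hij.ne]

theorem backward_update (y vOld : ∀ j, Act d j) (w : Params dw) (z : Fin (E + 1) → Z)
    (z' : Z) {i j : Fin (E + 1)} (hij : i < j) :
    backward a QB y vOld w (Function.update z i z') j = backward a QB y vOld w z j := by
  induction j using Fin.reverseInduction with
  | last => rw [backward_last, backward_last]
  | cast e ih =>
    rw [backward_castSucc, backward_castSucc, ih (hij.trans Fin.castSucc_lt_succ),
      Function.update_of_ne hij.ne']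

variable (a QF QB) in
-- Causality in time: the run is adapted to the randomness.
theorem run_update (w₁ : Params dw) (γ m : ℝ) (ω : ℕ → Noise d Z) (n : Noise d Z) {s t : ℕ}
    (hst : t < s) :
    run a QF QB w₁ γ m t (Function.update ω s n) = run a QF QB w₁ γ m t ω := by
  induction t with
  | zero => rfl
  | succ t ih =>
    simp only [run]
    rw [ih (by omega), Function.update_of_ne hst.ne]

end Recursion

variable [MeasurableSpace Z]

theorem measurable_lazySample {Ω : Type*} [MeasurableSpace Ω] (t : ℕ) {x : Ω → Act d 0}
    {n : Ω → Noise d Z} (hx : Measurable x) (hn : Measurable n) :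
    Measurable fun ω => lazySample t (x ω) (n ω) := by
  unfold lazySample
  by_cases ht : t = 1
  · simp only [ht, true_or, if_true]
    exact measurable_fst.comp hn
  · simp only [ht, false_or]
    refine Measurable.ite ?_ (measurable_fst.comp hn) hx
    exact (measurable_fst.comp (measurable_snd.comp hn)) (measurableSet_singleton true)

variable {D : Measure (Act d 0)} {ν : Measure Z} {QF QB : Compressors d Z} {w₁ : Params dw}
  {γ m Lℓ Ca La Lga σ ωF ωB : ℝ}

theorem measurable_run
    (hdiff : ∀ e, Differentiable ℝ (fun z : Act d e.castSucc × Wt dw e => a e z.1 z.2))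
    (hF : IsContractive QF ν ωF) (hB : IsContractive QB ν ωB) (t : ℕ) :
    Measurable (fun ω => (run a QF QB w₁ γ m t ω).x) ∧
    (∀ j, Measurable fun ω => (run a QF QB w₁ γ m t ω).y j) ∧
    (∀ j, Measurable fun ω => (run a QF QB w₁ γ m t ω).v j) ∧
    Measurable (fun ω => (run a QF QB w₁ γ m t ω).u) ∧
    Measurable (fun ω => (run a QF QB w₁ γ m t ω).w) := by
  induction t with
  | zero =>
    exact ⟨measurable_const, fun _ => measurable_const, fun _ => measurable_const,
      measurable_const, measurable_const⟩
  | succ t ih =>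
    obtain ⟨hx, hy, hv, hu, hw⟩ := ih
    have hn : Measurable fun ω : ℕ → Noise d Z => ω (t + 1) := measurable_pi_apply _
    have hx' : Measurable fun ω => (run a QF QB w₁ γ m (t + 1) ω).x :=
      measurable_lazySample (t + 1) hx hn
    have hy' : ∀ j, Measurable fun ω => (run a QF QB w₁ γ m (t + 1) ω).y j := by
      intro j
      induction j using Fin.induction with
      | zero => exact hx'
      | succ e ih =>
        simp only [run, step, forward_succ]
        refine (hy _).add ((hF.measurable e.succ).comp (Measurable.prodMk ?_
          ((measurable_op hdiff ih (measurable_params_apply hw e)).sub (hy _))))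
        exact (measurable_pi_apply _).comp hn.snd.snd.fst
    have hv' : ∀ j, Measurable fun ω => (run a QF QB w₁ γ m (t + 1) ω).v j := by
      intro j
      induction j using Fin.reverseInduction with
      | last => simp only [run, step, backward_last]; exact measurable_const
      | cast e ih =>
        simp only [run, step, backward_castSucc]
        refine (hv _).add ((hB.measurable e.castSucc).comp (Measurable.prodMk ?_
          ((measurable_adjoint_apply (measurable_jac₁ hdiff (hy' e.castSucc)
            (measurable_params_apply hw e)) ih).sub (hv _))))
        exact (measurable_pi_apply _).comp hn.snd.snd.snd
    have hu' : Measurable fun ω => (run a QF QB w₁ γ m (t + 1) ω).u :=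
      measurable_params fun e => ((measurable_params_apply hu e).const_smul (1 - m)).add
        ((measurable_adjoint_apply (measurable_jac₂ hdiff (hy' e.castSucc)
            (measurable_params_apply hw e)) (hv' e.succ)).const_smul m)
    exact ⟨hx', hy', hv', hu', hw.sub (hu'.const_smul γ)⟩

variable [IsProbabilityMeasure D] [IsProbabilityMeasure ν] {p : unitInterval}

instance : IsProbabilityMeasure (pathLaw D ν p) := by
  unfold pathLaw
  infer_instance

theorem isResampling_forward_seed (t : ℕ) (j : Fin (E + 1)) :
    IsResampling (fun (ω : ℕ → Noise d Z) z => Function.update ω t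
      ((ω t).1, (ω t).2.1, Function.update (ω t).2.2.1 j z, (ω t).2.2.2)) (pathLaw D ν p) ν :=
  IsResampling.update (μ := fun t => noiseLaw D ν (schedule p t))
    ((((isResampling_pi_update (fun _ : Fin (E + 1) => ν) j).prod_left
      (Measure.pi fun _ : Fin (E + 1) => ν)).prod_right _).prod_right D)

theorem isResampling_backward_seed (t : ℕ) (j : Fin (E + 1)) :
    IsResampling (fun (ω : ℕ → Noise d Z) z => Function.update ω t
      ((ω t).1, (ω t).2.1, (ω t).2.2.1, Function.update (ω t).2.2.2 j z)) (pathLaw D ν p) ν :=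
  IsResampling.update (μ := fun t => noiseLaw D ν (schedule p t))
    ((((isResampling_pi_update (fun _ : Fin (E + 1) => ν) j).prod_right
      (Measure.pi fun _ : Fin (E + 1) => ν)).prod_right _).prod_right D)

/-- The forward compression error at worker `e`. -/
theorem forward_error
    (hdiff : ∀ e, Differentiable ℝ (fun z : Act d e.castSucc × Wt dw e => a e z.1 z.2))
    (hF : IsContractive QF ν ωF) (hB : IsContractive QB ν ωB) (t : ℕ) {e : Fin E}
    (he : e.succ ≠ Fin.last E)
    (hδ : MemLp (fun ω => a e ((run a QF QB w₁ γ m (t + 1) ω).y e.castSucc)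
      ((run a QF QB w₁ γ m t ω).w e) - (run a QF QB w₁ γ m t ω).y e.succ) 2 (pathLaw D ν p)) :
    MemLp (fun ω => (run a QF QB w₁ γ m (t + 1) ω).y e.succ
      - a e ((run a QF QB w₁ γ m (t + 1) ω).y e.castSucc) ((run a QF QB w₁ γ m t ω).w e)) 2
      (pathLaw D ν p) ∧
    lpNorm (fun ω => (run a QF QB w₁ γ m (t + 1) ω).y e.succ
      - a e ((run a QF QB w₁ γ m (t + 1) ω).y e.castSucc) ((run a QF QB w₁ γ m t ω).w e)) 2
      (pathLaw D ν p)
    ≤ ωF * lpNorm (fun ω => a e ((run a QF QB w₁ γ m (t + 1) ω).y e.castSucc)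
      ((run a QF QB w₁ γ m t ω).w e) - (run a QF QB w₁ γ m t ω).y e.succ) 2 (pathLaw D ν p) := by
  obtain ⟨-, hy, -, -, hw⟩ :=
    measurable_run (w₁ := w₁) (γ := γ) (m := m) (a := a) hdiff hF hB t
  obtain ⟨-, hy', -, -, -⟩ :=
    measurable_run (w₁ := w₁) (γ := γ) (m := m) (a := a) hdiff hF hB (t + 1)
  have key := memLp_compression_error (isResampling_forward_seed (D := D) (p := p) (t + 1) e.succ)
    (hF.measurable e.succ) hF.nonneg (hF.integrable _ (Fin.succ_ne_zero e) he)
    (hF.contract _ (Fin.succ_ne_zero e) he)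
    (seed := fun ω : ℕ → Noise d Z => (ω (t + 1)).2.2.1 e.succ)
    ((measurable_pi_apply _).comp (measurable_pi_apply (t + 1)).snd.snd.fst)
    (fun ω z => by simp)
    (δ := fun ω => a e ((run a QF QB w₁ γ m (t + 1) ω).y e.castSucc)
      ((run a QF QB w₁ γ m t ω).w e) - (run a QF QB w₁ γ m t ω).y e.succ)
    ((measurable_op hdiff (hy' e.castSucc) (measurable_params_apply hw e)).sub (hy e.succ))
    -- The vector to be compressed does not see its own seed: the old state by causality in time,
    -- the incoming message by causality along the pipeline.
    (fun ω z => by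
      have h₁ := run_update a QF QB w₁ γ m ω ((ω (t + 1)).1, (ω (t + 1)).2.1,
        Function.update (ω (t + 1)).2.2.1 e.succ z, (ω (t + 1)).2.2.2) (Nat.lt_succ_self t)
      simp only [run, step, Nat.succ_eq_add_one, Function.update_self] at h₁ ⊢
      rw [h₁, forward_update _ _ _ _ _ Fin.castSucc_lt_succ]
      rfl) hδ
  have hneg : (fun ω => (run a QF QB w₁ γ m (t + 1) ω).y e.succ
      - a e ((run a QF QB w₁ γ m (t + 1) ω).y e.castSucc) ((run a QF QB w₁ γ m t ω).w e))
      = -fun ω => a e ((run a QF QB w₁ γ m (t + 1) ω).y e.castSucc)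
        ((run a QF QB w₁ γ m t ω).w e) - (run a QF QB w₁ γ m t ω).y e.succ
        - QF e.succ ((ω (t + 1)).2.2.1 e.succ)
          (a e ((run a QF QB w₁ γ m (t + 1) ω).y e.castSucc)
            ((run a QF QB w₁ γ m t ω).w e) - (run a QF QB w₁ γ m t ω).y e.succ) := by
    funext ω
    simp only [run, step, forward_succ, Pi.neg_apply]
    abel
  rw [hneg, lpNorm_neg]
  exact ⟨key.1.neg, key.2⟩

/-- The backward compression error at worker `e`. -/
theorem backward_error
    (hdiff : ∀ e, Differentiable ℝ (fun z : Act d e.castSucc × Wt dw e => a e z.1 z.2))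
    (hF : IsContractive QF ν ωF) (hB : IsContractive QB ν ωB) (t : ℕ) {e : Fin E}
    (he : e.castSucc ≠ 0)
    (hδ : MemLp (fun ω => ContinuousLinearMap.adjoint
      (jac₁ a e ((run a QF QB w₁ γ m (t + 1) ω).y e.castSucc) ((run a QF QB w₁ γ m t ω).w e))
        ((run a QF QB w₁ γ m (t + 1) ω).v e.succ) - (run a QF QB w₁ γ m t ω).v e.castSucc) 2
      (pathLaw D ν p)) :
    MemLp (fun ω => (run a QF QB w₁ γ m (t + 1) ω).v e.castSucc
      - ContinuousLinearMap.adjoint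
      (jac₁ a e ((run a QF QB w₁ γ m (t + 1) ω).y e.castSucc) ((run a QF QB w₁ γ m t ω).w e))
        ((run a QF QB w₁ γ m (t + 1) ω).v e.succ)) 2 (pathLaw D ν p) ∧
    lpNorm (fun ω => (run a QF QB w₁ γ m (t + 1) ω).v e.castSucc
      - ContinuousLinearMap.adjoint
      (jac₁ a e ((run a QF QB w₁ γ m (t + 1) ω).y e.castSucc) ((run a QF QB w₁ γ m t ω).w e))
        ((run a QF QB w₁ γ m (t + 1) ω).v e.succ)) 2 (pathLaw D ν p)
    ≤ ωB * lpNorm (fun ω => ContinuousLinearMap.adjoint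
      (jac₁ a e ((run a QF QB w₁ γ m (t + 1) ω).y e.castSucc) ((run a QF QB w₁ γ m t ω).w e))
        ((run a QF QB w₁ γ m (t + 1) ω).v e.succ) - (run a QF QB w₁ γ m t ω).v e.castSucc) 2
      (pathLaw D ν p) := by
  obtain ⟨-, hy, hv, -, hw⟩ :=
    measurable_run (w₁ := w₁) (γ := γ) (m := m) (a := a) hdiff hF hB t
  obtain ⟨-, hy', hv', -, -⟩ :=
    measurable_run (w₁ := w₁) (γ := γ) (m := m) (a := a) hdiff hF hB (t + 1)
  have he' := (Fin.castSucc_lt_last e).ne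
  have key := memLp_compression_error
    (isResampling_backward_seed (D := D) (p := p) (t + 1) e.castSucc)
    (hB.measurable e.castSucc) hB.nonneg (hB.integrable _ he he') (hB.contract _ he he')
    (seed := fun ω : ℕ → Noise d Z => (ω (t + 1)).2.2.2 e.castSucc)
    ((measurable_pi_apply _).comp (measurable_pi_apply (t + 1)).snd.snd.snd)
    (fun ω z => by simp)
    (δ := fun ω => ContinuousLinearMap.adjoint
      (jac₁ a e ((run a QF QB w₁ γ m (t + 1) ω).y e.castSucc) ((run a QF QB w₁ γ m t ω).w e))
        ((run a QF QB w₁ γ m (t + 1) ω).v e.succ) - (run a QF QB w₁ γ m t ω).v e.castSucc)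
    ((measurable_adjoint_apply (measurable_jac₁ hdiff (hy' e.castSucc)
      (measurable_params_apply hw e)) (hv' e.succ)).sub (hv e.castSucc))
    (fun ω z => by
      have h₁ := run_update a QF QB w₁ γ m ω ((ω (t + 1)).1, (ω (t + 1)).2.1,
        (ω (t + 1)).2.2.1, Function.update (ω (t + 1)).2.2.2 e.castSucc z) (Nat.lt_succ_self t)
      simp only [run, step, Nat.succ_eq_add_one, Function.update_self] at h₁ ⊢
      rw [h₁, backward_update _ _ _ _ _ Fin.castSucc_lt_succ]
      rfl) hδ
  have hneg : (fun ω => (run a QF QB w₁ γ m (t + 1) ω).v e.castSucc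
      - ContinuousLinearMap.adjoint
      (jac₁ a e ((run a QF QB w₁ γ m (t + 1) ω).y e.castSucc) ((run a QF QB w₁ γ m t ω).w e))
        ((run a QF QB w₁ γ m (t + 1) ω).v e.succ))
      = -fun ω => ContinuousLinearMap.adjoint
      (jac₁ a e ((run a QF QB w₁ γ m (t + 1) ω).y e.castSucc) ((run a QF QB w₁ γ m t ω).w e))
        ((run a QF QB w₁ γ m (t + 1) ω).v e.succ) - (run a QF QB w₁ γ m t ω).v e.castSucc
        - QB e.castSucc ((ω (t + 1)).2.2.2 e.castSucc) (ContinuousLinearMap.adjoint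
      (jac₁ a e ((run a QF QB w₁ γ m (t + 1) ω).y e.castSucc) ((run a QF QB w₁ γ m t ω).w e))
        ((run a QF QB w₁ γ m (t + 1) ω).v e.succ) - (run a QF QB w₁ γ m t ω).v e.castSucc) := by
    funext ω
    simp only [run, step, backward_castSucc, Pi.neg_apply]
    abel
  rw [hneg, lpNorm_neg]
  exact ⟨key.1.neg, key.2⟩

/-! ### Square integrability -/

theorem memLp_of_norm_le_add {Ω V V₁ V₂ : Type*} [MeasurableSpace Ω] [NormedAddCommGroup V]
    [NormedAddCommGroup V₁] [NormedAddCommGroup V₂] {P : Measure Ω} [IsFiniteMeasure P]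
    {f : Ω → V₁} {g : Ω → V₂} {h : Ω → V} (hf : MemLp f 2 P) (hg : MemLp g 2 P)
    (hm : AEStronglyMeasurable h P) {c K : ℝ} (hle : ∀ ω, ‖h ω‖ ≤ c + K * (‖f ω‖ + ‖g ω‖)) :
    MemLp h 2 P :=
  MemLp.of_le ((memLp_const c).add ((hf.norm.add hg.norm).const_mul K)) hm
    (ae_of_all _ fun ω => (hle ω).trans (le_abs_self _))

theorem memLp_params {Ω : Type*} [MeasurableSpace Ω] {P : Measure Ω} {w : Ω → Params dw}
    (hm : Measurable w) (hw : ∀ e, MemLp (fun ω => w ω e) 2 P) : MemLp w 2 P := by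
  have h : MemLp (fun ω => ∑ e, ‖w ω e‖) 2 P := memLp_finsetSum Finset.univ fun e _ => (hw e).norm
  exact MemLp.of_le h hm.aestronglyMeasurable
    (ae_of_all _ fun ω => (norm_params_le_sum (w ω)).trans (le_abs_self _))

theorem memLp_params_apply {Ω : Type*} [MeasurableSpace Ω] {P : Measure Ω} {w : Ω → Params dw}
    (hm : Measurable w) (hw : MemLp w 2 P) (e : Fin E) : MemLp (fun ω => w ω e) 2 P :=
  MemLp.of_le hw (measurable_params_apply hm e).aestronglyMeasurable
    (ae_of_all _ fun ω => PiLp.norm_apply_le (w ω) e)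

theorem measurePreserving_noise_fst (t : ℕ) :
    MeasurePreserving (fun ω : ℕ → Noise d Z => (ω t).1) (pathLaw D ν p) D :=
  MeasurePreserving.comp (g := Prod.fst) (μb := noiseLaw D ν (schedule p t)) measurePreserving_fst
    (measurePreserving_eval_infinitePi (fun t => noiseLaw D ν (schedule p t)) t)

theorem memLp_noise_fst (hD : Integrable (fun x => ‖x‖ ^ 2) D) (t : ℕ) :
    MemLp (fun ω : ℕ → Noise d Z => (ω t).1) 2 (pathLaw D ν p) :=
  MemLp.comp_measurePreserving (g := fun x : Act d 0 => x)
    ((memLp_two_iff_integrable_sq_norm aestronglyMeasurable_id).2 hD)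
    (measurePreserving_noise_fst t)

/-- Induction over iterations and, within each, along the two passes: operators grow at most
linearly, Jacobians are bounded, compression errors are square integrable. The compressors are
contractive only strictly between the ends of the pipeline, so `y` at the last index and `v` at
index `0` are left out; neither enters the updates. -/
theorem memLp_run (hD : Integrable (fun x => ‖x‖ ^ 2) D) (hs : IsSmooth a D Lℓ Ca La Lga)
    (hF : IsContractive QF ν ωF) (hB : IsContractive QB ν ωB) (t : ℕ) :
    MemLp (fun ω => (run a QF QB w₁ γ m t ω).x) 2 (pathLaw D ν p) ∧
    (∀ j, j ≠ Fin.last E → MemLp (fun ω => (run a QF QB w₁ γ m t ω).y j) 2 (pathLaw D ν p)) ∧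
    (∀ j, j ≠ 0 → MemLp (fun ω => (run a QF QB w₁ γ m t ω).v j) 2 (pathLaw D ν p)) ∧
    MemLp (fun ω => (run a QF QB w₁ γ m t ω).u) 2 (pathLaw D ν p) ∧
    MemLp (fun ω => (run a QF QB w₁ γ m t ω).w) 2 (pathLaw D ν p) := by
  induction t with
  | zero =>
    exact ⟨memLp_const _, fun _ _ => memLp_const _, fun _ _ => memLp_const _,
      memLp_const _, memLp_const _⟩
  | succ t ih =>
    obtain ⟨hx, hy, hv, hu, hw⟩ := ih
    obtain ⟨mx, my, mv, mu, mw⟩ :=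
      measurable_run (w₁ := w₁) (γ := γ) (m := m) (a := a) hs.op_diff hF hB t
    obtain ⟨mx', my', mv', mu', mw'⟩ :=
      measurable_run (w₁ := w₁) (γ := γ) (m := m) (a := a) hs.op_diff hF hB (t + 1)
    have hwe := memLp_params_apply mw hw
    have hx' : MemLp (fun ω => (run a QF QB w₁ γ m (t + 1) ω).x) 2 (pathLaw D ν p) := by
      refine memLp_of_norm_le_add (c := 0) (K := 1) (memLp_noise_fst hD (t + 1)) hx
        mx'.aestronglyMeasurable fun ω => ?_
      simp only [run, step, lazySample, zero_add, one_mul]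
      split_ifs
      · exact le_add_of_nonneg_right (norm_nonneg _)
      · exact le_add_of_nonneg_left (norm_nonneg _)
    have hy' : ∀ j, j ≠ Fin.last E →
        MemLp (fun ω => (run a QF QB w₁ γ m (t + 1) ω).y j) 2 (pathLaw D ν p) := by
      intro j hj
      induction j using Fin.induction with
      | zero => exact hx'
      | succ e ih =>
        have he : (e : ℕ) + 1 < E := by simpa using Fin.val_lt_last hj
        have htar : MemLp (fun ω => a e ((run a QF QB w₁ γ m (t + 1) ω).y e.castSucc)
            ((run a QF QB w₁ γ m t ω).w e)) 2 (pathLaw D ν p) := by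
          refine memLp_of_norm_le_add (c := ‖a e 0 0‖) (K := |La|)
            (ih (Fin.castSucc_lt_last e).ne) (hwe e)
            (measurable_op hs.op_diff (my' _)
              (measurable_params_apply mw e)).aestronglyMeasurable fun ω => ?_
          have := hs.op_lip' he ((run a QF QB w₁ γ m (t + 1) ω).y e.castSucc) 0
            ((run a QF QB w₁ γ m t ω).w e) 0
          rw [sub_zero, sub_zero] at this
          exact (norm_le_norm_add_norm_sub' _ _).trans (add_le_add le_rfl this)
        have := (forward_error hs.op_diff hF hB t hj (htar.sub (hy _ hj))).1.add htar
        simpa [Pi.add_def] using this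
    have hv' : ∀ j, j ≠ 0 →
        MemLp (fun ω => (run a QF QB w₁ γ m (t + 1) ω).v j) 2 (pathLaw D ν p) := by
      intro j hj
      induction j using Fin.reverseInduction with
      | last => simp only [run, step, backward_last]; exact memLp_const _
      | cast e ih =>
        have htar : MemLp (fun ω => ContinuousLinearMap.adjoint
            (jac₁ a e ((run a QF QB w₁ γ m (t + 1) ω).y e.castSucc)
              ((run a QF QB w₁ γ m t ω).w e))
            ((run a QF QB w₁ γ m (t + 1) ω).v e.succ)) 2 (pathLaw D ν p) := by
          refine MemLp.of_le_mul (c := Ca) (ih (Fin.succ_ne_zero e))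
            (measurable_adjoint_apply (measurable_jac₁ hs.op_diff (my' _)
              (measurable_params_apply mw e)) (mv' _)).aestronglyMeasurable
            (ae_of_all _ fun ω => ?_)
          refine (ContinuousLinearMap.le_opNorm _ _).trans ?_
          rw [LinearIsometryEquiv.norm_map]
          exact mul_le_mul_of_nonneg_right (hs.jac₁_le _ _ _) (norm_nonneg _)
        have := (backward_error hs.op_diff hF hB t hj (htar.sub (hv _ hj))).1.add htar
        simpa [Pi.add_def] using this
    have hu' : MemLp (fun ω => (run a QF QB w₁ γ m (t + 1) ω).u) 2 (pathLaw D ν p) := by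
      refine memLp_params mu' fun e => ?_
      refine ((memLp_params_apply mu hu e).const_smul (1 - m)).add (MemLp.const_smul ?_ m)
      refine MemLp.of_le_mul (c := Ca) (hv' _ (Fin.succ_ne_zero e))
        (measurable_adjoint_apply (measurable_jac₂ hs.op_diff (my' _)
          (measurable_params_apply mw e)) (mv' _)).aestronglyMeasurable
        (ae_of_all _ fun ω => ?_)
      refine (ContinuousLinearMap.le_opNorm _ _).trans ?_
      rw [LinearIsometryEquiv.norm_map]
      exact mul_le_mul_of_nonneg_right (hs.jac₂_le _ _ _) (norm_nonneg _)
    exact ⟨hx', hy', hv', hu', hw.sub (hu'.const_smul γ)⟩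

end Algorithm

/-! ### The compression errors are controlled -/

section Tracking

set_option linter.unusedSectionVars false

/-- The hyperparameters: the lazy sampling probability, the momentum coefficient and the step
size. -/
abbrev Hyper : Type := unitInterval × ℝ × ℝ

variable {E : ℕ} {d : Fin (E + 1) → ℕ} {dw : Fin E → ℕ} {Z : Type*} [MeasurableSpace Z]

/-- Law of the randomness for given hyperparameters. -/
noncomputable abbrev law (D : Measure (Act d 0)) (ν : Measure Z) [IsProbabilityMeasure D]
    [IsProbabilityMeasure ν] (θ : Hyper) : Measure (ℕ → Noise d Z) :=
  pathLaw D ν θ.1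

/-- The states of the algorithm for given hyperparameters. -/
noncomputable abbrev iter (a : Operators d dw) (QF QB : Compressors d Z) (w₁ : Params dw)
    (θ : Hyper) (t : ℕ) (ω : ℕ → Noise d Z) : State d dw :=
  run a QF QB w₁ θ.2.2 θ.2.1 t ω

/-- The weights `w^{(t)}` for given hyperparameters. -/
noncomputable abbrev wts (a : Operators d dw) (QF QB : Compressors d Z) (w₁ : Params dw)
    (θ : Hyper) (t : ℕ) (ω : ℕ → Noise d Z) : Params dw :=
  weights a QF QB w₁ θ.2.2 θ.2.1 t ω

/-- The cumulated squared moves of the samples and of the weights, plus one. -/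
noncomputable def budget (a : Operators d dw) (QF QB : Compressors d Z) (w₁ : Params dw)
    (D : Measure (Act d 0)) (ν : Measure Z) [IsProbabilityMeasure D] [IsProbabilityMeasure ν]
    (θ : Hyper) (T : ℕ) : ℝ :=
  1 + ∑ t ∈ Finset.range T,
      ∫ ω, ‖(iter a QF QB w₁ θ (t + 2) ω).x - (iter a QF QB w₁ θ (t + 1) ω).x‖ ^ 2 ∂law D ν θ
    + ∑ t ∈ Finset.range T,
      ∫ ω, ‖wts a QF QB w₁ θ (t + 2) ω - wts a QF QB w₁ θ (t + 1) ω‖ ^ 2 ∂law D ν θ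

/-- The gradient of the sample loss that is computed from compressed messages. -/
noncomputable def compressedGrad (a : Operators d dw) (QF QB : Compressors d Z) (w₁ : Params dw)
    (θ : Hyper) (t : ℕ) (ω : ℕ → Noise d Z) : Params dw :=
  WithLp.toLp 2 fun e => ContinuousLinearMap.adjoint
    (jac₂ a e ((iter a QF QB w₁ θ t ω).y e.castSucc) (wts a QF QB w₁ θ t ω e))
    ((iter a QF QB w₁ θ t ω).v e.succ)

variable {a : Operators d dw} {QF QB : Compressors d Z} {w₁ : Params dw}

theorem iter_u_succ (θ : Hyper) (t : ℕ) (ω : ℕ → Noise d Z) :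
    (iter a QF QB w₁ θ (t + 1) ω).u = (1 - θ.2.1) • (iter a QF QB w₁ θ t ω).u
      + θ.2.1 • compressedGrad a QF QB w₁ θ (t + 1) ω :=
  rfl

theorem wts_succ (θ : Hyper) (t : ℕ) (ω : ℕ → Noise d Z) :
    wts a QF QB w₁ θ (t + 2) ω
      = wts a QF QB w₁ θ (t + 1) ω - θ.2.2 • (iter a QF QB w₁ θ (t + 1) ω).u :=
  rfl

theorem iter_y_of_val_eq_zero (θ : Hyper) (t : ℕ) (ω : ℕ → Noise d Z) (w : Params dw)
    {j : Fin (E + 1)} (hj : (j : ℕ) = 0) :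
    (iter a QF QB w₁ θ t ω).y j = activation a (iter a QF QB w₁ θ t ω).x w j := by
  obtain rfl : j = 0 := Fin.ext hj
  cases t <;> rfl

variable {D : Measure (Act d 0)} {ν : Measure Z} [IsProbabilityMeasure D] [IsProbabilityMeasure ν]
variable {Lℓ Ca La Lga σ ωF ωB : ℝ}

theorem sum_move_nonneg {V : Type*} [NormedAddCommGroup V] {Ω : Type*} [MeasurableSpace Ω]
    (P : Measure Ω) (f : ℕ → Ω → V) (T : ℕ) :
    0 ≤ ∑ t ∈ Finset.range T, ∫ ω, ‖f t ω‖ ^ 2 ∂P :=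
  Finset.sum_nonneg fun _ _ => integral_nonneg fun _ => by positivity

theorem one_le_budget (θ : Hyper) (T : ℕ) : 1 ≤ budget a QF QB w₁ D ν θ T := by
  have h₁ := sum_move_nonneg (law D ν θ)
    (fun t ω => (iter a QF QB w₁ θ (t + 2) ω).x - (iter a QF QB w₁ θ (t + 1) ω).x) T
  have h₂ := sum_move_nonneg (law D ν θ)
    (fun t ω => wts a QF QB w₁ θ (t + 2) ω - wts a QF QB w₁ θ (t + 1) ω) T
  unfold budget
  linarith

/-- A sum of second moments whose first term is bounded apart. -/
theorem sum_range_le_of_first {V : Type*} [NormedAddCommGroup V] {Ω : Type*} [MeasurableSpace Ω]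
    (P : Measure Ω) (f : ℕ → Ω → V) {c : ℝ} (hc : ∫ ω, ‖f 0 ω‖ ^ 2 ∂P ≤ c) (hc0 : 0 ≤ c)
    (T : ℕ) : ∑ t ∈ Finset.range T, ∫ ω, ‖f t ω‖ ^ 2 ∂P
      ≤ c + ∑ t ∈ Finset.range T, ∫ ω, ‖f (t + 1) ω‖ ^ 2 ∂P := by
  cases T with
  | zero => simpa using hc0
  | succ n =>
    rw [Finset.sum_range_succ', Finset.sum_range_succ]
    have : 0 ≤ ∫ ω, ‖f (n + 1) ω‖ ^ 2 ∂P := integral_nonneg fun _ => by positivity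
    linarith

variable (hD : Integrable (fun x => ‖x‖ ^ 2) D) (hs : IsSmooth a D Lℓ Ca La Lga)
  (hF : IsContractive QF ν ωF) (hB : IsContractive QB ν ωB)

include hs hF hB

theorem measurable_iter_x (θ : Hyper) (t : ℕ) :
    Measurable fun ω => (iter a QF QB w₁ θ t ω).x :=
  (measurable_run hs.op_diff hF hB t).1

theorem measurable_iter_y (θ : Hyper) (t : ℕ) (j : Fin (E + 1)) :
    Measurable fun ω => (iter a QF QB w₁ θ t ω).y j :=
  (measurable_run hs.op_diff hF hB t).2.1 j

theorem measurable_iter_v (θ : Hyper) (t : ℕ) (j : Fin (E + 1)) :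
    Measurable fun ω => (iter a QF QB w₁ θ t ω).v j :=
  (measurable_run hs.op_diff hF hB t).2.2.1 j

theorem measurable_wts (θ : Hyper) (t : ℕ) : Measurable fun ω => wts a QF QB w₁ θ t ω :=
  (measurable_run hs.op_diff hF hB (t - 1)).2.2.2.2

theorem measurable_compressedGrad (θ : Hyper) (t : ℕ) :
    Measurable fun ω => compressedGrad a QF QB w₁ θ t ω :=
  measurable_params fun e => measurable_adjoint_apply
    (measurable_jac₂ hs.op_diff (measurable_iter_y hs hF hB θ t _)
      (measurable_params_apply (measurable_wts hs hF hB θ t) e))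
    (measurable_iter_v hs hF hB θ t _)

theorem measurable_lossGrad_iter (θ : Hyper) (t : ℕ) :
    Measurable fun ω => lossGrad a (iter a QF QB w₁ θ t ω).x (wts a QF QB w₁ θ t ω) :=
  measurable_lossGrad hs.op_diff (measurable_iter_x hs hF hB θ t) (measurable_wts hs hF hB θ t)

include hD

theorem memLp_iter_x (θ : Hyper) (t : ℕ) :
    MemLp (fun ω => (iter a QF QB w₁ θ t ω).x) 2 (law D ν θ) :=
  (memLp_run hD hs hF hB t).1

theorem memLp_wts (θ : Hyper) (t : ℕ) :
    MemLp (fun ω => wts a QF QB w₁ θ t ω) 2 (law D ν θ) :=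
  (memLp_run hD hs hF hB (t - 1)).2.2.2.2

/-- The value of a Lipschitz function at the current sample and weights is square integrable. -/
theorem memLp_of_lipschitz {V : Type*} [NormedAddCommGroup V] {f : Act d 0 → Params dw → V} {K : ℝ}
    (hf : ∀ x x' w w', ‖f x w - f x' w'‖ ≤ K * (‖x - x'‖ + ‖w - w'‖)) (θ : Hyper) (t : ℕ)
    (hm : AEStronglyMeasurable
      (fun ω => f (iter a QF QB w₁ θ t ω).x (wts a QF QB w₁ θ t ω)) (law D ν θ)) :
    MemLp (fun ω => f (iter a QF QB w₁ θ t ω).x (wts a QF QB w₁ θ t ω)) 2 (law D ν θ) := by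
  refine memLp_of_norm_le_add (c := ‖f 0 0‖) (K := K) (memLp_iter_x (w₁ := w₁) hD hs hF hB θ t)
    (memLp_wts (w₁ := w₁) hD hs hF hB θ t) hm fun ω => ?_
  have := hf (iter a QF QB w₁ θ t ω).x 0 (wts a QF QB w₁ θ t ω) 0
  rw [sub_zero, sub_zero] at this
  exact (norm_le_norm_add_norm_sub' _ _).trans (add_le_add le_rfl this)

theorem controlled_move_x : Controlled (law D ν) (budget a QF QB w₁ D ν)
    fun θ t ω => (iter a QF QB w₁ θ t ω).x - (iter a QF QB w₁ θ (t - 1) ω).x := by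
  refine ⟨fun θ t => (memLp_iter_x hD hs hF hB θ t).sub (memLp_iter_x hD hs hF hB θ _),
    ∫ x, ‖x‖ ^ 2 ∂D + 1, by positivity, fun θ T => ?_⟩
  have h0 : 0 ≤ ∫ x, ‖x‖ ^ 2 ∂D := by positivity
  refine (sum_range_le_of_first (law D ν θ) (fun t ω => (iter a QF QB w₁ θ (t + 1) ω).x
    - (iter a QF QB w₁ θ (t + 1 - 1) ω).x) (c := ∫ x, ‖x‖ ^ 2 ∂D) ?_ h0 T).trans ?_
  -- The budget does not contain the move from the artificial sample `0` to the first draw; its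
  -- second moment is that of `D`.
  · have : ∀ ω : ℕ → Noise d Z, (iter a QF QB w₁ θ (0 + 1) ω).x
        - (iter a QF QB w₁ θ (0 + 1 - 1) ω).x = (ω 1).1 := fun ω => by
      simp [iter, run, step, lazySample, initState]
    simp only [this]
    have hmp := measurePreserving_noise_fst (D := D) (ν := ν) (p := θ.1) 1
    have := integral_map (μ := law D ν θ) (f := fun x : Act d 0 => ‖x‖ ^ 2)
      hmp.measurable.aemeasurable (by fun_prop)
    rw [hmp.map_eq] at this
    exact this.ge
  · have h₂ := sum_move_nonneg (law D ν θ)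
      (fun t ω => wts a QF QB w₁ θ (t + 2) ω - wts a QF QB w₁ θ (t + 1) ω) T
    have h₁ := one_le_budget (a := a) (QF := QF) (QB := QB) (w₁ := w₁) (D := D) (ν := ν) θ T
    rw [add_mul, one_mul]
    refine add_le_add (le_mul_of_one_le_right h0 h₁) ?_
    simp only [Nat.add_sub_cancel, budget]
    linarith

theorem controlled_move_w : Controlled (law D ν) (budget a QF QB w₁ D ν)
    fun θ t ω => wts a QF QB w₁ θ t ω - wts a QF QB w₁ θ (t - 1) ω := by
  refine ⟨fun θ t => (memLp_wts hD hs hF hB θ t).sub (memLp_wts hD hs hF hB θ _),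
    1, by positivity, fun θ T => ?_⟩
  refine (sum_range_le_of_first (law D ν θ) (fun t ω => wts a QF QB w₁ θ (t + 1) ω
    - wts a QF QB w₁ θ (t + 1 - 1) ω) (c := 0) ?_ le_rfl T).trans ?_
  -- By truncated subtraction the weights at times `0` and `1` are both `w₁`, so the first move is
  -- zero.
  · simp [weights]
  · have h₂ := sum_move_nonneg (law D ν θ)
      (fun t ω => (iter a QF QB w₁ θ (t + 2) ω).x - (iter a QF QB w₁ θ (t + 1) ω).x) T
    simp only [Nat.add_sub_cancel, budget, zero_add, one_mul]
    linarith

theorem controlled_move_of_lipschitz {V : Type*} [NormedAddCommGroup V]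
    {f : Act d 0 → Params dw → V} {K : ℝ}
    (hf : ∀ x x' w w', ‖f x w - f x' w'‖ ≤ K * (‖x - x'‖ + ‖w - w'‖))
    (hm : ∀ θ t, AEStronglyMeasurable
      (fun ω => f (iter a QF QB w₁ θ t ω).x (wts a QF QB w₁ θ t ω)) (law D ν θ)) :
    Controlled (law D ν) (budget a QF QB w₁ D ν)
      fun θ t ω => f (iter a QF QB w₁ θ t ω).x (wts a QF QB w₁ θ t ω)
        - f (iter a QF QB w₁ θ (t - 1) ω).x (wts a QF QB w₁ θ (t - 1) ω) :=
  (controlled_move_x hD hs hF hB).of_le (controlled_move_w hD hs hF hB)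
    (fun θ t => (hm θ t).sub (hm θ (t - 1))) fun _ _ _ => hf _ _ _ _

theorem controlled_zero {V : Type*} [NormedAddCommGroup V] :
    Controlled (law D ν) (budget a QF QB w₁ D ν) fun _ _ _ => (0 : V) :=
  (controlled_move_x hD hs hF hB).of_le (controlled_move_w hD hs hF hB) (K := 0)
    (fun _ _ => aestronglyMeasurable_const) fun _ _ _ => by simp

/-- Induction along the pipeline. The activation at index `0` is never compressed, hence exact;
afterwards the compressor tracks the exact activation while seeing the output of `a_e` on an inexact
input, whose error is controlled by the previous index. -/
theorem controlled_activation_error (j : Fin (E + 1)) (hj : j ≠ Fin.last E) :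
    Controlled (law D ν) (budget a QF QB w₁ D ν) fun θ t ω => (iter a QF QB w₁ θ t ω).y j
      - activation a (iter a QF QB w₁ θ t ω).x (wts a QF QB w₁ θ t ω) j := by
  induction j using Fin.induction with
  | zero =>
    have h : ∀ θ t ω, (iter a QF QB w₁ θ t ω).y 0
        - activation a (iter a QF QB w₁ θ t ω).x (wts a QF QB w₁ θ t ω) 0 = 0 := fun θ t ω =>
      sub_eq_zero.2 (iter_y_of_val_eq_zero θ t ω _ rfl)
    simp only [h]
    exact controlled_zero hD hs hF hB
  | succ e ih =>
    have he : (e : ℕ) + 1 < E := by simpa using Fin.val_lt_last hj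
    have ih := ih (Fin.castSucc_lt_last e).ne
    obtain ⟨K, -, hK⟩ := hs.activation_lip e.succ hj
    have hm : ∀ (j : Fin (E + 1)) (θ : Hyper) (t : ℕ), AEStronglyMeasurable (fun ω =>
        activation a (iter a QF QB w₁ θ t ω).x (wts a QF QB w₁ θ t ω) j) (law D ν θ) :=
      fun j θ t => (measurable_activation hs.op_diff (measurable_iter_x hs hF hB θ t)
        (measurable_wts hs hF hB θ t) _).aestronglyMeasurable
    have hm' : ∀ (θ : Hyper) (t : ℕ), AEStronglyMeasurable (fun ω =>
        a e ((iter a QF QB w₁ θ t ω).y e.castSucc) (wts a QF QB w₁ θ t ω e)) (law D ν θ) :=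
      fun θ t => (measurable_op hs.op_diff (measurable_iter_y hs hF hB θ t _)
        (measurable_params_apply (measurable_wts hs hF hB θ t) e)).aestronglyMeasurable
    have hpert : Controlled (law D ν) (budget a QF QB w₁ D ν) fun θ t ω =>
        a e ((iter a QF QB w₁ θ t ω).y e.castSucc) (wts a QF QB w₁ θ t ω e)
        - activation a (iter a QF QB w₁ θ t ω).x (wts a QF QB w₁ θ t ω) e.succ := by
      refine ih.of_le ih (K := |La|) (fun θ t => (hm' θ t).sub (hm _ θ t)) fun θ t ω => ?_
      rw [activation_succ]
      refine (hs.op_lip' he _ _ _ _).trans (mul_le_mul_of_nonneg_left ?_ (abs_nonneg _))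
      rw [sub_self, norm_zero]
      gcongr
      exact norm_nonneg _
    have hr := memLp_of_lipschitz (w₁ := w₁) hD hs hF hB hK
    have hc := fun (θ : Hyper) t => (memLp_run (γ := θ.2.2) (m := θ.2.1) (w₁ := w₁) (p := θ.1)
      hD hs hF hB t).2.1 e.succ hj
    -- At time `0` the stored message is `0` and the target is the activation at sample `0` and
    -- weights `w₁`: an initial error free of the hyperparameters.
    refine Controlled.track hF.nonneg hF.lt_one one_le_budget hpert
      (controlled_move_of_lipschitz hD hs hF hB hK (hm e.succ)) (fun θ t => hr θ t (hm _ θ t)) hc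
      (fun θ t => ?_) ⟨‖activation a 0 w₁ e.succ‖ ^ 2, by positivity, fun θ => ?_⟩
    · have htar : MemLp (fun ω => a e ((iter a QF QB w₁ θ (t + 1) ω).y e.castSucc)
          (wts a QF QB w₁ θ (t + 1) ω e)) 2 (law D ν θ) := by
        have := (hpert.memLp θ (t + 1)).add (hr θ (t + 1) (hm _ θ (t + 1)))
        simpa only [Pi.add_def, sub_add_cancel] using this
      exact (forward_error hs.op_diff hF hB t hj (htar.sub (hc θ t))).2
    · simp [iter, run, initState, weights]

/-- The same tracking argument from the loss downwards. The input of the compressor is now perturbed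
both by the incoming cotangent and by the activation at which the Jacobian is taken. -/
theorem controlled_cotangent_error (j : Fin (E + 1)) (hj : j ≠ 0) :
    Controlled (law D ν) (budget a QF QB w₁ D ν) fun θ t ω => (iter a QF QB w₁ θ t ω).v j
      - cotangent a (iter a QF QB w₁ θ t ω).x (wts a QF QB w₁ θ t ω) j := by
  have hm : ∀ (j : Fin (E + 1)) (θ : Hyper) (t : ℕ), AEStronglyMeasurable (fun ω =>
      cotangent a (iter a QF QB w₁ θ t ω).x (wts a QF QB w₁ θ t ω) j) (law D ν θ) :=
    fun j θ t => (measurable_cotangent hs.op_diff (measurable_iter_x hs hF hB θ t)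
      (measurable_wts hs hF hB θ t) _).aestronglyMeasurable
  induction j using Fin.reverseInduction with
  | last =>
    -- At time `0` the stored vector is `0`, not `1`, but the cumulated sum starts at time `1`, from
    -- which on the error vanishes.
    refine ⟨fun θ t => (((memLp_run hD hs hF hB t).2.2.1 _ hj).sub ?_), 0, le_rfl, fun θ T => ?_⟩
    · simp only [cotangent_last]
      exact memLp_const _
    · simp [cotangent_last, iter, run, step, backward_last]
  | cast e ih =>
    have he : 0 < (e : ℕ) := Nat.pos_of_ne_zero fun h0 => hj (Fin.ext h0)
    have ih := ih (Fin.succ_ne_zero e)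
    obtain ⟨K, -, hK⟩ := hs.cotangent_lip e.castSucc hj
    obtain ⟨G, hG, hb⟩ := hs.cotangent_le e.succ
    have hact := controlled_activation_error (w₁ := w₁) hD hs hF hB e.castSucc
      (Fin.castSucc_lt_last e).ne
    have hm' : ∀ (θ : Hyper) (t : ℕ), AEStronglyMeasurable (fun ω => ContinuousLinearMap.adjoint
        (jac₁ a e ((iter a QF QB w₁ θ t ω).y e.castSucc) (wts a QF QB w₁ θ t ω e))
        ((iter a QF QB w₁ θ t ω).v e.succ)) (law D ν θ) :=
      fun θ t => (measurable_adjoint_apply (measurable_jac₁ hs.op_diff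
        (measurable_iter_y hs hF hB θ t _)
        (measurable_params_apply (measurable_wts hs hF hB θ t) e))
        (measurable_iter_v hs hF hB θ t _)).aestronglyMeasurable
    have hpert : Controlled (law D ν) (budget a QF QB w₁ D ν) fun θ t ω =>
        ContinuousLinearMap.adjoint
          (jac₁ a e ((iter a QF QB w₁ θ t ω).y e.castSucc) (wts a QF QB w₁ θ t ω e))
          ((iter a QF QB w₁ θ t ω).v e.succ)
        - cotangent a (iter a QF QB w₁ θ t ω).x (wts a QF QB w₁ θ t ω) e.castSucc := by
      refine ih.of_le hact (K := |Ca| + |Lga| * G)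
        (fun θ t => (hm' θ t).sub (hm _ θ t)) fun θ t ω => ?_
      rw [cotangent_castSucc]
      refine (norm_adjoint_sub_adjoint_le _ _ _ _).trans ?_
      set y := (iter a QF QB w₁ θ t ω).y e.castSucc
      set v := (iter a QF QB w₁ θ t ω).v e.succ
      set w := wts a QF QB w₁ θ t ω
      set x := (iter a QF QB w₁ θ t ω).x
      have h : ‖jac₁ a e y (w e) - jac₁ a e (activation a x w e.castSucc) (w e)‖
          ≤ |Lga| * ‖y - activation a x w e.castSucc‖ := by
        simpa using hs.jac₁_lip' he y (activation a x w e.castSucc) (w e) (w e)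
      have h₁ : 0 ≤ |Ca| * ‖y - activation a x w e.castSucc‖ := by positivity
      have h₂ : 0 ≤ |Lga| * G * ‖v - cotangent a x w e.succ‖ := by positivity
      calc _ ≤ |Ca| * ‖v - cotangent a x w e.succ‖
            + |Lga| * ‖y - activation a x w e.castSucc‖ * G := by
            gcongr
            · exact (hs.jac₁_le e _ _).trans (le_abs_self _)
            · exact hb x w
        _ ≤ _ := by linarith
    have hr := memLp_of_lipschitz (w₁ := w₁) hD hs hF hB hK
    have hc := fun (θ : Hyper) t => (memLp_run (γ := θ.2.2) (m := θ.2.1) (w₁ := w₁) (p := θ.1)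
      hD hs hF hB t).2.2.1 e.castSucc hj
    refine Controlled.track hB.nonneg hB.lt_one one_le_budget hpert
      (controlled_move_of_lipschitz hD hs hF hB hK (hm e.castSucc))
      (fun θ t => hr θ t (hm _ θ t)) hc
      (fun θ t => ?_) ⟨‖cotangent a 0 w₁ e.castSucc‖ ^ 2, by positivity, fun θ => ?_⟩
    · have htar : MemLp (fun ω => ContinuousLinearMap.adjoint
          (jac₁ a e ((iter a QF QB w₁ θ (t + 1) ω).y e.castSucc) (wts a QF QB w₁ θ (t + 1) ω e))
          ((iter a QF QB w₁ θ (t + 1) ω).v e.succ)) 2 (law D ν θ) := by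
        have := (hpert.memLp θ (t + 1)).add (hr θ (t + 1) (hm _ θ (t + 1)))
        simpa only [Pi.add_def, sub_add_cancel] using this
      exact (backward_error hs.op_diff hF hB t hj (htar.sub (hc θ t))).2
    · simp [iter, run, initState, weights]

theorem controlled_params {f : Hyper → ℕ → (ℕ → Noise d Z) → Params dw}
    (hm : ∀ θ t, Measurable (f θ t))
    (hf : ∀ e, Controlled (law D ν) (budget a QF QB w₁ D ν) fun θ t ω => f θ t ω e) :
    Controlled (law D ν) (budget a QF QB w₁ D ν) f := by
  refine ⟨fun θ t => memLp_params (hm θ t) fun e => (hf e).memLp θ t, ?_⟩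
  choose C hC h using fun e => (hf e).bound
  refine ⟨∑ e, C e, Finset.sum_nonneg fun e _ => hC e, fun θ T => ?_⟩
  have : ∀ t, ∫ ω, ‖f θ t ω‖ ^ 2 ∂law D ν θ = ∑ e, ∫ ω, ‖f θ t ω e‖ ^ 2 ∂law D ν θ := fun t => by
    rw [← integral_finsetSum _ fun e _ => ((hf e).memLp θ t).integrable_norm_sq]
    simp only [PiLp.norm_sq_eq_of_L2]
  simp only [this]
  rw [Finset.sum_comm, Finset.sum_mul]
  exact Finset.sum_le_sum fun e _ => h e θ T

theorem controlled_gradient_error :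
    Controlled (law D ν) (budget a QF QB w₁ D ν) fun θ t ω => compressedGrad a QF QB w₁ θ t ω
      - lossGrad a (iter a QF QB w₁ θ t ω).x (wts a QF QB w₁ θ t ω) := by
  have hm : ∀ θ t, Measurable fun ω => compressedGrad a QF QB w₁ θ t ω
      - lossGrad a (iter a QF QB w₁ θ t ω).x (wts a QF QB w₁ θ t ω) := fun θ t =>
    (measurable_compressedGrad hs hF hB θ t).sub (measurable_lossGrad_iter hs hF hB θ t)
  refine controlled_params hD hs hF hB hm fun e => ?_
  obtain ⟨G, hG, hb⟩ := hs.cotangent_le e.succ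
  refine (controlled_cotangent_error hD hs hF hB e.succ (Fin.succ_ne_zero e)).of_le
    (controlled_activation_error hD hs hF hB e.castSucc (Fin.castSucc_lt_last e).ne)
    (K := |Ca| + |Lga| * G)
    (fun θ t => (measurable_params_apply (hm θ t) e).aestronglyMeasurable) fun θ t ω => ?_
  refine (norm_adjoint_sub_adjoint_le _ _ _ _).trans ?_
  set y := (iter a QF QB w₁ θ t ω).y e.castSucc
  set v := (iter a QF QB w₁ θ t ω).v e.succ
  set w := wts a QF QB w₁ θ t ω
  set x := (iter a QF QB w₁ θ t ω).x
  have h : ‖jac₂ a e y (w e) - jac₂ a e (activation a x w e.castSucc) (w e)‖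
      ≤ |Lga| * ‖y - activation a x w e.castSucc‖ := by
    -- The first worker receives the exact sample, so Lipschitz continuity of `∇₂ a_1` in the data
    -- is not needed.
    rcases Nat.eq_zero_or_pos (e : ℕ) with he | he
    · have : y = activation a x w e.castSucc :=
        iter_y_of_val_eq_zero θ t ω w (j := e.castSucc) he
      simp [this]
    · simpa using hs.jac₂_lip' he y (activation a x w e.castSucc) (w e) (w e)
  have h₁ : 0 ≤ |Ca| * ‖y - activation a x w e.castSucc‖ := by positivity
  have h₂ : 0 ≤ |Lga| * G * ‖v - cotangent a x w e.succ‖ := by positivity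
  calc _ ≤ |Ca| * ‖v - cotangent a x w e.succ‖
        + |Lga| * ‖y - activation a x w e.castSucc‖ * G := by
        gcongr
        · exact (hs.jac₂_le e _ _).trans (le_abs_self _)
        · exact hb x w
    _ ≤ _ := by linarith

end Tracking

/-! ### The sampling noise -/

section Noise

set_option linter.unusedSectionVars false

variable {E : ℕ} {d : Fin (E + 1) → ℕ} {dw : Fin E → ℕ} {Z : Type*} [MeasurableSpace Z]

/-- The deviation of the gradient of the sample loss from its mean. -/
noncomputable def deviation (a : Operators d dw) (D : Measure (Act d 0)) (x : Act d 0)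
    (w : Params dw) : Params dw :=
  lossGrad a x w - gradient (risk a D) w

/-- The deviation at the current sample and weights. -/
noncomputable abbrev devIter (a : Operators d dw) (QF QB : Compressors d Z) (w₁ : Params dw)
    (D : Measure (Act d 0)) (θ : Hyper) (t : ℕ) (ω : ℕ → Noise d Z) : Params dw :=
  deviation a D (iter a QF QB w₁ θ t ω).x (wts a QF QB w₁ θ t ω)

/-- The exponential average of the deviations. -/
noncomputable def noiseAvg (a : Operators d dw) (QF QB : Compressors d Z) (w₁ : Params dw)
    (D : Measure (Act d 0)) (θ : Hyper) : ℕ → (ℕ → Noise d Z) → Params dw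
  | 0, _ => 0
  | t + 1, ω => (1 - θ.2.1) • noiseAvg a QF QB w₁ D θ t ω
      + θ.2.1 • devIter a QF QB w₁ D θ (t + 1) ω

variable {a : Operators d dw} {QF QB : Compressors d Z} {w₁ : Params dw}
variable {D : Measure (Act d 0)} {ν : Measure Z} [IsProbabilityMeasure D] [IsProbabilityMeasure ν]
variable {Lℓ Ca La Lga σ ωF ωB : ℝ}

theorem wts_update (θ : Hyper) (t : ℕ) (ω : ℕ → Noise d Z) (n : Noise d Z) :
    wts a QF QB w₁ θ (t + 1) (Function.update ω (t + 1) n) = wts a QF QB w₁ θ (t + 1) ω :=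
  congrArg State.w (run_update a QF QB w₁ θ.2.2 θ.2.1 ω n (Nat.lt_succ_self t))

theorem noiseAvg_update (θ : Hyper) (ω : ℕ → Noise d Z) (n : Noise d Z) {s t : ℕ} (hst : t < s) :
    noiseAvg a QF QB w₁ D θ t (Function.update ω s n) = noiseAvg a QF QB w₁ D θ t ω := by
  induction t with
  | zero => rfl
  | succ t ih =>
    simp only [noiseAvg, devIter, iter, wts, weights, Nat.add_sub_cancel]
    rw [ih (by omega), run_update _ _ _ _ _ _ _ _ hst, run_update _ _ _ _ _ _ _ _ (by omega)]

/-- The average over one lazy draw: a new sample contributes the mean of `g`, which is zero, and a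
kept one contributes `c`. -/
theorem integral_noiseLaw_ite {g : Act d 0 → ℝ} (hg : Measurable g) (hgi : Integrable g D)
    (hg0 : ∫ x, g x ∂D = 0) (c : ℝ) (q : unitInterval) :
    ∫ n : Noise d Z, (if n.2.1 = true then g n.1 else c) ∂noiseLaw D ν q = (1 - (q : ℝ)) * c := by
  have hmp : MeasurePreserving (fun n : Noise d Z => (n.1, n.2.1)) (noiseLaw D ν q)
      (D.prod (bernoulliMeasure true false q)) :=
    (MeasurePreserving.id D).prod measurePreserving_fst
  set F : Act d 0 × Bool → ℝ := fun y => if y.2 = true then g y.1 else c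
  have hFm : Measurable F := Measurable.ite (measurable_snd (measurableSet_singleton true))
    (hg.comp measurable_fst) measurable_const
  have hFi : Integrable F (D.prod (bernoulliMeasure true false q)) := by
    refine ((hgi.comp_fst _).norm.add (integrable_const |c|)).mono' hFm.aestronglyMeasurable
      (ae_of_all _ fun y => ?_)
    simp only [F, Pi.add_apply]
    split_ifs
    · exact le_add_of_nonneg_right (abs_nonneg c)
    · exact le_add_of_nonneg_left (norm_nonneg _)
  have h₁ : ∫ n : Noise d Z, F (n.1, n.2.1) ∂noiseLaw D ν q
      = ∫ y, F y ∂D.prod (bernoulliMeasure true false q) := by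
    rw [← hmp.map_eq, integral_map hmp.measurable.aemeasurable hFm.aestronglyMeasurable]
  change ∫ n : Noise d Z, F (n.1, n.2.1) ∂noiseLaw D ν q = _
  rw [h₁, integral_prod _ hFi]
  simp only [integral_bernoulliMeasure, F, if_true, Bool.false_eq_true, if_false, smul_eq_mul]
  rw [integral_add (hgi.const_mul _) (integrable_const _), integral_const_mul, hg0]
  simp

theorem continuous_gradient_risk (hs : IsSmooth a D Lℓ Ca La Lga) :
    Continuous (gradient (risk a D)) :=
  (LipschitzWith.of_dist_le_mul (K := ⟨|Lℓ|, abs_nonneg _⟩) fun w w' => by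
    rw [dist_eq_norm, dist_eq_norm]
    exact (hs.risk_lip w w').trans
      (mul_le_mul_of_nonneg_right (le_abs_self _) (norm_nonneg _))).continuous

theorem deviation_lip (hs : IsSmooth a D Lℓ Ca La Lga) : ∃ K, 0 ≤ K ∧ ∀ x w w',
    ‖deviation a D x w - deviation a D x w'‖ ≤ K * ‖w - w'‖ := by
  obtain ⟨K, hK, h⟩ := hs.lossGrad_lip
  refine ⟨K + |Lℓ|, by positivity, fun x w w' => ?_⟩
  have h₁ := h x w w'
  have h₂ : ‖gradient (risk a D) w - gradient (risk a D) w'‖ ≤ |Lℓ| * ‖w - w'‖ :=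
    (hs.risk_lip w w').trans (mul_le_mul_of_nonneg_right (le_abs_self _) (norm_nonneg _))
  unfold deviation
  rw [sub_sub_sub_comm, add_mul]
  exact (norm_sub_le _ _).trans (add_le_add h₁ h₂)

theorem deviation_le (hs : IsSmooth a D Lℓ Ca La Lga) (hu : IsUnbiased a D σ) :
    ∃ G, 0 ≤ G ∧ ∀ x w, ‖deviation a D x w‖ ≤ G := by
  obtain ⟨G, hG, h⟩ := hs.lossGrad_le
  exact ⟨G + G, by positivity, fun x w =>
    (norm_sub_le _ _).trans (add_le_add (h x w) (hs.gradient_risk_le hu h w))⟩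

/-- The squared deviation is bounded, uniformly in the weights, by a multiple of `σ ^ 2`. -/
theorem exists_deviation_sq_le (hs : IsSmooth a D Lℓ Ca La Lga) (hu : IsUnbiased a D σ) :
    ∃ κ, 0 ≤ κ ∧ ∀ᵐ x ∂D, ∀ w, ‖deviation a D x w‖ ^ 2 ≤ κ * σ ^ 2 := by
  -- If `σ = 0`, the deviation vanishes almost surely at each weight of a countable dense set, hence
  -- at all weights by continuity. Otherwise it is bounded by some `G`, and `κ = G² / σ²` works.
  by_cases hσ : σ = 0
  · refine ⟨0, le_rfl, ?_⟩
    have hae : ∀ᵐ x ∂D, ∀ i, deviation a D x (TopologicalSpace.denseSeq (Params dw) i) = 0 := by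
      refine ae_all_iff.2 fun i => ?_
      set w := TopologicalSpace.denseSeq (Params dw) i
      have hi : ∫ x, ‖gradient (loss a x) w - gradient (risk a D) w‖ ^ 2 ∂D = 0 :=
        le_antisymm ((hu.variance w).trans_eq (by simp [hσ])) (by positivity)
      have h0 := (integral_eq_zero_iff_of_nonneg (fun x => by positivity)
        (hu.sq_integrable w)).1 hi
      filter_upwards [h0] with x hx
      simpa [gradient_loss hs.op_diff, deviation] using hx
    obtain ⟨K, hK, hl⟩ := deviation_lip hs
    filter_upwards [hae] with x hx w
    have hc : Continuous (deviation a D x) :=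
      (LipschitzWith.of_dist_le_mul (K := ⟨K, hK⟩) fun w w' => by
        rw [dist_eq_norm, dist_eq_norm]
        exact hl x w w').continuous
    have := (TopologicalSpace.denseRange_denseSeq (Params dw)).equalizer hc continuous_const
      (funext hx : _ = (fun _ => (0 : Params dw)) ∘ _)
    simp [this]
  · obtain ⟨G, hG, h⟩ := deviation_le hs hu
    refine ⟨G ^ 2 / σ ^ 2, by positivity, ae_of_all _ fun x w => ?_⟩
    rw [div_mul_cancel₀ _ (pow_ne_zero 2 hσ)]
    exact pow_le_pow_left₀ (norm_nonneg _) (h x w) 2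

/-- From iteration `1` on, the current sample is one of the countably many candidate draws, each of
law `D`. -/
theorem ae_iter_x {s : Act d 0 → Prop} (h : ∀ᵐ x ∂D, s x) (θ : Hyper) :
    ∀ᵐ ω ∂law D ν θ, ∀ t, s (iter a QF QB w₁ θ (t + 1) ω).x := by
  have hae : ∀ᵐ ω ∂law D ν θ, ∀ t, s (ω t).1 := ae_all_iff.2 fun t =>
    (measurePreserving_noise_fst t).quasiMeasurePreserving.ae h
  filter_upwards [hae] with ω hω t
  induction t with
  | zero =>
    simp only [iter, run, step, lazySample, zero_add, true_or, if_true]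
    exact hω 1
  | succ t ih =>
    simp only [iter] at ih ⊢
    rw [run]
    simp only [step, lazySample]
    split_ifs
    · exact hω _
    · exact ih

variable (hs : IsSmooth a D Lℓ Ca La Lga) (hu : IsUnbiased a D σ)
  (hF : IsContractive QF ν ωF) (hB : IsContractive QB ν ωB)

include hs hF hB

theorem measurable_deviation {Ω : Type*} [MeasurableSpace Ω] {x : Ω → Act d 0} {w : Ω → Params dw}
    (hx : Measurable x) (hw : Measurable w) : Measurable fun ω => deviation a D (x ω) (w ω) :=
  (measurable_lossGrad hs.op_diff hx hw).sub
    ((continuous_gradient_risk hs).measurable.comp hw)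

theorem measurable_devIter (θ : Hyper) (t : ℕ) : Measurable (devIter a QF QB w₁ D θ t) :=
  measurable_deviation hs hF hB (measurable_iter_x hs hF hB θ t) (measurable_wts hs hF hB θ t)

theorem measurable_noiseAvg (θ : Hyper) (t : ℕ) : Measurable (noiseAvg a QF QB w₁ D θ t) := by
  induction t with
  | zero => exact measurable_const
  | succ t ih =>
    have h := measurable_devIter (w₁ := w₁) hs hF hB θ (t + 1)
    have : noiseAvg a QF QB w₁ D θ (t + 1) = fun ω => (1 - θ.2.1) • noiseAvg a QF QB w₁ D θ t ω
      + θ.2.1 • devIter a QF QB w₁ D θ (t + 1) ω := rfl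
    rw [this]
    exact Measurable.add (ih.const_smul (1 - θ.2.1)) (h.const_smul θ.2.1)

omit hs hF hB in
theorem noiseAvg_le {θ : Hyper} (hm0 : 0 ≤ θ.2.1) (hm1 : θ.2.1 ≤ 1) {G : ℝ} (hG : 0 ≤ G)
    {ω : ℕ → Noise d Z} (h : ∀ t, ‖devIter a QF QB w₁ D θ (t + 1) ω‖ ≤ G) (t : ℕ) :
    ‖noiseAvg a QF QB w₁ D θ t ω‖ ≤ G := by
  induction t with
  | zero => simpa [noiseAvg] using hG
  | succ t ih =>
    rw [noiseAvg]
    refine (norm_add_le _ _).trans ?_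
    rw [norm_smul, norm_smul, Real.norm_of_nonneg hm0, Real.norm_of_nonneg (sub_nonneg.2 hm1)]
    nlinarith [h t]

include hu

/-- Only a sample that was kept correlates with the past. -/
theorem integral_inner_noiseAvg (θ : Hyper) (hm0 : 0 ≤ θ.2.1) (hm1 : θ.2.1 ≤ 1) (t : ℕ) :
    ∫ ω, inner ℝ (noiseAvg a QF QB w₁ D θ (t + 1) ω) (devIter a QF QB w₁ D θ (t + 2) ω) ∂law D ν θ
      = (1 - (schedule θ.1 (t + 2) : ℝ)) * ∫ ω, inner ℝ (noiseAvg a QF QB w₁ D θ (t + 1) ω)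
        (deviation a D (iter a QF QB w₁ θ (t + 1) ω).x (wts a QF QB w₁ θ (t + 2) ω))
          ∂law D ν θ := by
  obtain ⟨G, hG, hdev⟩ := deviation_le hs hu
  have hN : ∀ s ω, ‖noiseAvg a QF QB w₁ D θ s ω‖ ≤ G := fun s ω =>
    noiseAvg_le hm0 hm1 hG (fun t => hdev _ _) s
  have hint : Integrable (fun ω => inner ℝ (noiseAvg a QF QB w₁ D θ (t + 1) ω)
      (devIter a QF QB w₁ D θ (t + 2) ω)) (law D ν θ) := by
    refine Integrable.of_bound ((measurable_noiseAvg hs hF hB θ _).inner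
      (measurable_devIter hs hF hB θ _)).aestronglyMeasurable (G * G) (ae_of_all _ fun ω => ?_)
    exact (norm_inner_le_norm _ _).trans
      (mul_le_mul (hN _ _) (hdev _ _) (norm_nonneg _) hG)
  -- All the randomness of iteration `t + 2` is resampled; the average up to `t + 1`, the weights
  -- `w^{(t+2)}` and the previous sample are unaffected.
  have hres : IsResampling (fun (ω : ℕ → Noise d Z) n => Function.update ω (t + 2) n)
      (law D ν θ) (noiseLaw D ν (schedule θ.1 (t + 2))) :=
    isResampling_update (fun t => noiseLaw D ν (schedule θ.1 t)) (t + 2)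
  rw [hres.integral_eq hint, ← integral_const_mul]
  congr 1
  funext ω
  set w := wts a QF QB w₁ θ (t + 2) ω
  set N := noiseAvg a QF QB w₁ D θ (t + 1) ω
  have hpt : ∀ n : Noise d Z, inner ℝ
      (noiseAvg a QF QB w₁ D θ (t + 1) (Function.update ω (t + 2) n))
      (devIter a QF QB w₁ D θ (t + 2) (Function.update ω (t + 2) n))
      = if n.2.1 = true then inner ℝ N (deviation a D n.1 w)
        else inner ℝ N (deviation a D (iter a QF QB w₁ θ (t + 1) ω).x w) := by
    intro n
    have hx : (iter a QF QB w₁ θ (t + 2) (Function.update ω (t + 2) n)).x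
        = if n.2.1 = true then n.1 else (iter a QF QB w₁ θ (t + 1) ω).x := by
      simp only [iter]
      rw [run, run_update _ _ _ _ _ _ _ _ (Nat.lt_succ_self (t + 1))]
      simp [step, lazySample]
    rw [noiseAvg_update θ ω n (Nat.lt_succ_self (t + 1)), devIter, hx, wts_update]
    split_ifs <;> rfl
  simp only [hpt]
  have hgm : Measurable fun x => inner ℝ N (deviation a D x w) :=
    measurable_const.inner (measurable_deviation hs hF hB measurable_id measurable_const)
  have hdi : Integrable (fun x => deviation a D x w) D :=
    Integrable.of_bound (measurable_deviation hs hF hB measurable_id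
      measurable_const).aestronglyMeasurable G (ae_of_all _ fun x => hdev x w)
  refine integral_noiseLaw_ite hgm (hdi.const_inner N) ?_ _ _
  rw [integral_inner hdi]
  have hi := hu.integrable w
  have hmean := hu.mean w
  simp only [gradient_loss hs.op_diff] at hi hmean
  have : ∫ x, deviation a D x w ∂D = 0 := by
    simp only [deviation]
    rw [integral_sub hi (integrable_const _), hmean]
    simp
  rw [this, inner_zero_right]

end Noise

/-! ### Summation of the sampling noise -/

section NoiseBound

set_option linter.unusedSectionVars false

/-- Summation of the coupled recursions for the size `A` of an average and its correlation `k`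
with the next increment. -/
theorem sum_le_of_correlation_recursion {k A r δ : ℕ → ℝ} {p m M K : ℝ} (hm : 0 < m) (hm1 : m ≤ 1)
    (hp : 0 < p)
    (hp1 : p ≤ 1) (hM : 0 ≤ M) (hK : 0 ≤ K) (hk0 : k 0 = 0)
    (hk : ∀ s, |k (s + 1)| ≤ (1 - p) * (|k s| + m * M + K * r (s + 1)))
    (hr : ∀ t, 0 ≤ r t) (hA : ∀ t, 0 ≤ A t) (hA0 : A 0 = 0)
    (hstep : ∀ t, A (t + 1) ≤ (1 - m) * A t + 2 * m * |k t| + m ^ 2 * M)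
    (hδ : ∀ c t, 2 * c * r t ≤ A t + c ^ 2 * δ t) (T : ℕ) :
    ∑ t ∈ Finset.range T, A (t + 1)
      ≤ 4 * T * M * (m / p) + 2 * T * M * m + 4 * K ^ 2 / p ^ 2 * ∑ t ∈ Finset.range T, δ t := by
  set S := ∑ t ∈ Finset.range T, A (t + 1)
  set κ := ∑ t ∈ Finset.range T, |k t|
  set R := ∑ t ∈ Finset.range T, r t
  have hAS : ∑ t ∈ Finset.range T, A t ≤ S := by
    have h₁ := Finset.sum_range_succ A T
    have h₂ := Finset.sum_range_succ' A T
    have := hA T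
    simp only [S]
    linarith
  have hS : S ≤ 2 * κ + T * M * m := by
    have h₁ : S ≤ (1 - m) * ∑ t ∈ Finset.range T, A t + 2 * m * κ + T * (m ^ 2 * M) := by
      refine (Finset.sum_le_sum fun t _ => hstep t).trans_eq ?_
      rw [Finset.sum_add_distrib, Finset.sum_add_distrib, ← Finset.mul_sum, ← Finset.mul_sum]
      simp [κ]
    have h₂ := mul_le_mul_of_nonneg_left hAS (sub_nonneg.2 hm1)
    exact le_of_mul_le_mul_left (by linarith) hm
  -- Summing the recursion for `|k|` from `k 0 = 0` leaves `(1 - p) κ` on the right, which is moved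
  -- to the left.
  have hκ : p * κ ≤ T * (m * M) + K * R := by
    rcases T with _ | n
    · simp [κ, R]
    · have h₁ : κ = ∑ t ∈ Finset.range n, |k (t + 1)| := by
        simp [κ, Finset.sum_range_succ', hk0]
      have h₂ : ∑ t ∈ Finset.range n, |k (t + 1)| ≤ (1 - p) * (∑ t ∈ Finset.range n, |k t|
          + n * (m * M) + K * ∑ t ∈ Finset.range n, r (t + 1)) := by
        refine (Finset.sum_le_sum fun t _ => hk t).trans_eq ?_
        rw [← Finset.mul_sum, Finset.sum_add_distrib, Finset.sum_add_distrib, Finset.sum_const,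
          Finset.card_range, nsmul_eq_mul, ← Finset.mul_sum]
      have h₃ : ∑ t ∈ Finset.range n, |k t| ≤ κ := by
        simp only [κ, Finset.sum_range_succ]
        exact le_add_of_nonneg_right (abs_nonneg _)
      have h₄ : ∑ t ∈ Finset.range n, r (t + 1) ≤ R := by
        simp only [R, Finset.sum_range_succ']
        exact le_add_of_nonneg_right (hr 0)
      have h₅ : 0 ≤ ∑ t ∈ Finset.range n, r (t + 1) := Finset.sum_nonneg fun t _ => hr _
      have h₆ : 0 ≤ m * M := by positivity
      have h₇ : κ ≤ (1 - p) * κ + ((n : ℝ) * (m * M) + K * R) := by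
        have h₈ : 0 ≤ (n : ℝ) * (m * M) + K * R :=
          add_nonneg (by positivity) (mul_nonneg hK (h₅.trans h₄))
        have h₉ := mul_le_mul_of_nonneg_left (add_le_add (add_le_add h₃ (le_refl (n * (m * M))))
          (mul_le_mul_of_nonneg_left h₄ hK)) (sub_nonneg.2 hp1)
        rw [h₁.symm] at h₂
        nlinarith
      push_cast
      linarith
  -- Young's inequality with `c = 2K / p`: the term `2 (K / p) R` in the bound of `S` then costs
  -- only `S / 2`, which is absorbed.
  have hR : 2 * (2 * K / p) * R ≤ S + (2 * K / p) ^ 2 * ∑ t ∈ Finset.range T, δ t := by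
    refine le_trans ?_ (add_le_add_left hAS _)
    rw [Finset.mul_sum, Finset.mul_sum, ← Finset.sum_add_distrib]
    exact Finset.sum_le_sum fun t _ => hδ _ t
  have hκ' : κ ≤ T * M * (m / p) + K / p * R := by
    have : κ ≤ (T * (m * M) + K * R) / p := by
      rw [le_div_iff₀ hp]; linarith
    refine this.trans_eq ?_
    field_simp
  have e₁ : 2 * (2 * K / p) * R = 4 * (K / p * R) := by ring
  have e₂ : (2 * K / p) ^ 2 = 4 * K ^ 2 / p ^ 2 := by ring
  rw [e₁, e₂] at hR
  linarith

/-- The factor of `σ ^ 2` in the final bound. -/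
noncomputable def noiseFactor (p m : ℝ) : ℝ :=
  ((2 - p) * m - (1 - p) * m ^ 2) / (1 - (1 - p) * (1 - m) ^ 2)

/-- The numerator is `m + (1 - p) m (1 - m) ≥ m` and the denominator is `p + (1 - p) m (2 - m) ≤ p +
2m`. It is used with `q = 3m` when `p ≤ m` and with `q = 3p` when `m < p`. -/
theorem div_le_noiseFactor {p m q : ℝ} (hp : 0 ≤ p) (hp1 : p ≤ 1) (hm : 0 < m) (hm1 : m < 1)
    (hq : p + 2 * m ≤ q) : m / q ≤ noiseFactor p m := by
  have h : 0 ≤ (1 - p) * m := mul_nonneg (sub_nonneg.2 hp1) hm.le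
  have hden : 1 - (1 - p) * (1 - m) ^ 2 = p + (1 - p) * m * (2 - m) := by ring
  have h₁ : 0 < p + (1 - p) * m * (2 - m) := by
    rcases hp.eq_or_lt with rfl | hp
    · nlinarith
    · nlinarith
  have h₂ : p + (1 - p) * m * (2 - m) ≤ q := by nlinarith [mul_nonneg hp hm.le]
  have h₃ : m ≤ (2 - p) * m - (1 - p) * m ^ 2 := by nlinarith
  rw [noiseFactor, hden]
  exact div_le_div₀ (hm.le.trans h₃) h₃ h₁ h₂

variable {E : ℕ} {d : Fin (E + 1) → ℕ} {dw : Fin E → ℕ} {Z : Type*} [MeasurableSpace Z]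
variable {a : Operators d dw} {QF QB : Compressors d Z} {w₁ : Params dw}
variable {D : Measure (Act d 0)} {ν : Measure Z} [IsProbabilityMeasure D] [IsProbabilityMeasure ν]
variable {Lℓ Ca La Lga σ ωF ωB : ℝ}

theorem sum_move_prev_le (θ : Hyper) (T : ℕ) : ∑ t ∈ Finset.range T,
      ∫ ω, ‖wts a QF QB w₁ θ (t + 1) ω - wts a QF QB w₁ θ t ω‖ ^ 2 ∂law D ν θ
    ≤ ∑ t ∈ Finset.range T,
      ∫ ω, ‖wts a QF QB w₁ θ (t + 2) ω - wts a QF QB w₁ θ (t + 1) ω‖ ^ 2 ∂law D ν θ := by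
  have := sum_range_le_of_first (law D ν θ) (fun t ω => wts a QF QB w₁ θ (t + 1) ω
    - wts a QF QB w₁ θ t ω) (c := 0) (by simp [weights]) le_rfl T
  simpa using this

variable (hD : Integrable (fun x => ‖x‖ ^ 2) D) (hs : IsSmooth a D Lℓ Ca La Lga)
  (hu : IsUnbiased a D σ) (hF : IsContractive QF ν ωF) (hB : IsContractive QB ν ωB)

omit [IsProbabilityMeasure D] [IsProbabilityMeasure ν] in
theorem integrable_inner {Ω V : Type*} [MeasurableSpace Ω] [NormedAddCommGroup V]
    [InnerProductSpace ℝ V] {P : Measure Ω} {f g : Ω → V} (hf : MemLp f 2 P) (hg : MemLp g 2 P) :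
    Integrable (fun ω => inner ℝ (f ω) (g ω)) P :=
  (hf.norm.integrable_mul hg.norm).mono (hf.1.inner hg.1)
    (ae_of_all _ fun _ => (norm_inner_le_norm _ _).trans (le_abs_self _))

include hs hu hF hB in
theorem memLp_noiseAvg (θ : Hyper) (hm : 0 < θ.2.1) (hm1 : θ.2.1 < 1) (t : ℕ) :
    MemLp (noiseAvg a QF QB w₁ D θ t) 2 (law D ν θ) := by
  obtain ⟨G, hG, hdev⟩ := deviation_le hs hu
  exact MemLp.of_bound (measurable_noiseAvg hs hF hB θ t).aestronglyMeasurable G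
    (ae_of_all _ fun _ => noiseAvg_le hm.le hm1.le hG (fun _ => hdev _ _) t)

include hD hs hu hF hB in
theorem sum_noiseAvg_le : ∃ κ K, 0 ≤ κ ∧ 0 ≤ K ∧ ∀ (θ : Hyper) (T : ℕ), 0 < θ.2.1 → θ.2.1 < 1 →
    ∑ t ∈ Finset.range T, ∫ ω, ‖noiseAvg a QF QB w₁ D θ (t + 1) ω‖ ^ 2 ∂law D ν θ
      ≤ κ * (T * (σ ^ 2 * noiseFactor θ.1 θ.2.1)) + K / θ.2.1 ^ 2 * ∑ t ∈ Finset.range T,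
        ∫ ω, ‖wts a QF QB w₁ θ (t + 2) ω - wts a QF QB w₁ θ (t + 1) ω‖ ^ 2 ∂law D ν θ := by
  obtain ⟨κ, hκ, hκdev⟩ := exists_deviation_sq_le hs hu
  obtain ⟨K, hK, hlip⟩ := deviation_lip hs
  obtain ⟨G, hG, hdev⟩ := deviation_le hs hu
  refine ⟨18 * κ, 4 * K ^ 2, by positivity, by positivity, fun θ T hm hm1 => ?_⟩
  set P := law D ν θ
  set m := θ.2.1
  set p : ℝ := ((θ.1 : unitInterval) : ℝ)
  have hp0 : 0 ≤ p := θ.1.2.1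
  have hp1 : p ≤ 1 := θ.1.2.2
  set N := noiseAvg a QF QB w₁ D θ
  set ξ := devIter a QF QB w₁ D θ
  set W := wts a QF QB w₁ θ
  set M := κ * σ ^ 2
  have hM : 0 ≤ M := by positivity
  have hξ : ∀ᵐ ω ∂P, ∀ t, ‖ξ (t + 1) ω‖ ^ 2 ≤ M := by
    filter_upwards [ae_iter_x (a := a) (QF := QF) (QB := QB) (w₁ := w₁) hκdev θ] with ω hω t
    exact hω t _
  have hNm : ∀ t, MemLp (N t) 2 P := memLp_noiseAvg hs hu hF hB θ hm hm1
  have hξm : ∀ t, MemLp (ξ t) 2 P := fun t => MemLp.of_bound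
    (measurable_devIter hs hF hB θ t).aestronglyMeasurable G (ae_of_all _ fun ω => hdev _ _)
  have hWm : ∀ t, MemLp (fun ω => W (t + 1) ω - W t ω) 2 P := fun t =>
    (memLp_wts hD hs hF hB θ _).sub (memLp_wts hD hs hF hB θ _)
  have hA_le : ∀ t, ∫ ω, ‖N t ω‖ ^ 2 ∂P ≤ M := by
    intro t
    have : ∀ᵐ ω ∂P, ‖N t ω‖ ^ 2 ≤ M := by
      filter_upwards [hξ] with ω hω
      have := noiseAvg_le (a := a) (QF := QF) (QB := QB) (w₁ := w₁) (D := D) hm.le hm1.le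
        (Real.sqrt_nonneg M) (fun t => Real.le_sqrt_of_sq_le (hω t)) t
      exact (Real.le_sqrt (norm_nonneg _) hM).1 this
    refine (integral_mono_ae (hNm t).integrable_norm_sq (integrable_const M) this).trans_eq ?_
    simp
  have hW0 : 0 ≤ ∑ t ∈ Finset.range T, ∫ ω, ‖W (t + 2) ω - W (t + 1) ω‖ ^ 2 ∂P :=
    sum_move_nonneg P (fun t ω => W (t + 2) ω - W (t + 1) ω) T
  -- For `p ≤ m`, possibly `p = 0`, the noise factor is at least `1/3` and the trivial bound `M` per
  -- iteration suffices. Otherwise the decay of correlations is needed.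
  rcases le_or_gt p m with hpm | hpm
  · have hR := div_le_noiseFactor (q := 3 * m) hp0 hp1 hm hm1 (by linarith)
    have h3 : m / (3 * m) = 1 / 3 := by field_simp
    rw [h3] at hR
    have h₁ : ∑ t ∈ Finset.range T, ∫ ω, ‖N (t + 1) ω‖ ^ 2 ∂P ≤ T * M := by
      refine (Finset.sum_le_sum fun t _ => hA_le (t + 1)).trans_eq ?_
      simp
    have h₂ : T * M * (1 / 3) ≤ T * M * noiseFactor p m :=
      mul_le_mul_of_nonneg_left hR (by positivity)
    have h₃ : 0 ≤ 4 * K ^ 2 / m ^ 2 * ∑ t ∈ Finset.range T,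
        ∫ ω, ‖W (t + 2) ω - W (t + 1) ω‖ ^ 2 ∂P := mul_nonneg (by positivity) hW0
    have h₄ : 18 * κ * (T * (σ ^ 2 * noiseFactor p m)) = 18 * (T * M * noiseFactor p m) := by
      simp only [M]; ring
    have h₅ : 0 ≤ T * M := by positivity
    rw [h₄]
    linarith
  · have hp : 0 < p := hm.trans hpm
    set k : ℕ → ℝ := fun t => ∫ ω, inner ℝ (N t ω) (ξ (t + 1) ω) ∂P
    set A : ℕ → ℝ := fun t => ∫ ω, ‖N t ω‖ ^ 2 ∂P
    set r : ℕ → ℝ := fun t => ∫ ω, ‖N t ω‖ * ‖W (t + 1) ω - W t ω‖ ∂P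
    set δ : ℕ → ℝ := fun t => ∫ ω, ‖W (t + 1) ω - W t ω‖ ^ 2 ∂P
    have hNs : ∀ t ω, N (t + 1) ω = (1 - m) • N t ω + m • ξ (t + 1) ω := fun _ _ => rfl
    have hri : ∀ t, Integrable (fun ω => ‖N t ω‖ * ‖W (t + 1) ω - W t ω‖) P := fun t =>
      (hNm t).norm.integrable_mul (hWm t).norm
    have hsq : ∀ t, ∫ ω, ‖ξ (t + 1) ω‖ ^ 2 ∂P ≤ M := by
      intro t
      have : ∀ᵐ ω ∂P, ‖ξ (t + 1) ω‖ ^ 2 ≤ M := by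
        filter_upwards [hξ] with ω hω using hω t
      refine (integral_mono_ae (hξm _).integrable_norm_sq (integrable_const M) this).trans_eq ?_
      simp
    have hk0 : k 0 = 0 := by simp [k, N, noiseAvg]
    have hk : ∀ s, |k (s + 1)| ≤ (1 - p) * (|k s| + m * M + K * r (s + 1)) := by
      intro s
      set J := ∫ ω, inner ℝ (N (s + 1) ω)
        (deviation a D (iter a QF QB w₁ θ (s + 1) ω).x (W (s + 2) ω)) ∂P
      have hJ : k (s + 1) = (1 - (schedule θ.1 (s + 2) : ℝ)) * J :=
        integral_inner_noiseAvg hs hu hF hB θ hm.le hm1.le s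
      have hq : p ≤ schedule θ.1 (s + 2) := by
        unfold schedule
        split_ifs
        · exact hp1
        · exact le_rfl
      have hq1 : (schedule θ.1 (s + 2) : ℝ) ≤ 1 := (schedule θ.1 (s + 2)).2.2
      have hdm : MemLp (fun ω => deviation a D (iter a QF QB w₁ θ (s + 1) ω).x (W (s + 2) ω)) 2 P :=
        MemLp.of_bound (measurable_deviation hs hF hB (measurable_iter_x hs hF hB θ _)
          (measurable_wts hs hF hB θ _)).aestronglyMeasurable G (ae_of_all _ fun ω => hdev _ _)
      -- The average already contains the deviation of the kept sample, with weight `m`; this is the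
      -- source of the term `m M`.
      have h₁ : ∫ ω, inner ℝ (N (s + 1) ω) (ξ (s + 1) ω) ∂P
          = (1 - m) * k s + m * ∫ ω, ‖ξ (s + 1) ω‖ ^ 2 ∂P := by
        rw [← integral_const_mul, ← integral_const_mul, ← integral_add
          ((integrable_inner (hNm s) (hξm (s + 1))).const_mul _)
          ((hξm (s + 1)).integrable_norm_sq.const_mul _)]
        congr 1
        funext ω
        rw [hNs, inner_add_left, real_inner_smul_left, real_inner_smul_left,
          real_inner_self_eq_norm_sq]
      -- Both deviations are taken at the same sample and differ only in the weights.
      have h₂ : |J - ∫ ω, inner ℝ (N (s + 1) ω) (ξ (s + 1) ω) ∂P| ≤ K * r (s + 1) := by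
        rw [← integral_sub (integrable_inner (hNm _) hdm) (integrable_inner (hNm _) (hξm _)),
          ← integral_const_mul, ← Real.norm_eq_abs]
        refine norm_integral_le_of_norm_le ((hri (s + 1)).const_mul K) (ae_of_all _ fun ω => ?_)
        rw [← inner_sub_right]
        refine (norm_inner_le_norm _ _).trans ?_
        rw [mul_left_comm]
        exact mul_le_mul_of_nonneg_left (hlip _ _ _) (norm_nonneg _)
      have h₃ : |∫ ω, inner ℝ (N (s + 1) ω) (ξ (s + 1) ω) ∂P| ≤ |k s| + m * M := by
        have h0 : 0 ≤ ∫ ω, ‖ξ (s + 1) ω‖ ^ 2 ∂P := by positivity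
        rw [h₁]
        refine (abs_add_le _ _).trans (add_le_add ?_ ?_)
        · rw [abs_mul, abs_of_nonneg (sub_nonneg.2 hm1.le)]
          exact mul_le_of_le_one_left (abs_nonneg _) (by linarith)
        · rw [abs_of_nonneg (mul_nonneg hm.le h0)]
          exact mul_le_mul_of_nonneg_left (hsq s) hm.le
      have h₄ : |J| ≤ |k s| + m * M + K * r (s + 1) := by
        have := abs_sub_abs_le_abs_sub J (∫ ω, inner ℝ (N (s + 1) ω) (ξ (s + 1) ω) ∂P)
        linarith
      rw [hJ, abs_mul, abs_of_nonneg (sub_nonneg.2 hq1)]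
      exact mul_le_mul (by linarith) h₄ (abs_nonneg _) (by linarith)
    have hr : ∀ t, 0 ≤ r t := fun t => integral_nonneg fun ω => by positivity
    have hA : ∀ t, 0 ≤ A t := fun t => integral_nonneg fun ω => by positivity
    have hA0 : A 0 = 0 := by simp [A, N, noiseAvg]
    have hstep : ∀ t, A (t + 1) ≤ (1 - m) * A t + 2 * m * |k t| + m ^ 2 * M := by
      intro t
      have h₁ : A (t + 1) = (1 - m) ^ 2 * A t + 2 * (1 - m) * m * k t
          + m ^ 2 * ∫ ω, ‖ξ (t + 1) ω‖ ^ 2 ∂P := by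
        have i₁ := (hNm t).integrable_norm_sq.const_mul ((1 - m) ^ 2)
        have i₂ := (integrable_inner (hNm t) (hξm (t + 1))).const_mul (2 * (1 - m) * m)
        have i₃ : Integrable (fun ω => (1 - m) ^ 2 * ‖N t ω‖ ^ 2
          + 2 * (1 - m) * m * inner ℝ (N t ω) (ξ (t + 1) ω)) P := i₁.add i₂
        rw [← integral_const_mul, ← integral_const_mul, ← integral_const_mul,
          ← integral_add i₁ i₂, ← integral_add i₃ ((hξm (t + 1)).integrable_norm_sq.const_mul _)]
        refine integral_congr_ae (ae_of_all _ fun ω => ?_)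
        beta_reduce
        rw [hNs, norm_add_sq_real, real_inner_smul_left, real_inner_smul_right, norm_smul,
          norm_smul, mul_pow, mul_pow, Real.norm_eq_abs, Real.norm_eq_abs, sq_abs, sq_abs]
        ring
      have h₂ : (1 - m) ^ 2 * A t ≤ (1 - m) * A t :=
        mul_le_mul_of_nonneg_right (by nlinarith) (hA t)
      have h₃ : 2 * (1 - m) * m * k t ≤ 2 * m * |k t| := by
        have e₁ : 2 * (1 - m) * m * k t ≤ 2 * (1 - m) * m * |k t| :=
          mul_le_mul_of_nonneg_left (le_abs_self _)
            (mul_nonneg (mul_nonneg zero_le_two (sub_nonneg.2 hm1.le)) hm.le)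
        nlinarith [abs_nonneg (k t), mul_pos hm hm]
      have h₄ := mul_le_mul_of_nonneg_left (hsq t) (sq_nonneg m)
      linarith
    have hδ : ∀ c t, 2 * c * r t ≤ A t + c ^ 2 * δ t := by
      intro c t
      rw [← integral_const_mul, ← integral_const_mul, ← integral_add
        (hNm t).integrable_norm_sq ((hWm t).integrable_norm_sq.const_mul _)]
      refine integral_mono ((hri t).const_mul _)
        ((hNm t).integrable_norm_sq.add ((hWm t).integrable_norm_sq.const_mul _)) fun ω => ?_
      nlinarith [sq_nonneg (‖N t ω‖ - c * ‖W (t + 1) ω - W t ω‖)]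
    have key := sum_le_of_correlation_recursion hm hm1.le hp hp1 hM hK hk0 hk hr hA hA0 hstep hδ T
    have hprev : ∑ t ∈ Finset.range T, δ t ≤ ∑ t ∈ Finset.range T,
        ∫ ω, ‖W (t + 2) ω - W (t + 1) ω‖ ^ 2 ∂P := sum_move_prev_le θ T
    have hR := div_le_noiseFactor (q := 3 * p) hp0 hp1 hm hm1 (by linarith)
    have h3 : m / (3 * p) = m / p / 3 := by field_simp
    have hmp : m ≤ m / p := le_div_self hm.le hp hp1
    rw [h3] at hR
    have h₁ : T * M * (m / p) ≤ T * M * (3 * noiseFactor p m) :=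
      mul_le_mul_of_nonneg_left (by linarith) (by positivity)
    have h₂ : T * M * m ≤ T * M * (3 * noiseFactor p m) :=
      mul_le_mul_of_nonneg_left (by linarith) (by positivity)
    -- Here `m < p` turns `1 / p²` into `1 / m²`.
    have h₃ : 4 * K ^ 2 / p ^ 2 * ∑ t ∈ Finset.range T, δ t ≤ 4 * K ^ 2 / m ^ 2 *
        ∑ t ∈ Finset.range T, ∫ ω, ‖W (t + 2) ω - W (t + 1) ω‖ ^ 2 ∂P := by
      refine mul_le_mul ?_ hprev (Finset.sum_nonneg fun t _ => integral_nonneg fun ω => by positivity)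
        (by positivity)
      gcongr
    have h₄ : 18 * κ * (T * (σ ^ 2 * noiseFactor p m)) = 6 * (T * M * (3 * noiseFactor p m)) := by
      simp only [M]; ring
    rw [h₄]
    linarith

end NoiseBound

/-! ### Descent -/

section Descent

set_option linter.unusedSectionVars false

variable {E : ℕ} {d : Fin (E + 1) → ℕ} {dw : Fin E → ℕ} {Z : Type*} [MeasurableSpace Z]
variable {a : Operators d dw} {QF QB : Compressors d Z} {w₁ : Params dw}
variable {D : Measure (Act d 0)} {ν : Measure Z} [IsProbabilityMeasure D] [IsProbabilityMeasure ν]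
variable {Lℓ Ca La Lga σ ωF ωB : ℝ}

/-- Expand `‖u - ∇ℓ‖²` and bound the inner product by smoothness. This leaves `(2 |Lℓ| γ - 1) ‖u‖²`,
and `2 |Lℓ| γ ≤ 1/2 + 2 Lℓ² γ²`; so no restriction on `γ` is needed. -/
theorem IsSmooth.descent (hs : IsSmooth a D Lℓ Ca La Lga) (w u : Params dw) {γ : ℝ} (hγ : 0 < γ) :
    ‖gradient (risk a D) w‖ ^ 2 ≤ 2 / γ * (risk a D w - risk a D (w - γ • u))
      + ‖u - gradient (risk a D) w‖ ^ 2
      + (2 * Lℓ ^ 2 - 1 / (2 * γ ^ 2)) * ‖(w - γ • u) - w‖ ^ 2 := by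
  have h := hs.risk_le w (w - γ • u)
  set g := gradient (risk a D) w
  have e₁ : w - γ • u - w = -(γ • u) := by abel
  have e₂ : ‖w - γ • u - w‖ ^ 2 = γ ^ 2 * ‖u‖ ^ 2 := by
    rw [e₁, norm_neg, norm_smul, mul_pow, Real.norm_eq_abs, sq_abs]
  rw [e₂, e₁, inner_neg_right, real_inner_smul_right] at h
  rw [e₂, norm_sub_sq_real, real_inner_comm]
  have h₁ : 2 / γ * (γ * inner ℝ g u - |Lℓ| * (γ ^ 2 * ‖u‖ ^ 2))
      ≤ 2 / γ * (risk a D w - risk a D (w - γ • u)) :=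
    mul_le_mul_of_nonneg_left (by linarith) (by positivity)
  have h₂ : 2 / γ * (γ * inner ℝ g u - |Lℓ| * (γ ^ 2 * ‖u‖ ^ 2))
      = 2 * inner ℝ g u - 2 * |Lℓ| * γ * ‖u‖ ^ 2 := by
    field_simp
  have h₃ : (2 * Lℓ ^ 2 - 1 / (2 * γ ^ 2)) * (γ ^ 2 * ‖u‖ ^ 2)
      = 2 * |Lℓ| ^ 2 * γ ^ 2 * ‖u‖ ^ 2 - ‖u‖ ^ 2 / 2 := by
    rw [sq_abs]
    field_simp
  have h₄ : 0 ≤ (1 - 2 * |Lℓ| * γ) ^ 2 * ‖u‖ ^ 2 := by positivity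
  rw [h₃]
  nlinarith

/-- The gradient estimation error without the sampling noise. -/
noncomputable def biasIter (a : Operators d dw) (QF QB : Compressors d Z) (w₁ : Params dw)
    (D : Measure (Act d 0)) (θ : Hyper) (t : ℕ) (ω : ℕ → Noise d Z) : Params dw :=
  (iter a QF QB w₁ θ t ω).u - gradient (risk a D) (wts a QF QB w₁ θ t ω)
    - noiseAvg a QF QB w₁ D θ t ω

/-- The error of the compressed gradient. -/
noncomputable abbrev gradErr (a : Operators d dw) (QF QB : Compressors d Z) (w₁ : Params dw)
    (θ : Hyper) (t : ℕ) (ω : ℕ → Noise d Z) : Params dw :=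
  compressedGrad a QF QB w₁ θ t ω - lossGrad a (iter a QF QB w₁ θ t ω).x (wts a QF QB w₁ θ t ω)

theorem biasIter_succ (θ : Hyper) (t : ℕ) (ω : ℕ → Noise d Z) :
    biasIter a QF QB w₁ D θ (t + 1) ω = (1 - θ.2.1) • biasIter a QF QB w₁ D θ t ω
      + ((1 - θ.2.1) • (gradient (risk a D) (wts a QF QB w₁ θ t ω)
          - gradient (risk a D) (wts a QF QB w₁ θ (t + 1) ω))
        + θ.2.1 • gradErr a QF QB w₁ θ (t + 1) ω) := by
  simp only [biasIter, iter_u_succ, noiseAvg, devIter, deviation, gradErr]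
  module

/-- Contraction with factor `1 - m`, pathwise. Summing costs `1 / m²` on the squared drive: this
stays on the weight moves, but cancels for the gradient errors, which enter with a factor `m`. -/
theorem sum_biasIter_le (hs : IsSmooth a D Lℓ Ca La Lga) (θ : Hyper) (hm : 0 < θ.2.1)
    (hm1 : θ.2.1 < 1) (T : ℕ) (ω : ℕ → Noise d Z) :
    ∑ t ∈ Finset.range T, ‖biasIter a QF QB w₁ D θ (t + 1) ω‖ ^ 2
      ≤ ‖gradient (risk a D) w₁‖ ^ 2 / θ.2.1
        + 2 * Lℓ ^ 2 / θ.2.1 ^ 2 * ∑ t ∈ Finset.range T,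
          ‖wts a QF QB w₁ θ (t + 1) ω - wts a QF QB w₁ θ t ω‖ ^ 2
        + 2 * ∑ t ∈ Finset.range T, ‖gradErr a QF QB w₁ θ (t + 1) ω‖ ^ 2 := by
  set m := θ.2.1
  set W := fun t => wts a QF QB w₁ θ t ω
  set Γ := fun t => gradErr a QF QB w₁ θ t ω
  have hrec : ∀ t, ‖biasIter a QF QB w₁ D θ (t + 1) ω‖
      ≤ (1 - m) * ‖biasIter a QF QB w₁ D θ t ω‖
        + (|Lℓ| * ‖W (t + 1) - W (t + 1 - 1)‖ + m * ‖Γ (t + 1)‖) := by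
    intro t
    rw [biasIter_succ]
    refine (norm_add_le _ _).trans (add_le_add ?_ ((norm_add_le _ _).trans (add_le_add ?_ ?_)))
    · rw [norm_smul, Real.norm_of_nonneg (sub_nonneg.2 hm1.le)]
    · rw [norm_smul, Real.norm_of_nonneg (sub_nonneg.2 hm1.le), norm_sub_rev]
      refine (mul_le_of_le_one_left (norm_nonneg _) (by linarith)).trans ?_
      exact (hs.risk_lip _ _).trans
        (mul_le_mul_of_nonneg_right (le_abs_self _) (norm_nonneg _))
    · rw [norm_smul, Real.norm_of_nonneg hm.le]
  have h := sum_sq_le_of_contraction (θ := fun t => ‖biasIter a QF QB w₁ D θ t ω‖)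
    (β := fun t => |Lℓ| * ‖W t - W (t - 1)‖ + m * ‖Γ t‖) (c := 1 - m) (by linarith) (by linarith)
    (fun t => norm_nonneg _) hrec T
  -- The momentum and the noise average start at `0`, so the initial bias is `-∇ℓ(w₁)`.
  have h0 : ‖biasIter a QF QB w₁ D θ 0 ω‖ = ‖gradient (risk a D) w₁‖ := by
    simp [biasIter, iter, run, initState, noiseAvg, weights]
  rw [sub_sub_cancel] at h
  simp only [h0, Nat.add_sub_cancel] at h
  have hβ : ∑ t ∈ Finset.range T, (|Lℓ| * ‖W (t + 1) - W t‖ + m * ‖Γ (t + 1)‖) ^ 2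
      ≤ 2 * Lℓ ^ 2 * ∑ t ∈ Finset.range T, ‖W (t + 1) - W t‖ ^ 2
        + 2 * m ^ 2 * ∑ t ∈ Finset.range T, ‖Γ (t + 1)‖ ^ 2 := by
    rw [Finset.mul_sum, Finset.mul_sum, ← Finset.sum_add_distrib]
    refine Finset.sum_le_sum fun t _ => ?_
    have := sq_nonneg (|Lℓ| * ‖W (t + 1) - W t‖ - m * ‖Γ (t + 1)‖)
    have e : Lℓ ^ 2 = |Lℓ| ^ 2 := (sq_abs _).symm
    rw [e]
    nlinarith
  calc _ ≤ _ := h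
    _ ≤ (‖gradient (risk a D) w₁‖ ^ 2 + (2 * Lℓ ^ 2 * ∑ t ∈ Finset.range T, ‖W (t + 1) - W t‖ ^ 2
        + 2 * m ^ 2 * ∑ t ∈ Finset.range T, ‖Γ (t + 1)‖ ^ 2) / m) / m := by gcongr
    _ = _ := by
      simp only [W, Γ]
      field_simp
      ring

theorem sum_gradient_sq_le (hs : IsSmooth a D Lℓ Ca La Lga) {ℓ₀ : ℝ} (hℓ : ∀ w, ℓ₀ ≤ risk a D w)
    (θ : Hyper) (hm : 0 < θ.2.1) (hm1 : θ.2.1 < 1) (hγ : 0 < θ.2.2) (T : ℕ) (ω : ℕ → Noise d Z) :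
    ∑ t ∈ Finset.range T, ‖gradient (risk a D) (wts a QF QB w₁ θ (t + 1) ω)‖ ^ 2
      ≤ 2 / θ.2.2 * (risk a D w₁ - ℓ₀)
        + 2 * (‖gradient (risk a D) w₁‖ ^ 2 / θ.2.1
          + 2 * Lℓ ^ 2 / θ.2.1 ^ 2 * ∑ t ∈ Finset.range T,
            ‖wts a QF QB w₁ θ (t + 1) ω - wts a QF QB w₁ θ t ω‖ ^ 2
          + 2 * ∑ t ∈ Finset.range T, ‖gradErr a QF QB w₁ θ (t + 1) ω‖ ^ 2)
        + 2 * ∑ t ∈ Finset.range T, ‖noiseAvg a QF QB w₁ D θ (t + 1) ω‖ ^ 2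
        + (2 * Lℓ ^ 2 - 1 / (2 * θ.2.2 ^ 2)) * ∑ t ∈ Finset.range T,
          ‖wts a QF QB w₁ θ (t + 2) ω - wts a QF QB w₁ θ (t + 1) ω‖ ^ 2 := by
  have hstep : ∀ t, ‖gradient (risk a D) (wts a QF QB w₁ θ (t + 1) ω)‖ ^ 2
      ≤ 2 / θ.2.2 * (risk a D (wts a QF QB w₁ θ (t + 1) ω) - risk a D (wts a QF QB w₁ θ (t + 2) ω))
        + (2 * ‖biasIter a QF QB w₁ D θ (t + 1) ω‖ ^ 2
          + 2 * ‖noiseAvg a QF QB w₁ D θ (t + 1) ω‖ ^ 2)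
        + (2 * Lℓ ^ 2 - 1 / (2 * θ.2.2 ^ 2))
          * ‖wts a QF QB w₁ θ (t + 2) ω - wts a QF QB w₁ θ (t + 1) ω‖ ^ 2 := by
    intro t
    have h := hs.descent (wts a QF QB w₁ θ (t + 1) ω) (iter a QF QB w₁ θ (t + 1) ω).u hγ
    rw [← wts_succ] at h
    have h₁ : (iter a QF QB w₁ θ (t + 1) ω).u - gradient (risk a D) (wts a QF QB w₁ θ (t + 1) ω)
        = biasIter a QF QB w₁ D θ (t + 1) ω + noiseAvg a QF QB w₁ D θ (t + 1) ω := by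
      simp [biasIter]
    have h₂ : ‖biasIter a QF QB w₁ D θ (t + 1) ω + noiseAvg a QF QB w₁ D θ (t + 1) ω‖ ^ 2
        ≤ 2 * ‖biasIter a QF QB w₁ D θ (t + 1) ω‖ ^ 2
          + 2 * ‖noiseAvg a QF QB w₁ D θ (t + 1) ω‖ ^ 2 := by
      have := pow_le_pow_left₀ (norm_nonneg _)
        (norm_add_le (biasIter a QF QB w₁ D θ (t + 1) ω) (noiseAvg a QF QB w₁ D θ (t + 1) ω)) 2
      nlinarith [sq_nonneg (‖biasIter a QF QB w₁ D θ (t + 1) ω‖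
        - ‖noiseAvg a QF QB w₁ D θ (t + 1) ω‖)]
    rw [h₁] at h
    linarith
  have htel : ∑ t ∈ Finset.range T, (risk a D (wts a QF QB w₁ θ (t + 1) ω)
      - risk a D (wts a QF QB w₁ θ (t + 2) ω)) ≤ risk a D w₁ - ℓ₀ := by
    rw [Finset.sum_range_sub' fun t => risk a D (wts a QF QB w₁ θ (t + 1) ω)]
    have h0 : wts a QF QB w₁ θ (0 + 1) ω = w₁ := rfl
    rw [h0]
    linarith [hℓ (wts a QF QB w₁ θ (T + 1) ω)]
  refine (Finset.sum_le_sum fun t _ => hstep t).trans ?_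
  rw [Finset.sum_add_distrib, Finset.sum_add_distrib, Finset.sum_add_distrib, ← Finset.mul_sum,
    ← Finset.mul_sum, ← Finset.mul_sum, ← Finset.mul_sum]
  have h₁ := sum_biasIter_le (QF := QF) (QB := QB) (w₁ := w₁) hs θ hm hm1 T ω
  have h₂ := mul_le_mul_of_nonneg_left htel (show 0 ≤ 2 / θ.2.2 by positivity)
  linarith

theorem sum_Icc_one_eq {M : Type*} [AddCommMonoid M] (f : ℕ → M) (T : ℕ) :
    ∑ t ∈ Finset.Icc 1 T, f t = ∑ t ∈ Finset.range T, f (t + 1) := by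
  induction T with
  | zero => simp
  | succ n ih => rw [Finset.sum_Icc_succ_top (by omega), ih, Finset.sum_range_succ]

/-- The right-hand side is integrated by linearity, so the coefficients may have any sign; that of
the weight moves can be negative. -/
theorem integral_le_linear_comb {Ω : Type*} [MeasurableSpace Ω] {P : Measure Ω}
    [IsProbabilityMeasure P] {f : Ω → ℝ} {g : Fin 4 → Ω → ℝ} (hf : Integrable f P)
    (hg : ∀ i, Integrable (g i) P) (c : ℝ) (α : Fin 4 → ℝ)
    (h : ∀ ω, f ω ≤ c + ∑ i, α i * g i ω) :
    ∫ ω, f ω ∂P ≤ c + ∑ i, α i * ∫ ω, g i ω ∂P := by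
  have hi : ∀ i ∈ Finset.univ, Integrable (fun ω => α i * g i ω) P := fun i _ =>
    (hg i).const_mul (α i)
  refine (integral_mono hf ((integrable_const c).add (integrable_finsetSum _ hi)) h).trans_eq ?_
  simp only [Pi.add_apply]
  rw [integral_add (integrable_const c) (integrable_finsetSum _ hi), integral_finsetSum _ hi]
  simp only [integral_const_mul]
  simp

/-- Collects everything into one constant. Terms without `m` are absorbed into `C / m` or `C / m²`
since `m < 1`, while `-1 / (2γ²)` is kept exactly. -/
theorem descent_constant_le {Δ g₀ Cg κ K L X V V' G N R γ m : ℝ} (hΔ : 0 ≤ Δ) (hg₀ : 0 ≤ g₀)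
    (hCg : 0 ≤ Cg) (hκ : 0 ≤ κ) (hK : 0 ≤ K) (hX : 0 ≤ X) (hV : 0 ≤ V) (hR : 0 ≤ R)
    (hm : 0 < m) (hm1 : m < 1) (hγ : 0 < γ) (hV' : V' ≤ V) (hG : G ≤ Cg * (1 + X + V))
    (hN : N ≤ κ * R + K / m ^ 2 * V) :
    2 / γ * Δ + 2 * (g₀ / m + 2 * L ^ 2 / m ^ 2 * V' + 2 * G) + 2 * N
        + (2 * L ^ 2 - 1 / (2 * γ ^ 2)) * V
      ≤ (1 + 2 * Δ + 2 * g₀ + 4 * Cg + 2 * κ + 2 * K + 6 * L ^ 2) / γ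
        + (1 + 2 * Δ + 2 * g₀ + 4 * Cg + 2 * κ + 2 * K + 6 * L ^ 2) / m
        + (1 + 2 * Δ + 2 * g₀ + 4 * Cg + 2 * κ + 2 * K + 6 * L ^ 2) * X
        + (1 + 2 * Δ + 2 * g₀ + 4 * Cg + 2 * κ + 2 * K + 6 * L ^ 2) * R
        + ((1 + 2 * Δ + 2 * g₀ + 4 * Cg + 2 * κ + 2 * K + 6 * L ^ 2) / m ^ 2
          - 1 / (2 * γ ^ 2)) * V := by
  have hL : 0 ≤ L ^ 2 := sq_nonneg L
  obtain ⟨C, hC⟩ : ∃ C, C = 1 + 2 * Δ + 2 * g₀ + 4 * Cg + 2 * κ + 2 * K + 6 * L ^ 2 := ⟨_, rfl⟩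
  rw [← hC]
  have c₁ : 2 / γ * Δ ≤ C / γ := by
    rw [div_mul_eq_mul_div]
    gcongr
    linarith
  have c₂ : 2 * (g₀ / m) + 4 * Cg ≤ C / m := by
    have e : 4 * Cg ≤ 4 * Cg / m := le_div_self (by positivity) hm hm1.le
    have e' : (2 * g₀ + 4 * Cg) / m ≤ C / m := by
      gcongr
      linarith
    rw [add_div, mul_div_assoc] at e'
    linarith
  have c₃ : 4 * Cg * X ≤ C * X := by
    gcongr
    linarith
  have c₄ : 2 * κ * R ≤ C * R := by
    gcongr
    linarith
  have hm2 : m ^ 2 ≤ 1 := pow_le_one₀ hm.le hm1.le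
  have c₅ : 4 * L ^ 2 / m ^ 2 + 4 * Cg + 2 * (K / m ^ 2) + 2 * L ^ 2 ≤ C / m ^ 2 := by
    have e : 4 * Cg + 2 * L ^ 2 ≤ (4 * Cg + 2 * L ^ 2) / m ^ 2 :=
      le_div_self (by positivity) (by positivity) hm2
    have e' : (6 * L ^ 2 + 4 * Cg + 2 * K) / m ^ 2 ≤ C / m ^ 2 := by
      gcongr
      linarith
    have e'' : (6 * L ^ 2 + 4 * Cg + 2 * K) / m ^ 2
      = 4 * L ^ 2 / m ^ 2 + (4 * Cg + 2 * L ^ 2) / m ^ 2 + 2 * (K / m ^ 2) := by ring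
    linarith
  have c₆ := mul_le_mul_of_nonneg_right c₅ hV
  have c₇ := mul_le_mul_of_nonneg_left hV' (show 0 ≤ 4 * L ^ 2 / m ^ 2 by positivity)
  have c₈ : 2 * (2 * L ^ 2 / m ^ 2 * V') = 4 * L ^ 2 / m ^ 2 * V' := by ring
  simp only [add_mul, sub_mul] at c₆ ⊢
  linarith

variable (hD : Integrable (fun x => ‖x‖ ^ 2) D) (hs : IsSmooth a D Lℓ Ca La Lga)
  (hu : IsUnbiased a D σ) (hF : IsContractive QF ν ωF) (hB : IsContractive QB ν ωB)

include hs hu hF hB in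
theorem integrable_gradient_sq (θ : Hyper) (t : ℕ) :
    Integrable (fun ω => ‖gradient (risk a D) (wts a QF QB w₁ θ t ω)‖ ^ 2) (law D ν θ) := by
  obtain ⟨G, -, hG⟩ := hs.lossGrad_le
  refine (MemLp.of_bound ?_ G (ae_of_all _ fun ω => hs.gradient_risk_le hu hG _)).integrable_norm_sq
  exact ((continuous_gradient_risk hs).measurable.comp
    (measurable_wts hs hF hB θ t)).aestronglyMeasurable

include hD hs hu hF hB in
set_option maxHeartbeats 1000000 in
theorem exists_sum_gradient_sq_le {ℓ₀ : ℝ} (hℓ : ∀ w, ℓ₀ ≤ risk a D w) :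
    ∃ C, 0 < C ∧ ∀ (θ : Hyper) (T : ℕ), 0 < θ.2.1 → θ.2.1 < 1 → 0 < θ.2.2 →
      ∑ t ∈ Finset.range T,
          ∫ ω, ‖gradient (risk a D) (wts a QF QB w₁ θ (t + 1) ω)‖ ^ 2 ∂law D ν θ
        ≤ C / θ.2.2 + C / θ.2.1
          + C * ∑ t ∈ Finset.range T, ∫ ω, ‖(iter a QF QB w₁ θ (t + 2) ω).x
            - (iter a QF QB w₁ θ (t + 1) ω).x‖ ^ 2 ∂law D ν θ
          + C * (T * (σ ^ 2 * noiseFactor θ.1 θ.2.1))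
          + (C / θ.2.1 ^ 2 - 1 / (2 * θ.2.2 ^ 2)) * ∑ t ∈ Finset.range T,
            ∫ ω, ‖wts a QF QB w₁ θ (t + 2) ω - wts a QF QB w₁ θ (t + 1) ω‖ ^ 2 ∂law D ν θ := by
  obtain ⟨κ, K, hκ, hK, hnoise⟩ := sum_noiseAvg_le (w₁ := w₁) hD hs hu hF hB
  have hctrl := controlled_gradient_error (w₁ := w₁) hD hs hF hB
  obtain ⟨Cg, hCg, hgrad⟩ := hctrl.bound
  set Δ := risk a D w₁ - ℓ₀
  have hΔ : 0 ≤ Δ := sub_nonneg.2 (hℓ w₁)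
  set g₀ := ‖gradient (risk a D) w₁‖ ^ 2
  have hg₀ : 0 ≤ g₀ := by positivity
  refine ⟨1 + 2 * Δ + 2 * g₀ + 4 * Cg + 2 * κ + 2 * K + 6 * Lℓ ^ 2, by positivity,
    fun θ T hm hm1 hγ => ?_⟩
  set C := 1 + 2 * Δ + 2 * g₀ + 4 * Cg + 2 * κ + 2 * K + 6 * Lℓ ^ 2
  set P := law D ν θ
  set m := θ.2.1
  set γ := θ.2.2
  set W := wts a QF QB w₁ θ
  set N := noiseAvg a QF QB w₁ D θ
  set Γ := gradErr a QF QB w₁ θ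
  set X := ∑ t ∈ Finset.range T, ∫ ω, ‖(iter a QF QB w₁ θ (t + 2) ω).x
            - (iter a QF QB w₁ θ (t + 1) ω).x‖ ^ 2 ∂P
  set V := ∑ t ∈ Finset.range T, ∫ ω, ‖W (t + 2) ω - W (t + 1) ω‖ ^ 2 ∂P
  have hWm : ∀ s t, MemLp (fun ω => W s ω - W t ω) 2 P := fun s t =>
    (memLp_wts hD hs hF hB θ _).sub (memLp_wts hD hs hF hB θ _)
  have hNm : ∀ t, MemLp (N t) 2 P := memLp_noiseAvg hs hu hF hB θ hm hm1
  have hΓm : ∀ t, MemLp (Γ t) 2 P := fun t => hctrl.memLp θ t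
  have iG : ∀ t ∈ Finset.range T, Integrable
      (fun ω => ‖gradient (risk a D) (W (t + 1) ω)‖ ^ 2) P := fun t _ =>
    integrable_gradient_sq hs hu hF hB θ (t + 1)
  have iV : ∀ t ∈ Finset.range T, Integrable (fun ω => ‖W (t + 2) ω - W (t + 1) ω‖ ^ 2) P :=
    fun t _ => (hWm _ _).integrable_norm_sq
  have iV' : ∀ t ∈ Finset.range T, Integrable (fun ω => ‖W (t + 1) ω - W t ω‖ ^ 2) P :=
    fun t _ => (hWm _ _).integrable_norm_sq
  have iN : ∀ t ∈ Finset.range T, Integrable (fun ω => ‖N (t + 1) ω‖ ^ 2) P :=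
    fun t _ => (hNm _).integrable_norm_sq
  have iΓ : ∀ t ∈ Finset.range T, Integrable (fun ω => ‖Γ (t + 1) ω‖ ^ 2) P :=
    fun t _ => (hΓm _).integrable_norm_sq
  have h₁ : ∑ t ∈ Finset.range T, ∫ ω, ‖gradient (risk a D) (W (t + 1) ω)‖ ^ 2 ∂P
      ≤ 2 / γ * Δ + 2 * (g₀ / m + 2 * Lℓ ^ 2 / m ^ 2 * (∑ t ∈ Finset.range T,
            ∫ ω, ‖W (t + 1) ω - W t ω‖ ^ 2 ∂P)
          + 2 * ∑ t ∈ Finset.range T, ∫ ω, ‖Γ (t + 1) ω‖ ^ 2 ∂P)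
        + 2 * (∑ t ∈ Finset.range T, ∫ ω, ‖N (t + 1) ω‖ ^ 2 ∂P)
        + (2 * Lℓ ^ 2 - 1 / (2 * γ ^ 2)) * V := by
    simp only [V]
    rw [← integral_finsetSum _ iG, ← integral_finsetSum _ iV, ← integral_finsetSum _ iV',
      ← integral_finsetSum _ iN, ← integral_finsetSum _ iΓ]
    have jG := integrable_finsetSum _ iG
    have jV := integrable_finsetSum _ iV
    have jV' := integrable_finsetSum _ iV'
    have jN := integrable_finsetSum _ iN
    have jΓ := integrable_finsetSum _ iΓ
    have hg : ∀ i, Integrable ((![fun ω => ∑ t ∈ Finset.range T, ‖W (t + 1) ω - W t ω‖ ^ 2,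
        fun ω => ∑ t ∈ Finset.range T, ‖Γ (t + 1) ω‖ ^ 2,
        fun ω => ∑ t ∈ Finset.range T, ‖N (t + 1) ω‖ ^ 2,
        fun ω => ∑ t ∈ Finset.range T, ‖W (t + 2) ω - W (t + 1) ω‖ ^ 2] :
          Fin 4 → (ℕ → Noise d Z) → ℝ) i) P := by
      intro i
      fin_cases i
      exacts [jV', jΓ, jN, jV]
    have h := integral_le_linear_comb jG hg (2 / γ * Δ + 2 * (g₀ / m))
      ![4 * Lℓ ^ 2 / m ^ 2, 4, 2, 2 * Lℓ ^ 2 - 1 / (2 * γ ^ 2)] fun ω => by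
        refine (sum_gradient_sq_le (QF := QF) (QB := QB) (w₁ := w₁) hs hℓ θ hm hm1 hγ T ω).trans_eq
          ?_
        simp only [Fin.sum_univ_four, Matrix.cons_val]
        ring
    refine h.trans_eq ?_
    simp only [Fin.sum_univ_four, Matrix.cons_val]
    ring
  have hprev : ∑ t ∈ Finset.range T, ∫ ω, ‖W (t + 1) ω - W t ω‖ ^ 2 ∂P ≤ V :=
    sum_move_prev_le θ T
  have hn := hnoise θ T hm hm1
  have hgr : ∑ t ∈ Finset.range T, ∫ ω, ‖Γ (t + 1) ω‖ ^ 2 ∂P ≤ Cg * (1 + X + V) := hgrad θ T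
  have hV : 0 ≤ V := sum_move_nonneg P (fun t ω => W (t + 2) ω - W (t + 1) ω) T
  have hX : 0 ≤ X := sum_move_nonneg P
    (fun t ω => (iter a QF QB w₁ θ (t + 2) ω).x - (iter a QF QB w₁ θ (t + 1) ω).x) T
  have hR : 0 ≤ noiseFactor θ.1 m :=
    (show 0 ≤ m / ((θ.1 : ℝ) + 2 * m) from div_nonneg hm.le (by linarith [θ.1.2.1])).trans
      (div_le_noiseFactor θ.1.2.1 θ.1.2.2 hm hm1 le_rfl)
  have hR' : 0 ≤ T * (σ ^ 2 * noiseFactor θ.1 m) := by positivity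
  exact h₁.trans (descent_constant_le hΔ hg₀ hCg hκ hK hX hV hR' hm hm1 hγ hprev hgr hn)

end Descent

end Clapping

/-! ### The averaged bound -/

theorem mainTheorem3 {E : ℕ} (hE : 2 ≤ E) (d : Fin (E + 1) → ℕ) (dw : Fin E → ℕ)
    (hd : d (Fin.last E) = 1)
    (a : Clapping.Operators d dw)
    (D : Measure (Clapping.Act d 0)) [IsProbabilityMeasure D]
    (hD : Integrable (fun x => ‖x‖ ^ 2) D)
    {Z : Type*} [MeasurableSpace Z] (ν : Measure Z) [IsProbabilityMeasure ν]
    (QF QB : Clapping.Compressors d Z) (w₁ : Clapping.Params dw)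
    (Lℓ Ca La Lga σ ωF ωB : ℝ)
    (hbdd : BddBelow (Set.range (Clapping.risk a D)))
    (hsmooth : Clapping.IsSmooth a D Lℓ Ca La Lga)
    (hunb : Clapping.IsUnbiased a D σ)
    (hF : Clapping.IsContractive QF ν ωF) (hB : Clapping.IsContractive QB ν ωB) :
    ∃ C : ℝ, 0 < C ∧
      ∀ (T : ℕ) (p : unitInterval) (m γ : ℝ), 1 ≤ T → 0 < m → m < 1 → 0 < γ →
        let P := Clapping.pathLaw D ν p
        let x := Clapping.sample a QF QB w₁ γ m
        let w := Clapping.weights a QF QB w₁ γ m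
        (∀ t ∈ Finset.Icc 1 T,
          Integrable (fun ω => ‖gradient (Clapping.risk a D) (w t ω)‖ ^ 2) P ∧
          Integrable (fun ω => ‖x (t + 1) ω - x t ω‖ ^ 2) P ∧
          ∀ e, Integrable (fun ω => ‖w (t + 1) ω e - w t ω e‖ ^ 2) P) ∧
        1 / (T : ℝ) * ∑ t ∈ Finset.Icc 1 T,
            ∫ ω, ‖gradient (Clapping.risk a D) (w t ω)‖ ^ 2 ∂P
          ≤ C * (1 / (γ * T)) + C * (1 / (m * T))
            + C * (1 / (T : ℝ) * ∑ t ∈ Finset.Icc 1 T, ∫ ω, ‖x (t + 1) ω - x t ω‖ ^ 2 ∂P)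
            + C * (σ ^ 2 * (((2 - (p : ℝ)) * m - (1 - (p : ℝ)) * m ^ 2)
                / (1 - (1 - (p : ℝ)) * (1 - m) ^ 2)))
            + 1 / (T : ℝ) * (C / m ^ 2 - 1 / (2 * γ ^ 2)) *
              ∑ e, ∑ t ∈ Finset.Icc 1 T, ∫ ω, ‖w (t + 1) ω e - w t ω e‖ ^ 2 ∂P := by
  obtain ⟨ℓ₀, hℓ⟩ := hbdd
  obtain ⟨C, hC, hmain⟩ := Clapping.exists_sum_gradient_sq_le (w₁ := w₁) hD hsmooth hunb hF hB
    (ℓ₀ := ℓ₀) (fun w => hℓ ⟨w, rfl⟩)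
  refine ⟨C, hC, fun T p m γ hT hm hm1 hγ => ?_⟩
  intro P x w
  set θ : Clapping.Hyper := (p, m, γ)
  have hwe : ∀ t e, MemLp (fun ω => w (t + 1) ω e - w t ω e) 2 P := fun t e =>
    (Clapping.memLp_params_apply (Clapping.measurable_wts hsmooth hF hB θ (t + 1))
      (Clapping.memLp_wts hD hsmooth hF hB θ (t + 1)) e).sub
    (Clapping.memLp_params_apply (Clapping.measurable_wts hsmooth hF hB θ t)
      (Clapping.memLp_wts hD hsmooth hF hB θ t) e)
  refine ⟨fun t _ => ⟨Clapping.integrable_gradient_sq hsmooth hunb hF hB θ t,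
    ((Clapping.memLp_iter_x hD hsmooth hF hB θ (t + 1)).sub
      (Clapping.memLp_iter_x hD hsmooth hF hB θ t)).integrable_norm_sq,
    fun e => (hwe t e).integrable_norm_sq⟩, ?_⟩
  -- The squared blocks of the workers add up to the squared Euclidean norm.
  have hw : ∑ e, ∑ t ∈ Finset.Icc 1 T, ∫ ω, ‖w (t + 1) ω e - w t ω e‖ ^ 2 ∂P
      = ∑ t ∈ Finset.range T, ∫ ω, ‖w (t + 2) ω - w (t + 1) ω‖ ^ 2 ∂P := by
    rw [Finset.sum_comm, Clapping.sum_Icc_one_eq]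
    refine Finset.sum_congr rfl fun t _ => ?_
    rw [← integral_finsetSum _ fun e _ => (hwe (t + 1) e).integrable_norm_sq]
    simp only [PiLp.norm_sq_eq_of_L2]
    rfl
  have h : ∑ t ∈ Finset.range T, ∫ ω, ‖gradient (Clapping.risk a D) (w (t + 1) ω)‖ ^ 2 ∂P
      ≤ C / γ + C / m + C * ∑ t ∈ Finset.range T, ∫ ω, ‖x (t + 2) ω - x (t + 1) ω‖ ^ 2 ∂P
        + C * (T * (σ ^ 2 * Clapping.noiseFactor p m))
        + (C / m ^ 2 - 1 / (2 * γ ^ 2)) *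
          ∑ t ∈ Finset.range T, ∫ ω, ‖w (t + 2) ω - w (t + 1) ω‖ ^ 2 ∂P :=
    hmain θ T hm hm1 hγ
  have hT' : (0 : ℝ) < T := by exact_mod_cast hT
  rw [hw, Clapping.sum_Icc_one_eq, Clapping.sum_Icc_one_eq]
  have h' := mul_le_mul_of_nonneg_left h (show 0 ≤ 1 / (T : ℝ) by positivity)
  refine h'.trans_eq ?_
  simp only [Clapping.noiseFactor]
  generalize ((2 - (p : ℝ)) * m - (1 - (p : ℝ)) * m ^ 2)
    / (1 - (1 - (p : ℝ)) * (1 - m) ^ 2) = r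
  generalize ∑ t ∈ Finset.range T, ∫ ω, ‖w (t + 2) ω - w (t + 1) ω‖ ^ 2 ∂P = V
  rw [show ∑ t ∈ Finset.range T, ∫ ω, ‖x (t + 1 + 1) ω - x (t + 1) ω‖ ^ 2 ∂P
    = ∑ t ∈ Finset.range T, ∫ ω, ‖x (t + 2) ω - x (t + 1) ω‖ ^ 2 ∂P from rfl]
  generalize ∑ t ∈ Finset.range T, ∫ ω, ‖x (t + 2) ω - x (t + 1) ω‖ ^ 2 ∂P = X
  field_simp
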